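/- Let $\mathcal E$ be a Grothendieck topos over $\mathcal S=\mathrm{Sets}$, with structure morphism $\gamma:\mathcal E\to\mathcal S$. A cover is a small epimorphic family $\mathcal U=\{U_i\to 1\}_{i\in I}$ with all $U_i\neq\emptyset$; a refinement $\mathcal U\to\mathcal V=\{V_j\}_{j\in J}$ is a map $\alpha:I\to J$ with arrows $h_i:U_i\to V_{\alpha(i)}$. These form a category $\mathrm{Cov}(\mathcal E)$. Let $\mathcal P_{\mathcal U}$ be the category of triples $(X,(S_i)_{i\in I},\theta)$, where $X\in\mathcal E$, the $S_i$ are sets and $\theta_i:\gamma^*S_i\times U_i\cong X\times U_i$ are isomorphisms over $U_i$; its arrows are pairs $(f:X\to Y,\ (\vartheta_i:S_i\to T_i)_i)$ compatible with the $\theta_i$. Let $\sigma_{ji}:\gamma^*S_i\times U_i\times U_j\to\gamma^*S_j\times U_j\times U_i$ be the induced descent datum. An action triple $(u,v,s)$ consists of $u:C\to U_i$, $v:C\to U_j$ with $C\neq\emptyset$ and a bijection $s:S_i\to S_j$ such that $\sigma_{ji}\circ(\gamma^*S_i\times(u,v))=(\gamma^*S_j\times(v,u))\circ(\gamma^*s\times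 C)$. The object is a covering projection if, for all $i,j$ with $U_i\times U_j\neq\emptyset$, the arrows $(u,v):C\to U_i\times U_j$ coming from action triples form an epimorphic family. Let $\mathcal G_{\mathcal U}\subset\mathcal P_{\mathcal U}$ be the full subcategory of the (small) sums of covering projections. A refinement $(h,\alpha):\mathcal U\to\mathcal V$ induces a functor $(h,\alpha)^*:\mathcal G_{\mathcal V}\to\mathcal G_{\mathcal U}$, which keeps $X$, replaces $(T_j)$ by $(T_{\alpha(i)})$ and pulls back the trivializations. Let $c\mathcal G(\mathcal E)$ be the category whose objects are the pairs $(X,\mathcal U)$ of a cover and a covering projection trivialized by it, an arrow $(X,\mathcal U)\to(Y,\mathcal V)$ being an arrow $f:X\to Y$ of $\mathcal E$ that lifts to an arrow $h^*X\to l^*Y$ of $\mathcal G_{\mathcal W}$ for some refinements $h:\mathcal W\to\mathcal U$, $l:\mathcal W\to\mathcal V$. Give $c\mathcal G(\mathcal E)$ the Grothendieck topology generated by the families of covering projections trivialized by one cover $\mathcal U$ that are epimorphic in $\mathcal G_{\mathcal U}$, for all $\mathcal U$, and let $\mathcal G(\mathcal E)$ be the category of sheaves of sets. Theorem. The $\mathcal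 G_{\mathcal U}$ and $\mathcal G(\mathcal E)$ are Grothendieck topoi, and the functors $(h,\alpha)^*$ are the inverse images of geometric morphisms $\mathcal G_{\mathcal U}\to\mathcal G_{\mathcal V}$. There are geometric morphisms $\lambda_{\mathcal U}:\mathcal G(\mathcal E)\to\mathcal G_{\mathcal U}$ whose inverse images send a covering projection $X$ trivialized by $\mathcal U$ to the sheaf associated with the presheaf represented by $(X,\mathcal U)$, functorially in $X$. They form a pseudo-cone over the system $(\mathcal G_{\mathcal U})_{\mathcal U\in\mathrm{Cov}(\mathcal E)}$, whose structural isomorphisms are, on covering projections $X$ trivialized by $\mathcal V$, those induced by the isomorphisms $\mathrm{id}_X:(h^*X,\mathcal U)\cong(X,\mathcal V)$ of $c\mathcal G(\mathcal E)$. This pseudo-cone is a limit cone in the 2-category $\mathcal Top_{\mathcal S}$ of Grothendieck topoi, geometric morphisms and natural transformations of inverse images: for every Grothendieck topos $\mathcal T$, composition with the $\lambda_{\mathcal U}$ is an equivalence from the category of geometric morphisms $\mathcal T\to\mathcal G(\mathcal E)$ to the category of pseudo-cones with vertex $\mathcal T$ over the system $(\mathcal G_{\mathcal U})$. -/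

import Mathlib

open CategoryTheory Limits Opposite

universe u v w

noncomputable section

namespace FundTopos

/-! ### Grothendieck topoi and epimorphic families -/

/-- A Grothendieck topos (over the topos of `u`-small sets): a category equivalent to the category
of sheaves of sets on a small site. -/
class IsGrothendieckTopos (E : Type w) [Category.{v} E] : Prop where
  exists_site : ∃ (C : Type u) (_ : SmallCategory C) (J : GrothendieckTopology C),
    Nonempty (E ≌ Sheaf J (Type u))

/-- A family of arrows with common codomain is epimorphic if it is jointly right-cancellable. -/
def EpiFamily {C : Type w} [Category.{v} C] {A : Sort*} {X : C} {Y : A → C}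
    (f : ∀ a, Y a ⟶ X) : Prop :=
  ∀ ⦃Z : C⦄ (p q : X ⟶ Z), (∀ a, f a ≫ p = f a ≫ q) → p = q

/-- `X ≠ ∅`, that is, `X` is not an initial object. -/
def NonEmpty {C : Type w} [Category.{v} C] (X : C) : Prop := IsEmpty (IsInitial X)

section Aux

def tensorObjIso {C : Type w} [Category.{v} C] [CartesianMonoidalCategory C]
    [HasBinaryProducts C] (U X : C) : MonoidalCategory.tensorObj U X ≅ U ⨯ X where
  hom := prod.lift (SemiCartesianMonoidalCategory.fst U X) (SemiCartesianMonoidalCategory.snd U X)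
  inv := CartesianMonoidalCategory.lift prod.fst prod.snd
  hom_inv_id := by 
    apply CartesianMonoidalCategory.hom_ext
    · simpa using prod.lift_fst _ _
    · simpa using prod.lift_snd _ _
  inv_hom_id := by apply Limits.prod.hom_ext <;> simp

def tensorIsoProd {C : Type w} [Category.{v} C] [CartesianMonoidalCategory C]
    [HasBinaryProducts C] (U : C) : MonoidalCategory.tensorLeft U ≅ prod.functor.obj U :=
  NatIso.ofComponents (tensorObjIso U) (by
    intro X Y f
    change MonoidalCategoryStruct.whiskerLeft U f ≫ (tensorObjIso U Y).hom =
      (tensorObjIso U X).hom ≫ prod.map (𝟙 U) f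
    apply Limits.prod.hom_ext <;> simp [tensorObjIso])

variable {C : Type u} [SmallCategory C] {J : GrothendieckTopology C}

/-- Epimorphic families of sheaves are locally surjective. -/
theorem locally_surjective {A : Sort*} {X : Sheaf J (Type u)} {Y : A → Sheaf J (Type u)}
    {f : ∀ a, Y a ⟶ X} (hf : EpiFamily f) {c : C} (x : X.obj.obj (op c)) :
    ∃ S ∈ J c, ∀ ⦃d : C⦄ (k : d ⟶ c), S k →
      ∃ (a : A) (y : (Y a).obj.obj (op d)), (f a).hom.app (op d) y = X.obj.map k.op x := by
  let G : Subfunctor X.obj :=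
    { obj := fun c => {x | ∃ (a : A) (y : (Y a).obj.obj c), (f a).hom.app c y = x}
      map := by
        rintro U V i x ⟨a, y, rfl⟩
        exact ⟨a, (Y a).obj.map i y, by
          have := (f a).hom.naturality i
          exact ConcreteCategory.congr_hom this y⟩ }
  have hX := (isSheaf_iff_isSheaf_of_type J X.obj).1 X.property
  have hs : Presieve.IsSheaf J (G.sheafify J).toFunctor := Subfunctor.sheafify_isSheaf G hX
  let M : Sheaf J (Type u) := ⟨(G.sheafify J).toFunctor, (isSheaf_iff_isSheaf_of_type _ _).2 hs⟩
  let m : M ⟶ X := ⟨(G.sheafify J).ι⟩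
  have : Mono m.hom := inferInstanceAs (Mono (G.sheafify J).ι)
  have : Mono m := (sheafToPresheaf J (Type u)).mono_of_mono_map
    (inferInstanceAs (Mono m.hom))
  let g : ∀ a, Y a ⟶ M := fun a => ⟨Subfunctor.lift (f a).hom (by
      intro c x hx
      obtain ⟨y, rfl⟩ := hx
      exact G.le_sheafify J _ ⟨a, y, rfl⟩)⟩
  have hg : ∀ a, g a ≫ m = f a := fun a => rfl
  have : Epi m := ⟨fun p q h => hf p q fun a => by
    rw [← hg, Category.assoc, Category.assoc, h]⟩
  have : IsIso m := Balanced.isIso_of_mono_of_epi m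
  have hx : x ∈ (G.sheafify J).obj (op c) := by
    have h1 : inv m ≫ m = 𝟙 X := IsIso.inv_hom_id m
    have h2 := congrArg (fun t => t.hom.app (op c)) h1
    have h3 := ConcreteCategory.congr_hom h2 x
    have h4 : (m.hom.app (op c) ((inv m).hom.app (op c) x)) = x := h3
    rw [← h4]
    exact ((inv m).hom.app (op c) x).2
  exact ⟨_, hx, fun d k hk => hk⟩

theorem sheaf_epi_pullback {A : Sort*} {X : Sheaf J (Type u)} {Y : A → Sheaf J (Type u)}
    {f : ∀ a, Y a ⟶ X} (hf : EpiFamily f) {W Z : Sheaf J (Type u)} (g : W ⟶ X) (p q : W ⟶ Z)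
    (H : ∀ a ⦃D : Sheaf J (Type u)⦄ (k : D ⟶ W) (l : D ⟶ Y a), k ≫ g = l ≫ f a →
      k ≫ p = k ≫ q) : p = q := by
  apply (sheafToPresheaf J (Type u)).map_injective
  ext ⟨c⟩ y
  change p.hom.app (op c) y = q.hom.app (op c) y
  obtain ⟨S, hS, h⟩ := locally_surjective hf (g.hom.app (op c) y)
  have hZ := (isSheaf_iff_isSheaf_of_type J Z.obj).1 Z.property
  refine (hZ S hS).isSeparatedFor.ext fun d k hk => ?_
  obtain ⟨a, x, hx⟩ := h k hk
  let Fn : Sheaf J (Type u) ⥤ Type u := sheafToPresheaf J (Type u) ⋙ (evaluation _ _).obj (op d)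
  have sq := (IsPullback.of_hasPullback g (f a)).map Fn
  have e : g.hom.app (op d) (W.obj.map k.op y) = (f a).hom.app (op d) x := by
    rw [hx]
    exact ConcreteCategory.congr_hom (g.hom.naturality k.op) y
  obtain ⟨z, hz, -⟩ := Types.exists_of_isPullback sq (W.obj.map k.op y) x e
  have e1 := H a (pullback.fst g (f a)) (pullback.snd g (f a)) pullback.condition
  have e2 := ConcreteCategory.congr_hom
    (congrArg (fun t : pullback g (f a) ⟶ Z => t.hom.app (op d)) e1) z
  have e3 : p.hom.app (op d) ((pullback.fst g (f a)).hom.app (op d) z) =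
    q.hom.app (op d) ((pullback.fst g (f a)).hom.app (op d) z) := e2
  have hz' : (pullback.fst g (f a)).hom.app (op d) z = W.obj.map k.op y := hz
  rw [hz'] at e3
  have n1 := ConcreteCategory.congr_hom (p.hom.naturality k.op) y
  have n2 := ConcreteCategory.congr_hom (q.hom.naturality k.op) y
  exact n1.symm.trans (e3.trans n2)

theorem sheaf_hasColimits (A : Type u) : HasColimitsOfShape (Discrete A) (Sheaf J (Type u)) :=
  Sheaf.instHasColimitsOfShape

@[reducible] def sheafMonoidalClosed : MonoidalClosed (Sheaf J (Type u)) := inferInstance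

end Aux

section Topos

variable {E : Type (u + 1)} [Category.{u} E] [IsGrothendieckTopos.{u} E]

instance : HasFiniteLimits E := by
  obtain ⟨C, _, J, ⟨e⟩⟩ := IsGrothendieckTopos.exists_site (E := E)
  exact ⟨fun K _ _ => Adjunction.hasLimitsOfShape_of_equivalence e.functor⟩

instance : HasCoproducts.{u} E := by
  obtain ⟨C, _, J, ⟨e⟩⟩ := IsGrothendieckTopos.exists_site (E := E)
  have : ∀ A : Type u, HasColimitsOfShape (Discrete A) (Sheaf J (Type u)) := sheaf_hasColimits
  exact fun K => Adjunction.hasColimitsOfShape_of_equivalence e.functor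

/-- Epimorphic families in a topos are stable under pullback. -/
theorem EpiFamily.pullback' {A : Sort*} {X : E} {Y : A → E} {f : ∀ a, Y a ⟶ X}
    (hf : EpiFamily f) {W Z : E} (g : W ⟶ X) (p q : W ⟶ Z)
    (H : ∀ a ⦃D : E⦄ (k : D ⟶ W) (l : D ⟶ Y a), k ≫ g = l ≫ f a → k ≫ p = k ≫ q) : p = q := by
  obtain ⟨C, _, J, ⟨e⟩⟩ := IsGrothendieckTopos.exists_site (E := E)
  have hf' : EpiFamily fun a => e.functor.map (f a) := by
    intro Z p q h
    have key : ∀ r : e.functor.obj X ⟶ Z, e.functor.map (e.unit.app X ≫ e.inverse.map r) =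
        r ≫ e.counitInv.app Z := by
      intro r
      simp
    have := hf (e.unit.app X ≫ e.inverse.map p) (e.unit.app X ≫ e.inverse.map q) (by
      intro a
      apply e.functor.map_injective
      rw [Functor.map_comp, key, Functor.map_comp, key, ← Category.assoc, h a, Category.assoc])
    have h2 := congrArg e.functor.map this
    rw [key, key] at h2
    exact (cancel_mono _).1 h2
  apply e.functor.map_injective
  refine sheaf_epi_pullback hf' (e.functor.map g) _ _ fun a D k l hkl => ?_
  obtain ⟨D', ⟨i⟩⟩ : ∃ D', Nonempty (e.functor.obj D' ≅ D) := ⟨_, ⟨e.functor.objObjPreimageIso D⟩⟩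
  obtain ⟨k', hk'⟩ := e.functor.map_surjective (i.hom ≫ k)
  obtain ⟨l', hl'⟩ := e.functor.map_surjective (i.hom ≫ l)
  have := H a k' l' (e.functor.map_injective (by simp [hk', hl', hkl]))
  have h2 := congrArg e.functor.map this
  simpa [hk'] using h2

/-- There is a small set of generators. -/
theorem exists_generators : ∃ (A : Type u) (G : A → E), ∀ ⦃X Y : E⦄ (p q : X ⟶ Y),
    (∀ a (k : G a ⟶ X), k ≫ p = k ≫ q) → p = q := by
  obtain ⟨C, _, J, ⟨e⟩⟩ := IsGrothendieckTopos.exists_site (E := E)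
  have hs : ObjectProperty.IsSeparating (.ofObj (fun _ : PUnit.{u + 1} => (PUnit : Type u))) := by
    intro X Y f g h
    ext x
    exact ConcreteCategory.congr_hom (h PUnit (ObjectProperty.ofObj_apply _ PUnit.unit)
      (↾fun _ => x)) PUnit.unit
  have := Sheaf.isSeparating J hs
  refine ⟨C × PUnit.{u + 1}, fun c => e.inverse.obj (Sheaf.freeYoneda J c.1 (PUnit : Type u)),
    fun X Y p q h => e.functor.map_injective (this _ _ ?_)⟩
  rintro _ ⟨c⟩ k
  have h1 := h c (e.inverse.map k ≫ e.unitInv.app X)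
  have h2 := congrArg e.functor.map h1
  simp only [Functor.map_comp, Category.assoc] at h2
  simp at h2
  exact h2

/-- Multiplication by an object preserves sums. -/
theorem prod_preserves (U : E) (A : Type u) :
    PreservesColimitsOfShape (Discrete A) (prod.functor.obj U) := by
  obtain ⟨C, _, J, ⟨e⟩⟩ := IsGrothendieckTopos.exists_site (E := E)
  let : CartesianMonoidalCategory E := CartesianMonoidalCategory.ofHasFiniteProducts
  let : MonoidalClosed E :=
    @cartesianClosedOfEquiv (Sheaf J (Type u)) _ _ E _ _ e.symm sheafMonoidalClosed
  exact preservesColimitsOfShape_of_natIso (tensorIsoProd U)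

end Topos

/-! ### Covers and locally constant objects -/

section ProdLemmas

variable {C : Type w} [Category.{v} C] [HasBinaryProducts C] {W X Y Z : C}

@[simp] lemma lift_fst_simp (f : W ⟶ X) (g : W ⟶ Y) : prod.lift f g ≫ prod.fst = f :=
  prod.lift_fst f g

@[simp] lemma lift_snd_simp (f : W ⟶ X) (g : W ⟶ Y) : prod.lift f g ≫ prod.snd = g :=
  prod.lift_snd f g

@[simp] lemma lift_fst_assoc_simp (f : W ⟶ X) (g : W ⟶ Y) (k : X ⟶ Z) :
    prod.lift f g ≫ prod.fst ≫ k = f ≫ k := by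
  rw [← Category.assoc, prod.lift_fst]

@[simp] lemma lift_snd_assoc_simp (f : W ⟶ X) (g : W ⟶ Y) (k : Y ⟶ Z) :
    prod.lift f g ≫ prod.snd ≫ k = g ≫ k := by
  rw [← Category.assoc, prod.lift_snd]

end ProdLemmas

section Covers

variable (E : Type (u + 1)) [Category.{u} E] [IsGrothendieckTopos.{u} E]

/-- The inverse image `γ^*` of the structure morphism `E ⟶ Set`: it sends a set `S` to the sum of
`S` copies of the terminal object. (Its right adjoint is the global sections functor.) -/
def gammaStar : Type u ⥤ E := sigmaConst.obj (⊤_ E)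

/-- A cover of the topos `E`: a small epimorphic family `U i ⟶ 1` of non-empty objects. -/
structure Cover where
  I : Type u
  U : I → E
  nonempty : ∀ i, NonEmpty (U i)
  epi : EpiFamily fun i => terminal.from (U i)

variable {E}

/-- A refinement `𝒰 ⟶ 𝒱`: a map `α` of index sets and arrows `U i ⟶ V (α i)`. -/
@[ext]
structure Cover.Hom (𝒰 𝒱 : Cover E) where
  α : 𝒰.I → 𝒱.I
  h : ∀ i, 𝒰.U i ⟶ 𝒱.U (α i)

instance : Category (Cover E) where
  Hom := Cover.Hom
  id 𝒰 := ⟨fun i => i, fun _ => 𝟙 _⟩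
  comp f g := ⟨fun i => g.α (f.α i), fun i => f.h i ≫ g.h (f.α i)⟩

@[simp] lemma Cover.id_α (𝒰 : Cover E) (i : 𝒰.I) : Cover.Hom.α (𝟙 𝒰) i = i := rfl
@[simp] lemma Cover.id_h (𝒰 : Cover E) (i : 𝒰.I) : Cover.Hom.h (𝟙 𝒰) i = 𝟙 _ := rfl
@[simp] lemma Cover.comp_α {𝒰 𝒱 𝒲 : Cover E} (f : 𝒰 ⟶ 𝒱) (g : 𝒱 ⟶ 𝒲) (i : 𝒰.I) :
    Cover.Hom.α (f ≫ g) i = g.α (f.α i) := rfl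
@[simp] lemma Cover.comp_h {𝒰 𝒱 𝒲 : Cover E} (f : 𝒰 ⟶ 𝒱) (g : 𝒱 ⟶ 𝒲) (i : 𝒰.I) :
    Cover.Hom.h (f ≫ g) i = f.h i ≫ g.h (f.α i) := rfl

/-- A locally constant object split by `𝒰`: an object `X` with a family of sets `S i` and a
trivialization `θ i : γ^*(S i) × U i ≅ X × U i` over `U i`. -/
structure LocConst (𝒰 : Cover E) where
  X : E
  S : 𝒰.I → Type u
  θ : ∀ i, ((gammaStar E).obj (S i) ⨯ 𝒰.U i) ≅ (X ⨯ 𝒰.U i)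
  θ_snd : ∀ i, (θ i).hom ≫ prod.snd = prod.snd

/-- Morphisms of locally constant objects split by `𝒰`: an arrow `f` of `E` and functions
`S i → T i` compatible with the trivializations. -/
@[ext]
structure LocConst.Hom {𝒰 : Cover E} (X Y : LocConst 𝒰) where
  f : X.X ⟶ Y.X
  ϑ : ∀ i, X.S i → Y.S i
  comm : ∀ i, prod.map ((gammaStar E).map (↾(ϑ i))) (𝟙 (𝒰.U i)) ≫ (Y.θ i).hom =
    (X.θ i).hom ≫ prod.map f (𝟙 (𝒰.U i))

/-- The category (push-out topos) `P_𝒰` of locally constant objects split by `𝒰`. -/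
instance (𝒰 : Cover E) : Category (LocConst 𝒰) where
  Hom := LocConst.Hom
  id X := ⟨𝟙 _, fun _ x => x, fun i => by
    have : (↾(fun x : X.S i => x)) = 𝟙 (X.S i) := rfl
    rw [this, CategoryTheory.Functor.map_id, Limits.prod.map_id_id, Limits.prod.map_id_id,
      Category.id_comp,
      Category.comp_id]⟩
  comp {X Y Z} a b := ⟨a.f ≫ b.f, fun i x => b.ϑ i (a.ϑ i x), fun i => by
    have : (↾(fun x : X.S i => b.ϑ i (a.ϑ i x))) = ↾(a.ϑ i) ≫ ↾(b.ϑ i) := rfl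
    have e1 := prod.map_map ((gammaStar E).map (↾(a.ϑ i))) (𝟙 (𝒰.U i))
      ((gammaStar E).map (↾(b.ϑ i))) (𝟙 (𝒰.U i))
    have e2 := prod.map_map a.f (𝟙 (𝒰.U i)) b.f (𝟙 (𝒰.U i))
    rw [Category.comp_id] at e1 e2
    rw [this, CategoryTheory.Functor.map_comp, ← e1, Category.assoc, b.comm, ← Category.assoc, a.comm,
      Category.assoc, e2]⟩
  id_comp _ := LocConst.Hom.ext (Category.id_comp _) rfl
  comp_id _ := LocConst.Hom.ext (Category.comp_id _) rfl
  assoc _ _ _ := LocConst.Hom.ext (Category.assoc _ _ _) rfl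

namespace LocConst

variable {𝒰 𝒱 𝒲 : Cover E}

@[ext] lemma hom_ext' {X Y : LocConst 𝒰} {a b : X ⟶ Y} (h : a.f = b.f)
    (h' : a.ϑ = b.ϑ) : a = b := LocConst.Hom.ext h h'

@[simp] lemma id_f (X : LocConst 𝒰) : LocConst.Hom.f (𝟙 X) = 𝟙 _ := rfl
@[simp] lemma id_ϑ (X : LocConst 𝒰) (i : 𝒰.I) (x : X.S i) : LocConst.Hom.ϑ (𝟙 X) i x = x := rfl
@[simp] lemma comp_f {X Y Z : LocConst 𝒰} (a : X ⟶ Y) (b : Y ⟶ Z) :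
    LocConst.Hom.f (a ≫ b) = a.f ≫ b.f := rfl
@[simp] lemma comp_ϑ {X Y Z : LocConst 𝒰} (a : X ⟶ Y) (b : Y ⟶ Z) (i : 𝒰.I) (x : X.S i) :
    LocConst.Hom.ϑ (a ≫ b) i x = b.ϑ i (a.ϑ i x) := rfl

/-- The descent datum `σ` of a locally constant object:
`γ^*(S i) × U i × U j ⟶ X × U i × U j ⟶ X × U j × U i ⟶ γ^*(S j) × U j × U i`. -/
def σ (X : LocConst 𝒰) (i j : 𝒰.I) :
    ((gammaStar E).obj (X.S i) ⨯ (𝒰.U i ⨯ 𝒰.U j)) ⟶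
      ((gammaStar E).obj (X.S j) ⨯ (𝒰.U j ⨯ 𝒰.U i)) :=
  (Limits.prod.associator _ _ _).inv ≫ prod.map (X.θ i).hom (𝟙 (𝒰.U j)) ≫ (Limits.prod.associator _ _ _).hom ≫
    prod.map (𝟙 X.X) (prod.braiding (𝒰.U i) (𝒰.U j)).hom ≫
    (Limits.prod.associator _ _ _).inv ≫ prod.map (X.θ j).inv (𝟙 (𝒰.U i)) ≫ (Limits.prod.associator _ _ _).hom

/-- An action triple `(u, v, s)` for `X`, defined on a non-empty object `C`. -/
structure ActionTriple (X : LocConst 𝒰) (i j : 𝒰.I) where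
  C : E
  u : C ⟶ 𝒰.U i
  v : C ⟶ 𝒰.U j
  s : X.S i ≃ X.S j
  nonempty : NonEmpty C
  comm : prod.map (𝟙 ((gammaStar E).obj (X.S i))) (prod.lift u v) ≫ X.σ i j =
    prod.map ((gammaStar E).map (↾s)) (𝟙 C) ≫
      prod.map (𝟙 ((gammaStar E).obj (X.S j))) (prod.lift v u)

/-- `X` is a covering projection if, for all `i`, `j` with `U i × U j ≠ ∅`, the action triples
form an epimorphic family over `U i × U j`. -/
def IsCovering : ObjectProperty (LocConst 𝒰) := fun X =>
  ∀ i j, NonEmpty (𝒰.U i ⨯ 𝒰.U j) →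
    EpiFamily fun t : ActionTriple X i j => prod.lift t.u t.v

/-- `X` is a sum (coproduct in `P_𝒰`) of covering projections. -/
def IsSumOfCoverings : ObjectProperty (LocConst 𝒰) := fun X =>
  ∃ (A : Type u) (Y : A → LocConst 𝒰) (ι : ∀ a, Y a ⟶ X),
    (∀ a, IsCovering (Y a)) ∧ Nonempty (IsColimit (Cofan.mk X ι))

/-! #### Sections of a locally constant object -/

/-- The point of `γ^* S` given by an element of `S`. -/
def pt {S : Type u} (x : S) : ⊤_ E ⟶ (gammaStar E).obj S := Sigma.ι (fun _ : S => ⊤_ E) x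

lemma pt_map {S T : Type u} (s : S → T) (x : S) :
    pt x ≫ (gammaStar E).map (↾s) = (pt (s x) : ⊤_ E ⟶ _) := by
  simp [pt, gammaStar]

/-- The section of `γ^* S × C` given by an element of `S`, composed with `u : C ⟶ U`. -/
def sec {S : Type u} {C U : E} (x : S) (u : C ⟶ U) : C ⟶ (gammaStar E).obj S ⨯ U :=
  prod.lift (terminal.from C ≫ pt x) u

lemma sec_epi {S : Type u} (C : E) : EpiFamily fun x : S => sec x (𝟙 C) := by
  intro Z p q H
  have hp : EpiFamily fun x : S => (pt x : ⊤_ E ⟶ (gammaStar E).obj S) := by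
    intro Z p q h
    exact Sigma.hom_ext _ _ h
  refine hp.pullback' prod.fst p q fun x D k l hkl => ?_
  have : k = (k ≫ prod.snd) ≫ sec x (𝟙 C) := by
    apply Limits.prod.hom_ext
    · simp only [sec, Category.assoc, prod.lift_fst, hkl]
      rw [← Category.assoc, ← Category.assoc]
      congr 1
      exact Subsingleton.elim _ _
    · simp [sec]
  rw [this, Category.assoc, Category.assoc]
  simp only [Category.assoc]
  have e := H x
  simp only at e
  rw [e]

/-- The section `U i ⟶ X` given by an element of `S i`. -/
def elt (X : LocConst 𝒰) (i : 𝒰.I) (x : X.S i) : 𝒰.U i ⟶ X.X :=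
  sec x (𝟙 _) ≫ (X.θ i).hom ≫ prod.fst

lemma sec_comp {S : Type u} {C U V : E} (x : S) (u : C ⟶ U) (v : U ⟶ V) :
    u ≫ sec x v = sec x (u ≫ v) := by
  apply Limits.prod.hom_ext
  · simp only [sec, Category.assoc, prod.lift_fst]
    rw [← Category.assoc]
    congr 1
    exact Subsingleton.elim _ _
  · simp [sec]

lemma sec_map {S T : Type u} {C U V : E} (x : S) (u : C ⟶ U) (v : U ⟶ V) (s : S → T) :
    sec x u ≫ prod.map ((gammaStar E).map (↾s)) v = sec (s x) (u ≫ v) := by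
  apply Limits.prod.hom_ext
  · simp [sec, pt_map s x]
  · simp [sec]

lemma sec_map_id {S : Type u} {C U V : E} (x : S) (u : C ⟶ U) (v : U ⟶ V) :
    sec x u ≫ prod.map (𝟙 ((gammaStar E).obj S)) v = sec x (u ≫ v) := by
  apply Limits.prod.hom_ext <;> simp [sec]

lemma sec_θ (X : LocConst 𝒰) {C : E} (i : 𝒰.I) (x : X.S i) (u : C ⟶ 𝒰.U i) :
    sec x u ≫ (X.θ i).hom = prod.lift (u ≫ X.elt i x) u := by
  have : sec x u = u ≫ sec x (𝟙 _) := by rw [sec_comp, Category.comp_id]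
  apply Limits.prod.hom_ext
  · rw [prod.lift_fst, this, elt]
    simp
  · rw [prod.lift_snd, Category.assoc, X.θ_snd]
    simp [sec]

lemma comm_iff {X Y : LocConst 𝒰} (f : X.X ⟶ Y.X) (i : 𝒰.I) (t : X.S i → Y.S i) :
    prod.map ((gammaStar E).map (↾t)) (𝟙 (𝒰.U i)) ≫ (Y.θ i).hom =
      (X.θ i).hom ≫ prod.map f (𝟙 (𝒰.U i)) ↔ ∀ x, X.elt i x ≫ f = Y.elt i (t x) := by
  constructor
  · intro h x
    have := congrArg (fun k => sec x (𝟙 _) ≫ k ≫ prod.fst) h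
    simp only [Category.assoc] at this
    rw [← Category.assoc, sec_map, ← Category.assoc, ← Category.assoc, sec_θ, ← Category.assoc,
      sec_θ] at this
    simpa using this.symm
  · intro h
    refine sec_epi _ _ _ fun x => ?_
    rw [← Category.assoc, sec_map, sec_θ, ← Category.assoc, sec_θ]
    apply Limits.prod.hom_ext <;> simp [h]

lemma triple_iff (X : LocConst 𝒰) {i j : 𝒰.I} {C : E} (u : C ⟶ 𝒰.U i) (v : C ⟶ 𝒰.U j)
    (s : X.S i → X.S j) :
    prod.map (𝟙 ((gammaStar E).obj (X.S i))) (prod.lift u v) ≫ X.σ i j =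
      prod.map ((gammaStar E).map (↾s)) (𝟙 C) ≫
        prod.map (𝟙 ((gammaStar E).obj (X.S j))) (prod.lift v u) ↔
      ∀ x, u ≫ X.elt i x = v ≫ X.elt j (s x) := by
  let R := (Limits.prod.associator ((gammaStar E).obj (X.S j)) (𝒰.U j) (𝒰.U i)).inv ≫
    prod.map (X.θ j).hom (𝟙 (𝒰.U i))
  have a1 : ∀ x, (sec x (𝟙 C) ≫ prod.map (𝟙 ((gammaStar E).obj (X.S i))) (prod.lift u v) ≫
      X.σ i j) ≫ R = prod.lift (prod.lift (u ≫ X.elt i x) v) u := by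
    intro x
    have b1 : sec x (prod.lift u v) ≫ (Limits.prod.associator _ _ _).inv = prod.lift (sec x u) v := by
      apply Limits.prod.hom_ext
      · apply Limits.prod.hom_ext <;> simp [sec]
      · simp [sec]
    have b2 : X.σ i j ≫ R = (Limits.prod.associator _ _ _).inv ≫ prod.map (X.θ i).hom (𝟙 (𝒰.U j)) ≫
        (Limits.prod.associator _ _ _).hom ≫ prod.map (𝟙 X.X) (prod.braiding (𝒰.U i) (𝒰.U j)).hom ≫
        (Limits.prod.associator _ _ _).inv := by
      have : prod.map (X.θ j).inv (𝟙 (𝒰.U i)) ≫ prod.map (X.θ j).hom (𝟙 (𝒰.U i)) = 𝟙 _ := by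
        simp
      simp only [σ, R, Category.assoc, Iso.hom_inv_id_assoc, this, Category.comp_id]
    rw [Category.assoc, Category.assoc, ← Category.assoc, sec_map_id, b2, Category.id_comp, ← Category.assoc, b1]
    have b3 : prod.lift (sec x u) v ≫ prod.map (X.θ i).hom (𝟙 (𝒰.U j)) =
        prod.lift (prod.lift (u ≫ X.elt i x) u) v := by
      rw [← sec_θ]; simp
    rw [← Category.assoc, b3]
    apply Limits.prod.hom_ext
    · apply Limits.prod.hom_ext <;> simp
    · simp
  have a2 : ∀ x, (sec x (𝟙 C) ≫ prod.map ((gammaStar E).map (↾s)) (𝟙 C) ≫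
      prod.map (𝟙 ((gammaStar E).obj (X.S j))) (prod.lift v u)) ≫ R =
        prod.lift (prod.lift (v ≫ X.elt j (s x)) v) u := by
    intro x
    rw [← Category.assoc (sec x _), sec_map, sec_map_id]
    have b1 : sec (s x) ((𝟙 C ≫ 𝟙 C) ≫ prod.lift v u) ≫ (Limits.prod.associator _ _ _).inv =
        prod.lift (sec (s x) v) u := by
      apply Limits.prod.hom_ext
      · apply Limits.prod.hom_ext <;> simp [sec]
      · simp [sec]
    rw [← Category.assoc (sec (s x) _), b1, ← sec_θ]
    simp
  constructor
  · intro h x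
    have := a1 x
    rw [h, a2] at this
    have h2 := congrArg (fun k => k ≫ prod.fst ≫ prod.fst) this
    simpa using h2.symm
  · intro h
    refine sec_epi _ _ _ fun x => ?_
    apply (cancel_mono R).1
    rw [a1, a2, h x]

/-! #### Pullback along a refinement -/

/-- The inverse image of a locally constant object along a refinement `(h, α) : 𝒰 ⟶ 𝒱`: the same
object `X`, with `S i = T (α i)` and the trivializations pulled back along `h i`. -/
def pullbackObj (h : 𝒰 ⟶ 𝒱) (Y : LocConst 𝒱) : LocConst 𝒰 where
  X := Y.X
  S i := Y.S (h.α i)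
  θ i :=
    have e1 : prod.lift (prod.map (𝟙 _) (h.h i) ≫ (Y.θ (h.α i)).hom ≫ prod.fst) prod.snd ≫
        prod.map (𝟙 _) (h.h i) = prod.map (𝟙 _) (h.h i) ≫ (Y.θ (h.α i)).hom := by
      apply Limits.prod.hom_ext
      · simp
      · simp [Y.θ_snd]
    have over' : (Y.θ (h.α i)).inv ≫ prod.snd = prod.snd := by
      rw [Iso.inv_comp_eq, Y.θ_snd]
    have e2 : prod.lift (prod.map (𝟙 _) (h.h i) ≫ (Y.θ (h.α i)).inv ≫ prod.fst) prod.snd ≫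
        prod.map (𝟙 _) (h.h i) = prod.map (𝟙 _) (h.h i) ≫ (Y.θ (h.α i)).inv := by
      apply Limits.prod.hom_ext
      · simp
      · simp [over']
    { hom := prod.lift (prod.map (𝟙 _) (h.h i) ≫ (Y.θ (h.α i)).hom ≫ prod.fst) prod.snd
      inv := prod.lift (prod.map (𝟙 _) (h.h i) ≫ (Y.θ (h.α i)).inv ≫ prod.fst) prod.snd
      hom_inv_id := by
        apply Limits.prod.hom_ext
        · rw [Category.assoc, prod.lift_fst, ← Category.assoc, e1]; simp
        · simp
      inv_hom_id := by
        apply Limits.prod.hom_ext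
        · rw [Category.assoc, prod.lift_fst, ← Category.assoc, e2]; simp
        · simp }
  θ_snd i := prod.lift_snd _ _

lemma pullbackObj_elt (h : 𝒰 ⟶ 𝒱) (Y : LocConst 𝒱) (i : 𝒰.I) (x : Y.S (h.α i)) :
    (pullbackObj h Y).elt i x = h.h i ≫ Y.elt (h.α i) x := by
  change sec x (𝟙 _) ≫ prod.lift (prod.map (𝟙 _) (h.h i) ≫ (Y.θ (h.α i)).hom ≫ prod.fst) prod.snd
    ≫ prod.fst = _
  rw [prod.lift_fst, ← Category.assoc, sec_map_id, ← Category.assoc, sec_θ]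
  simp

/-- The functor `(h, α)^* : P_𝒱 ⥤ P_𝒰`. -/
def pullback (h : 𝒰 ⟶ 𝒱) : LocConst 𝒱 ⥤ LocConst 𝒰 where
  obj := pullbackObj h
  map {X Y} a := ⟨a.f, fun i => a.ϑ (h.α i), fun i => (comm_iff _ _ _).2 fun x => by
    have e := (comm_iff _ _ _).1 (a.comm (h.α i)) x
    have e1 := pullbackObj_elt h X i x
    have e2 := pullbackObj_elt h Y i (a.ϑ (h.α i) x)
    refine Eq.trans ?_ e2.symm
    rw [← e, ← Category.assoc]
    exact congrArg (fun k => k ≫ a.f) e1⟩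

/-- Two locally constant objects with the same underlying data are isomorphic through the
identity. -/
def isoOfElt {X Y : LocConst 𝒰} (f : X.X ≅ Y.X) (ϑ : ∀ i, X.S i ≃ Y.S i)
    (w : ∀ i x, X.elt i x ≫ f.hom = Y.elt i (ϑ i x)) : X ≅ Y where
  hom := ⟨f.hom, fun i => ϑ i, fun i => (comm_iff _ _ _).2 (w i)⟩
  inv := ⟨f.inv, fun i => (ϑ i).symm, fun i => (comm_iff _ _ _).2 fun y => by
    rw [Iso.comp_inv_eq, w, Equiv.apply_symm_apply]⟩
  hom_inv_id := by
    apply hom_ext'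
    · exact f.hom_inv_id
    · funext i x; exact (ϑ i).symm_apply_apply x
  inv_hom_id := by
    apply hom_ext'
    · exact f.inv_hom_id
    · funext i x; exact (ϑ i).apply_symm_apply x

/-- The canonical isomorphism `id^* X ≅ X`, given by the identities of `X` and of `S`. -/
def pullbackIdIso (X : LocConst 𝒰) : (pullback (𝟙 𝒰)).obj X ≅ X :=
  isoOfElt (Iso.refl X.X) (fun _ => Equiv.refl _) fun i x => by
    have := pullbackObj_elt (𝟙 𝒰) X i x
    exact (Category.comp_id _).trans (this.trans (Category.id_comp _))

/-- The canonical isomorphism `(h ≫ k)^* X ≅ h^* (k^* X)`, given by the identities of `X` and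
of `S`. -/
def pullbackCompIso (h : 𝒰 ⟶ 𝒱) (k : 𝒱 ⟶ 𝒲) (X : LocConst 𝒲) :
    (pullback (h ≫ k)).obj X ≅ (pullback h).obj ((pullback k).obj X) :=
  isoOfElt (Iso.refl X.X) (fun _ => Equiv.refl _) fun i x => by
    have e1 := pullbackObj_elt (h ≫ k) X i x
    have e2 := pullbackObj_elt h (pullbackObj k X) i x
    have e3 := pullbackObj_elt k X (h.α i) x
    refine (Category.comp_id _).trans (e1.trans ?_)
    refine Eq.trans ?_ e2.symm
    rw [e3]
    exact Category.assoc _ _ _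

end LocConst

end Covers

/-! ### Inverse images of covering projections and of their sums -/

section Coverings

variable {E : Type (u + 1)} [Category.{u} E] [IsGrothendieckTopos.{u} E] {𝒰 𝒱 𝒲 : Cover E}

lemma eq_of_not_nonEmpty {C : Type w} [Category.{v} C] {X Z : C} (h : ¬ NonEmpty X) (p q : X ⟶ Z) : p = q := by
  unfold NonEmpty at h
  rw [not_isEmpty_iff] at h
  exact h.some.hom_ext p q

lemma chain_eq {C : Type w} [Category.{v} C] {D F X Y P Q R : C} {k : D ⟶ X} {f : X ⟶ P}
    {k' : D ⟶ Y} {g : Y ⟶ Q} {l : D ⟶ F} {a : F ⟶ P} {b : F ⟶ Q} {x : P ⟶ R} {y : Q ⟶ R}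
    (e1 : k ≫ f = l ≫ a) (e2 : k' ≫ g = l ≫ b) (e3 : a ≫ x = b ≫ y) :
    k ≫ f ≫ x = k' ≫ g ≫ y := by
  rw [← Category.assoc, e1, Category.assoc, e3, ← Category.assoc, ← e2, Category.assoc]

namespace LocConst

lemma IsCovering.epi {Y : LocConst 𝒱} (hY : IsCovering Y) (i j : 𝒱.I) :
    EpiFamily fun t : ActionTriple Y i j => prod.lift t.u t.v := by
  by_cases h : NonEmpty (𝒱.U i ⨯ 𝒱.U j)
  · exact hY i j h
  · exact fun Z p q _ => eq_of_not_nonEmpty h p q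

/-- The inverse image of a covering projection along a refinement is a covering projection. -/
theorem IsCovering.pullback (h : 𝒰 ⟶ 𝒱) {Y : LocConst 𝒱} (hY : IsCovering Y) :
    IsCovering ((LocConst.pullback h).obj Y) := by
  intro i j _ Z p q H
  refine (hY.epi (h.α i) (h.α j)).pullback' (prod.map (h.h i) (h.h j)) p q
    fun t D k l hkl => ?_
  by_cases hD : NonEmpty D
  · have e1 : k ≫ prod.fst ≫ h.h i = l ≫ t.u := by
      have := congrArg (fun r => r ≫ prod.fst) hkl
      simpa using this
    have e2 : k ≫ prod.snd ≫ h.h j = l ≫ t.v := by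
      have := congrArg (fun r => r ≫ prod.snd) hkl
      simpa using this
    let T : ActionTriple ((LocConst.pullback h).obj Y) i j :=
      { C := D
        u := k ≫ prod.fst
        v := k ≫ prod.snd
        s := t.s
        nonempty := hD
        comm := (triple_iff _ _ _ _).2 fun x => by
          have a1 := pullbackObj_elt h Y i x
          have a2 := pullbackObj_elt h Y j (t.s x)
          have a3 := (triple_iff _ _ _ _).1 t.comm x
          refine (congrArg (fun r => (k ≫ prod.fst) ≫ r) a1).trans
            (Eq.trans ?_ (congrArg (fun r => (k ≫ prod.snd) ≫ r) a2).symm)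
          exact chain_eq ((Category.assoc _ _ _).trans e1) ((Category.assoc _ _ _).trans e2) a3 }
    have hT : prod.lift T.u T.v = k := by
      apply Limits.prod.hom_ext <;> simp [T]
    have := H T
    simpa only [hT] using this
  · exact eq_of_not_nonEmpty hD _ _

/-- Recognition of sums of locally constant objects. -/
def isColimitOfComponents {A : Type u} {Y : A → LocConst 𝒰} {X : LocConst 𝒰} (ι : ∀ a, Y a ⟶ X)
    (hX : IsColimit (Cofan.mk X.X fun a => (ι a).f))
    (e : ∀ i, (Σ a, (Y a).S i) ≃ X.S i) (he : ∀ i a y, e i ⟨a, y⟩ = (ι a).ϑ i y) :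
    IsColimit (Cofan.mk X ι) :=
  have fac : ∀ {T : E} (k : ∀ a, (Y a).X ⟶ T) (a : A),
      (ι a).f ≫ Cofan.IsColimit.desc hX k = k a := fun k a => Cofan.IsColimit.fac hX k a
  Cofan.IsColimit.mk _
    (fun t => ⟨Cofan.IsColimit.desc hX fun a => (t.inj a).f,
      fun i x => (t.inj ((e i).symm x).1).ϑ i ((e i).symm x).2, fun i =>
      (comm_iff _ _ _).2 fun x => by
        obtain ⟨⟨a, y⟩, rfl⟩ := (e i).surjective x
        rw [Equiv.symm_apply_apply, he]
        have q1 := (comm_iff _ _ _).1 ((ι a).comm i) y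
        have q2 := (comm_iff _ _ _).1 ((t.inj a).comm i) y
        refine (congrArg (fun r => r ≫ _) q1.symm).trans ((Category.assoc _ _ _).trans ?_)
        exact (congrArg (fun r => (Y a).elt i y ≫ r) (fac (fun a => (t.inj a).f) a)).trans q2⟩)
    (fun t a => by
      apply hom_ext'
      · exact fac (fun a => (t.inj a).f) a
      · funext i y
        change (t.inj ((e i).symm ((ι a).ϑ i y)).1).ϑ i ((e i).symm ((ι a).ϑ i y)).2 = _
        rw [← he, Equiv.symm_apply_apply])
    (fun t m hm => by
      apply hom_ext'
      · refine Cofan.IsColimit.hom_ext hX _ _ fun a => ?_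
        refine Eq.trans ?_ (fac (fun a => (t.inj a).f) a).symm
        exact congrArg Hom.f (hm a)
      · funext i x
        obtain ⟨⟨a, y⟩, rfl⟩ := (e i).surjective x
        change _ = (t.inj ((e i).symm (e i ⟨a, y⟩)).1).ϑ i ((e i).symm (e i ⟨a, y⟩)).2
        rw [Equiv.symm_apply_apply, he]
        exact congrFun (congrFun (congrArg Hom.ϑ (hm a)) i) y)

lemma prodRight_preserves (U : E) (A : Type u) :
    PreservesColimitsOfShape (Discrete A) (prod.functor.flip.obj U) := by
  have := prod_preserves U A
  let i : prod.functor.obj U ≅ prod.functor.flip.obj U :=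
    NatIso.ofComponents (fun X => prod.braiding U X) (by
      intro X Y f
      change prod.map (𝟙 U) f ≫ (prod.braiding U Y).hom =
        (prod.braiding U X).hom ≫ prod.map f (𝟙 U)
      apply Limits.prod.hom_ext <;> simp)
  exact preservesColimitsOfShape_of_natIso i

lemma gammaStar_preserves (A : Type u) :
    PreservesColimitsOfShape (Discrete A) (gammaStar E) := by
  have : (gammaStar E).IsLeftAdjoint := ⟨_, ⟨sigmaConstAdj (⊤_ E)⟩⟩
  infer_instance

/-- Multiplication by `U` turns sums into sums. -/
lemma isColimit_prod {A : Type u} {Y : A → E} {X : E} (f : ∀ a, Y a ⟶ X)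
    (h : IsColimit (Cofan.mk X f)) (U : E) :
    Nonempty (IsColimit (Cofan.mk (X ⨯ U) fun a => prod.map (f a) (𝟙 U))) := by
  have := prodRight_preserves U A
  exact ⟨isColimitCofanMkObjOfIsColimit (prod.functor.flip.obj U) Y f h⟩

lemma isColimit_gammaStar {A : Type u} (S : A → Type u) :
    Nonempty (IsColimit (Cofan.mk ((gammaStar E).obj (Σ a, S a))
      fun a => (gammaStar E).map (↾(fun y : S a => (⟨a, y⟩ : Σ a, S a))))) := by
  have := gammaStar_preserves (E := E) A
  refine ⟨isColimitCofanMkObjOfIsColimit (gammaStar E) S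
    (fun a => ↾(fun y : S a => (⟨a, y⟩ : Σ a, S a))) ?_⟩
  exact Cofan.IsColimit.mk _ (fun t => ↾(fun x => t.inj x.1 x.2))
    (fun t a => rfl)
    (fun t m hm => by
      ext ⟨a, y⟩
      exact ConcreteCategory.congr_hom (hm a) y)

/-- Sums of locally constant objects exist and are computed componentwise. -/
lemma exists_sum {A : Type u} (Y : A → LocConst 𝒰) :
    ∃ (X : LocConst 𝒰) (ι : ∀ a, Y a ⟶ X) (e : ∀ i, (Σ a, (Y a).S i) ≃ X.S i),
      Nonempty (IsColimit (Cofan.mk X.X fun a => (ι a).f)) ∧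
      ∀ i a y, e i ⟨a, y⟩ = (ι a).ϑ i y := by
  let hX := coproductIsCoproduct fun a => (Y a).X
  let c2 := fun i => (isColimit_prod _ hX (𝒰.U i)).some
  let c1 := fun i => (isColimit_prod _ (isColimit_gammaStar (E := E)
    fun a => (Y a).S i).some (𝒰.U i)).some
  let X : LocConst 𝒰 :=
    { X := ∐ fun a => (Y a).X
      S := fun i => Σ a, (Y a).S i
      θ := fun i =>
        { hom := Cofan.IsColimit.desc (c1 i) fun a => ((Y a).θ i).hom ≫
            prod.map (Sigma.ι (fun a => (Y a).X) a) (𝟙 _)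
          inv := Cofan.IsColimit.desc (c2 i) fun a => ((Y a).θ i).inv ≫
            prod.map ((gammaStar E).map (↾(fun y => (⟨a, y⟩ : Σ a, (Y a).S i)))) (𝟙 _)
          hom_inv_id := by
            refine Cofan.IsColimit.hom_ext (c1 i) _ _ fun a => ?_
            have f1 := Cofan.IsColimit.fac (c1 i) (fun a => ((Y a).θ i).hom ≫
              prod.map (Sigma.ι (fun a => (Y a).X) a) (𝟙 _)) a
            have f2 := Cofan.IsColimit.fac (c2 i) (fun a => ((Y a).θ i).inv ≫
              prod.map ((gammaStar E).map (↾(fun y => (⟨a, y⟩ : Σ a, (Y a).S i)))) (𝟙 _)) a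
            have f2' : prod.map (Sigma.ι (fun a => (Y a).X) a) (𝟙 _) ≫ _ = _ := f2
            refine (Category.assoc _ _ _).symm.trans ?_
            refine (congrArg (fun r => r ≫ _) f1).trans ?_
            refine (Category.assoc _ _ _).trans ?_
            refine (congrArg (fun r => ((Y a).θ i).hom ≫ r) f2').trans ?_
            rw [Iso.hom_inv_id_assoc]
            exact (Category.comp_id _).symm
          inv_hom_id := by
            refine Cofan.IsColimit.hom_ext (c2 i) _ _ fun a => ?_
            have f1 := Cofan.IsColimit.fac (c1 i) (fun a => ((Y a).θ i).hom ≫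
              prod.map (Sigma.ι (fun a => (Y a).X) a) (𝟙 _)) a
            have f2 := Cofan.IsColimit.fac (c2 i) (fun a => ((Y a).θ i).inv ≫
              prod.map ((gammaStar E).map (↾(fun y => (⟨a, y⟩ : Σ a, (Y a).S i)))) (𝟙 _)) a
            have f1' : prod.map ((gammaStar E).map
              (↾(fun y => (⟨a, y⟩ : Σ a, (Y a).S i)))) (𝟙 _) ≫ _ = _ := f1
            refine (Category.assoc _ _ _).symm.trans ?_
            refine (congrArg (fun r => r ≫ _) f2).trans ?_
            refine (Category.assoc _ _ _).trans ?_
            refine (congrArg (fun r => ((Y a).θ i).inv ≫ r) f1').trans ?_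
            rw [Iso.inv_hom_id_assoc]
            exact (Category.comp_id _).symm }
      θ_snd := fun i => by
        refine Cofan.IsColimit.hom_ext (c1 i) _ _ fun a => ?_
        have f1 := Cofan.IsColimit.fac (c1 i) (fun a => ((Y a).θ i).hom ≫
          prod.map (Sigma.ι (fun a => (Y a).X) a) (𝟙 _)) a
        refine (Category.assoc _ _ _).symm.trans ?_
        refine (congrArg (fun r => r ≫ _) f1).trans ?_
        change _ = prod.map ((gammaStar E).map
              (↾(fun y => (⟨a, y⟩ : Σ a, (Y a).S i)))) (𝟙 _) ≫ prod.snd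
        simp [(Y a).θ_snd] }
  refine ⟨X, fun a => ⟨Sigma.ι (fun a => (Y a).X) a, fun i y => ⟨a, y⟩, fun i =>
    Cofan.IsColimit.fac (c1 i) (fun a => ((Y a).θ i).hom ≫
      prod.map (Sigma.ι (fun a => (Y a).X) a) (𝟙 _)) a⟩, fun i => Equiv.refl _, ⟨hX⟩,
    fun i a y => rfl⟩

/-- The inverse image of a sum of covering projections is a sum of covering projections. -/
theorem IsSumOfCoverings.pullback (h : 𝒰 ⟶ 𝒱) {X : LocConst 𝒱} (hX : IsSumOfCoverings X) :
    IsSumOfCoverings ((LocConst.pullback h).obj X) := by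
  obtain ⟨A, Y, ι, hY, ⟨hι⟩⟩ := hX
  obtain ⟨Z, κ, e, ⟨hκ⟩, he⟩ := exists_sum Y
  let H := isColimitOfComponents κ hκ e he
  let i : Z ≅ X := H.coconePointUniqueUpToIso hι
  have hi : ∀ a, κ a ≫ i.hom = ι a := fun a =>
    H.comp_coconePointUniqueUpToIso_hom hι ⟨a⟩
  let K := isColimitOfComponents (fun a => (LocConst.pullback h).map (κ a)) hκ
    (fun i => e (h.α i)) (fun i a y => he (h.α i) a y)
  refine ⟨A, fun a => (LocConst.pullback h).obj (Y a), fun a => (LocConst.pullback h).map (ι a),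
    fun a => (hY a).pullback h, ⟨K.ofIsoColimit (Cofan.ext ((LocConst.pullback h).mapIso i) ?_)⟩⟩
  intro a
  change (LocConst.pullback h).map (κ a) ≫ (LocConst.pullback h).map i.hom = _
  rw [← Functor.map_comp, hi]
  rfl

/-- A covering projection is a sum of covering projections. -/
theorem IsCovering.isSum {X : LocConst 𝒰} (hX : IsCovering X) : IsSumOfCoverings X :=
  ⟨PUnit, fun _ => X, fun _ => 𝟙 X, fun _ => hX, ⟨Cofan.IsColimit.mk _
    (fun t => t.inj PUnit.unit) (fun t _ => Category.id_comp _)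
    (fun t m hm => by
      have := hm PUnit.unit
      exact (Category.id_comp m).symm.trans this)⟩⟩

/-- Two refinements of the cover of a covering projection become equal on it after a further
refinement. -/
theorem exists_refinement {𝒲' : Cover E} (l : 𝒲 ⟶ 𝒱) (l' : 𝒲' ⟶ 𝒱) {Y : LocConst 𝒱}
    (hY : IsCovering Y) :
    ∃ (𝒵 : Cover E) (k : 𝒵 ⟶ 𝒲) (k' : 𝒵 ⟶ 𝒲')
      (e : (LocConst.pullback (k ≫ l)).obj Y ⟶ (LocConst.pullback (k' ≫ l')).obj Y),
      e.f = 𝟙 Y.X := by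
  obtain ⟨A, G, hG⟩ := exists_generators (E := E)
  let I := Σ (w : 𝒲.I) (w' : 𝒲'.I) (a : A), { k : G a ⟶ 𝒲.U w ⨯ 𝒲'.U w' // NonEmpty (G a) ∧
    ∃ s : Y.S (l.α w) → Y.S (l'.α w'), ∀ x, (k ≫ prod.fst ≫ l.h w) ≫ Y.elt (l.α w) x =
      (k ≫ prod.snd ≫ l'.h w') ≫ Y.elt (l'.α w') (s x) }
  let 𝒵 : Cover E :=
    { I := I
      U := fun z => G z.2.2.1
      nonempty := fun z => z.2.2.2.2.1
      epi := by
        intro Z p q H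
        refine 𝒲.epi p q fun w => ?_
        refine 𝒲'.epi.pullback' (terminal.from (𝒲.U w)) _ _ fun w' D k m _ => ?_
        refine (hY.epi (l.α w) (l'.α w')).pullback' (prod.lift (k ≫ l.h w) (m ≫ l'.h w')) _ _
          fun t D' k₂ m₂ hk => ?_
        refine hG _ _ fun a k₃ => ?_
        by_cases ha : NonEmpty (G a)
        · have e1 : k₂ ≫ k ≫ l.h w = m₂ ≫ t.u := by
            have := congrArg (fun r => r ≫ prod.fst) hk
            simpa using this
          have e2 : k₂ ≫ m ≫ l'.h w' = m₂ ≫ t.v := by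
            have := congrArg (fun r => r ≫ prod.snd) hk
            simpa using this
          have := H ⟨w, w', a, prod.lift (k₃ ≫ k₂ ≫ k) (k₃ ≫ k₂ ≫ m), ha, t.s, fun x => by
            have a3 := (triple_iff _ _ _ _).1 t.comm x
            simp only [lift_fst_assoc_simp, lift_snd_assoc_simp, Category.assoc]
            have e1' : (k₃ ≫ k₂ ≫ k) ≫ l.h w = (k₃ ≫ m₂) ≫ t.u := by
              rw [Category.assoc, Category.assoc, e1, Category.assoc]
            have e2' : (k₃ ≫ k₂ ≫ m) ≫ l'.h w' = (k₃ ≫ m₂) ≫ t.v := by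
              rw [Category.assoc, Category.assoc, e2, Category.assoc]
            simpa only [Category.assoc] using chain_eq e1' e2' a3⟩
          have t1 : k₃ ≫ k₂ ≫ k ≫ terminal.from (𝒲.U w) = terminal.from (G a) :=
            Subsingleton.elim _ _
          simp only [← Category.assoc] at t1 ⊢
          rw [t1]
          exact this
        · exact eq_of_not_nonEmpty ha _ _ }
  let k : 𝒵 ⟶ 𝒲 := ⟨fun z => z.1, fun z => z.2.2.2.1 ≫ prod.fst⟩
  let k' : 𝒵 ⟶ 𝒲' := ⟨fun z => z.2.1, fun z => z.2.2.2.1 ≫ prod.snd⟩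
  refine ⟨𝒵, k, k', ⟨𝟙 Y.X, fun z => z.2.2.2.2.2.choose, fun z =>
    (comm_iff _ _ _).2 fun x => ?_⟩, rfl⟩
  have h1 := z.2.2.2.2.2.choose_spec x
  have e1 := pullbackObj_elt (k ≫ l) Y z x
  have e2 := pullbackObj_elt (k' ≫ l') Y z (z.2.2.2.2.2.choose x)
  refine (Category.comp_id _).trans (e1.trans (Eq.trans ?_ e2.symm))
  simp only [Category.assoc] at h1
  change ((z.2.2.2.1 ≫ prod.fst) ≫ l.h z.1) ≫ _ = ((z.2.2.2.1 ≫ prod.snd) ≫ l'.h z.2.1) ≫ _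
  simp only [Category.assoc]
  exact h1

end LocConst

end Coverings

/-! ### The topoi `G_𝒰` and the category `cG(E)` -/

section System

variable {E : Type (u + 1)} [Category.{u} E] [IsGrothendieckTopos.{u} E] {𝒰 𝒱 𝒲 : Cover E}

/-- The category of covering projections trivialized by `𝒰`, a full subcategory of `P_𝒰`. -/
abbrev CovProj (𝒰 : Cover E) := (LocConst.IsCovering (𝒰 := 𝒰)).FullSubcategory

/-- The category `G_𝒰`: the full subcategory of `P_𝒰` of the sums of covering projections. -/
abbrev GCat (𝒰 : Cover E) := (LocConst.IsSumOfCoverings (𝒰 := 𝒰)).FullSubcategory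

/-- The inclusion of the covering projections in `G_𝒰`. -/
abbrev incl (𝒰 : Cover E) : CovProj 𝒰 ⥤ GCat 𝒰 :=
  ObjectProperty.ιOfLE fun _ h => LocConst.IsCovering.isSum h

/-- The inverse image of a covering projection along a refinement. -/
abbrev covPullback (h : 𝒰 ⟶ 𝒱) : CovProj 𝒱 ⥤ CovProj 𝒰 :=
  ObjectProperty.lift _ (ObjectProperty.ι _ ⋙ LocConst.pullback h) fun X => X.property.pullback h

/-- The inverse image functor `(h, α)^* : G_𝒱 ⥤ G_𝒰` of the transition morphism `G_𝒰 ⟶ G_𝒱`. -/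
abbrev transition (h : 𝒰 ⟶ 𝒱) : GCat 𝒱 ⥤ GCat 𝒰 :=
  ObjectProperty.lift _ (ObjectProperty.ι _ ⋙ LocConst.pullback h) fun X => X.property.pullback h

/-- The canonical isomorphism `id^* X ≅ X`. -/
def transitionId (X : GCat 𝒰) : (transition (𝟙 𝒰)).obj X ≅ X :=
  ObjectProperty.isoMk _ (LocConst.pullbackIdIso X.obj)

/-- The canonical isomorphism `(h ≫ k)^* X ≅ h^* (k^* X)`. -/
def transitionComp (h : 𝒰 ⟶ 𝒱) (k : 𝒱 ⟶ 𝒲) (X : GCat 𝒲) :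
    (transition (h ≫ k)).obj X ≅ (transition h).obj ((transition k).obj X) :=
  ObjectProperty.isoMk _ (LocConst.pullbackCompIso h k X.obj)

variable (E) in
/-- Objects of `cG(E)`: pairs `(X, 𝒰)` of a cover and a covering projection trivialized by it. -/
structure CG where
  cover : Cover E
  obj : LocConst cover
  covering : LocConst.IsCovering obj

/-- An arrow `f` of `E` is an arrow `(X, 𝒰) ⟶ (Y, 𝒱)` of `cG(E)` if there are refinements
`h : 𝒲 ⟶ 𝒰` and `l : 𝒲 ⟶ 𝒱` such that `f` lifts to an arrow `h^* X ⟶ l^* Y` of `G_𝒲`. -/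
def CG.IsArrow (A B : CG E) (f : A.obj.X ⟶ B.obj.X) : Prop :=
  ∃ (𝒲 : Cover E) (h : 𝒲 ⟶ A.cover) (l : 𝒲 ⟶ B.cover)
    (a : (LocConst.pullback h).obj A.obj ⟶ (LocConst.pullback l).obj B.obj), a.f = f

lemma CG.isArrow_comp {A B D : CG E} {f : A.obj.X ⟶ B.obj.X} {g : B.obj.X ⟶ D.obj.X}
    (hf : CG.IsArrow A B f) (hg : CG.IsArrow B D g) : CG.IsArrow A D (f ≫ g) := by
  obtain ⟨𝒲, h, l, a, rfl⟩ := hf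
  obtain ⟨𝒲', l', m, b, rfl⟩ := hg
  obtain ⟨𝒵, k, k', e, he⟩ := LocConst.exists_refinement l l' B.covering
  refine ⟨𝒵, k ≫ h, k' ≫ m, (LocConst.pullbackCompIso k h A.obj).hom ≫
    (LocConst.pullback k).map a ≫ (LocConst.pullbackCompIso k l B.obj).inv ≫ e ≫
    (LocConst.pullbackCompIso k' l' B.obj).hom ≫ (LocConst.pullback k').map b ≫
    (LocConst.pullbackCompIso k' m D.obj).inv, ?_⟩
  change 𝟙 _ ≫ a.f ≫ 𝟙 _ ≫ e.f ≫ 𝟙 _ ≫ b.f ≫ 𝟙 _ = _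
  refine (Category.id_comp _).trans (congrArg (fun r => a.f ≫ r) ?_)
  refine (Category.id_comp _).trans ?_
  refine (congrArg (fun r => r ≫ _) he).trans ?_
  refine (Category.id_comp _).trans ((Category.id_comp _).trans (Category.comp_id _))

instance : Category (CG E) where
  Hom A B := { f : A.obj.X ⟶ B.obj.X // CG.IsArrow A B f }
  id A := ⟨𝟙 _, A.cover, 𝟙 _, 𝟙 _, 𝟙 _, rfl⟩
  comp f g := ⟨f.1 ≫ g.1, CG.isArrow_comp f.2 g.2⟩
  id_comp _ := Subtype.ext (Category.id_comp _)
  comp_id _ := Subtype.ext (Category.comp_id _)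
  assoc _ _ _ := Subtype.ext (Category.assoc _ _ _)

/-- The functor `λ_𝒰^*` from the covering projections trivialized by `𝒰` to `cG(E)`. -/
def lam (𝒰 : Cover E) : CovProj 𝒰 ⥤ CG E where
  obj X := ⟨𝒰, X.obj, X.property⟩
  map {X Y} f := ⟨f.hom.f, 𝒰, 𝟙 _, 𝟙 _, (LocConst.pullback (𝟙 𝒰)).map f.hom, rfl⟩

/-- The isomorphism `(h^* X, 𝒰) ≅ (X, 𝒱)` of `cG(E)` given by the identity of `X`. -/
def lamIso (h : 𝒰 ⟶ 𝒱) (X : CovProj 𝒱) :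
    (lam 𝒰).obj ((covPullback h).obj X) ≅ (lam 𝒱).obj X where
  hom := ⟨𝟙 X.obj.X, 𝒰, 𝟙 _, h, (LocConst.pullbackIdIso ((LocConst.pullback h).obj X.obj)).hom,
    rfl⟩
  inv := ⟨𝟙 X.obj.X, 𝒰, h, 𝟙 _, (LocConst.pullbackIdIso ((LocConst.pullback h).obj X.obj)).inv,
    rfl⟩
  hom_inv_id := Subtype.ext (Category.comp_id (𝟙 X.obj.X))
  inv_hom_id := Subtype.ext (Category.comp_id (𝟙 X.obj.X))

variable (E) in
/-- The Grothendieck topology on `cG(E)` generated by the families of covering projections that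
are epimorphic in one of the `G_𝒰`. -/
def topology : GrothendieckTopology (CG E) :=
  sInf {J | ∀ (𝒰 : Cover E) (X : CovProj 𝒰) (A : Type u) (Y : A → CovProj 𝒰) (f : ∀ a, Y a ⟶ X),
    EpiFamily (fun a => (incl 𝒰).map (f a)) →
      Sieve.ofArrows _ (fun a => (lam 𝒰).map (f a)) ∈ J ((lam 𝒰).obj X)}

variable (E) in
/-- The topos `G(E)` of covering projections. -/
abbrev GTopos := Sheaf (topology E) (Type u)

end System

/-! ### Geometric morphisms, cones and limits -/

section Limits

universe u₁ v₁ u₂ v₂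

/-- Geometric morphisms `T ⟶ L`. -/
structure GeomMorphism (T : Type u₁) [Category.{v₁} T] (L : Type u₂) [Category.{v₂} L] where
  /-- the inverse image functor -/
  inv : L ⥤ T
  /-- the direct image functor -/
  dir : T ⥤ L
  adj : inv ⊣ dir
  lex : PreservesFiniteLimits inv

/-- The 2-cells between geometric morphisms are the natural transformations between the inverse
image functors. -/
instance (T : Type u₁) [Category.{v₁} T] (L : Type u₂) [Category.{v₂} L] :
    Category (GeomMorphism T L) where
  Hom p q := p.inv ⟶ q.inv
  id p := 𝟙 p.inv
  comp α β := NatTrans.vcomp α β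

/-- Composition of geometric morphisms (in diagrammatic order). -/
def GeomMorphism.comp {T : Type u₁} [Category.{v₁} T] {L : Type u₂} [Category.{v₂} L]
    {M : Type w} [Category.{v} M] (p : GeomMorphism T L) (q : GeomMorphism L M) :
    GeomMorphism T M where
  inv := q.inv ⋙ p.inv
  dir := p.dir ⋙ q.dir
  adj := q.adj.comp p.adj
  lex := by
    have := p.lex
    have := q.lex
    exact comp_preservesFiniteLimits _ _

variable (E : Type (u + 1)) [Category.{u} E] [IsGrothendieckTopos.{u} E]

/-- Pseudo-cones with vertex `T` over the system `(G_𝒰)` of topoi and geometric morphisms: for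
each cover `𝒰` a geometric morphism `T ⟶ G_𝒰`, and for each refinement `h : 𝒰 ⟶ 𝒱` an invertible
2-cell from the composite `T ⟶ G_𝒰 ⟶ G_𝒱` to `T ⟶ G_𝒱`, compatible with identities and
composition. -/
structure PseudoCone (T : Type u₁) [Category.{v₁} T] where
  leg : ∀ 𝒰 : Cover E, GeomMorphism T (GCat 𝒰)
  iso : ∀ {𝒰 𝒱 : Cover E} (h : 𝒰 ⟶ 𝒱), transition h ⋙ (leg 𝒰).inv ≅ (leg 𝒱).inv
  iso_id : ∀ (𝒰 : Cover E) (X : GCat 𝒰),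
    (iso (𝟙 𝒰)).hom.app X = (leg 𝒰).inv.map (transitionId X).hom
  iso_comp : ∀ {𝒰 𝒱 𝒲 : Cover E} (h : 𝒰 ⟶ 𝒱) (k : 𝒱 ⟶ 𝒲) (X : GCat 𝒲),
    (iso (h ≫ k)).hom.app X = (leg 𝒰).inv.map (transitionComp h k X).hom ≫
      (iso h).hom.app ((transition k).obj X) ≫ (iso k).hom.app X

variable {E}

/-- Morphisms of pseudo-cones: families of 2-cells between the legs compatible with the structural
2-cells. -/
@[ext]
structure PseudoCone.Hom {T : Type u₁} [Category.{v₁} T] (c d : PseudoCone E T) where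
  τ : ∀ 𝒰 : Cover E, c.leg 𝒰 ⟶ d.leg 𝒰
  comm : ∀ {𝒰 𝒱 : Cover E} (h : 𝒰 ⟶ 𝒱) (X : GCat 𝒱),
    (c.iso h).hom.app X ≫ NatTrans.app (τ 𝒱) X =
      NatTrans.app (τ 𝒰) ((transition h).obj X) ≫ (d.iso h).hom.app X

instance (T : Type u₁) [Category.{v₁} T] : Category (PseudoCone E T) where
  Hom := PseudoCone.Hom
  id c := ⟨fun _ => 𝟙 _, fun h X => (Category.comp_id _).trans (Category.id_comp _).symm⟩
  comp {c d e} α β := ⟨fun 𝒰 => α.τ 𝒰 ≫ β.τ 𝒰, fun {𝒰 𝒱} h X => by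
    change _ ≫ NatTrans.app (α.τ 𝒱) X ≫ NatTrans.app (β.τ 𝒱) X =
      (NatTrans.app (α.τ 𝒰) _ ≫ NatTrans.app (β.τ 𝒰) _) ≫ _
    rw [← Category.assoc, α.comm, Category.assoc, β.comm, Category.assoc]⟩
  id_comp α := PseudoCone.Hom.ext (funext fun _ => Category.id_comp _)
  comp_id α := PseudoCone.Hom.ext (funext fun _ => Category.comp_id _)
  assoc α β γ := PseudoCone.Hom.ext (funext fun _ => Category.assoc _ _ _)

/-- Composition with a pseudo-cone `c` with vertex `L`: the functor from the geometric morphisms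
`T ⟶ L` to the pseudo-cones with vertex `T`. -/
def PseudoCone.precomp {L : Type u₂} [Category.{v₂} L] (c : PseudoCone E L)
    (T : Type u₁) [Category.{v₁} T] : GeomMorphism T L ⥤ PseudoCone E T where
  obj p :=
    { leg := fun 𝒰 => p.comp (c.leg 𝒰)
      iso := fun h => Functor.isoWhiskerRight (c.iso h) p.inv
      iso_id := fun 𝒰 X => congrArg p.inv.map (c.iso_id 𝒰 X)
      iso_comp := fun h k X => by
        have := congrArg p.inv.map (c.iso_comp h k X)
        rw [Functor.map_comp, Functor.map_comp] at this
        exact this }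
  map {p q} α :=
    { τ := fun 𝒰 => Functor.whiskerLeft (c.leg 𝒰).inv α
      comm := fun h X => NatTrans.naturality α ((c.iso h).hom.app X) }

/-- A pseudo-cone with vertex `L` is a limit in the 2-category of Grothendieck topoi if, for every
Grothendieck topos `T`, composition with it is an equivalence from the category of geometric
morphisms `T ⟶ L` to the category of pseudo-cones with vertex `T`. -/
def PseudoCone.IsLimit.{u₃, v₃, u₄, v₄, u₅} {E : Type (u₅ + 1)} [Category.{u₅} E]
    [IsGrothendieckTopos.{u₅} E] {L : Type u₄} [Category.{v₄} L] (c : PseudoCone E L) : Prop :=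
  ∀ (T : Type u₃) [Category.{v₃} T] [IsGrothendieckTopos.{u₅} T], (c.precomp T).IsEquivalence

/-- A pseudo-cone with vertex `G(E)` is the canonical one if, on covering projections, its inverse
image functors `λ_𝒰^* : G_𝒰 ⥤ G(E)` are the composite of `CovProj 𝒰 ⥤ cG(E)` with the functor
sending an object of `cG(E)` to the sheaf associated with its representable presheaf, compatibly
with the isomorphisms `(h^* X, 𝒰) ≅ (X, 𝒱)` of `cG(E)`. Here `η` is the arrow to the associated
sheaf; to say that it belongs to `W` is to say that it induces a bijection on the maps to any
sheaf. -/
def PseudoCone.IsCanonical (c : PseudoCone E (GTopos E)) : Prop :=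
  ∃ η : ∀ 𝒰 : Cover E, lam 𝒰 ⋙ yoneda ⟶
      incl 𝒰 ⋙ (c.leg 𝒰).inv ⋙ sheafToPresheaf (topology E) (Type u),
    (∀ (𝒰 : Cover E) (X : CovProj 𝒰), (topology E).W ((η 𝒰).app X)) ∧
    ∀ {𝒰 𝒱 : Cover E} (h : 𝒰 ⟶ 𝒱) (X : CovProj 𝒱),
      (η 𝒰).app ((covPullback h).obj X) ≫
          (sheafToPresheaf (topology E) (Type u)).map ((c.iso h).hom.app ((incl 𝒱).obj X)) =
        yoneda.map (lamIso h X).hom ≫ (η 𝒱).app X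

end Limits

end FundTopos

end

open FundTopos

/-! An object of P_𝒰 is known from its stalks: the sets S i, together with the relations `Rel`
between S i and S j along spans U i ← C → U j, which say that two sections of X agree over C. The
sections form an epimorphic family (`elt_epi`), epimorphic families in a topos are effective
(`EpiFamily.effective`), and over a non-empty C a relation is a partial injection. So arrows are the
families of functions preserving the relations (`exists_hom`), pullbacks are computed on stalks
(`exists_isStalkPullback`), and X is a covering projection exactly when, locally on every span, the
relation is a total function (`chartSieve`). Covering projections are therefore closed under finite
limits, under objects mapping injectively to finite families of them, and under quotients.

Split X into orbits under the equivalence relation generated by the `Rel`. Then X is a sum of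
covering projections if and only if each of its elements comes from a covering projection
(`isSumOfCoverings_iff`). A point of an orbit is determined by a chain of spans out of generators
starting at a base point. This bounds the stalks and makes the site of covering projections, with
the stalkwise surjective sieves, densely small. G_𝒰 is the category of sheaves on this site
(`sectionSheaf_isEquivalence`). To realize a sheaf A in G_𝒰, the functors "underlying object" and
"stalk at i" are lex and epimorphic on covers, so they extend to geometric morphisms out of E and
Set. The trivializations are natural on covering projections and extend to A by density of the
representables (`exists_realization`). Diaconescu's theorem (`exists_geomMorphism`) then describes
the geometric morphisms to G_𝒰.

The same method applies to cG(E): being an arrow of cG(E) is a local condition on stalks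
(`isArrow_of_mem`), every cospan lives over a single cover (`exists_lam_cospan`), and covers by sets
of generators suffice, so the site is lex and densely small. A pseudo-cone d with vertex T yields a
functor cG(E) ⥤ T. An arrow is lifted to some common refinement and conjugated by the structural
isomorphisms of d; the choice is immaterial because two lifts of the same arrow are restrictions of
one lift over the disjoint union of the two covers (`lift_eq`). This functor is lex and epimorphic
on covers, so it extends to a geometric morphism T → G(E). Conversely, any functor on cG(E) whose
restrictions to covering projections extend to geometric morphisms underlies a pseudo-cone
(`exists_extension`); the canonical cone is the one extending the sheafified Yoneda functor. All
comparisons of 2-cells are made on representables or on covering projections, which are dense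
(`homDense_ayoneda`, `homDense_incl`). -/

noncomputable section

universe w' v' w'' v''

namespace FundTopos

/-! ### Lex sites with a small dense subcategory -/

section Sites

variable {C : Type w} [Category.{u} C]

/-- The shapes of the terminal object and of pullbacks. -/
def lexShape : Bool → Type
  | true => WalkingCospan
  | false => Discrete PEmpty

instance (b : Bool) : SmallCategory (lexShape b) :=
  match b with
  | true => inferInstanceAs (Category WalkingCospan)
  | false => inferInstanceAs (Category (Discrete PEmpty))

/-- A site is densely small if its objects are covered by those of an essentially small family. -/
class IsDenselySmall (J : GrothendieckTopology C) : Prop where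
  exists_dense (J) : ∃ P : ObjectProperty C, ObjectProperty.EssentiallySmall.{u} P ∧
    ∀ X : C, ∃ S ∈ J X, ∀ ⦃Y : C⦄ (f : Y ⟶ X), S f →
      ∃ (Z : C) (g : Y ⟶ Z) (h : Z ⟶ X), P Z ∧ g ≫ h = f

/-- A densely small site with finite limits has a small dense subcategory closed under finite
limits. -/
theorem exists_small_lex [HasFiniteLimits C] (J : GrothendieckTopology C) [IsDenselySmall J] :
    ∃ (C₀ : Type u) (_ : SmallCategory C₀) (_ : HasFiniteLimits C₀) (ι : C₀ ⥤ C),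
      ι.Full ∧ ι.Faithful ∧ PreservesFiniteLimits ι ∧ ι.IsCoverDense J := by
  obtain ⟨P, hP, h⟩ := IsDenselySmall.exists_dense J
  -- Terminal objects and pullbacks generate all finite limits. Closing under just these two shapes
  -- keeps the subcategory essentially small.
  let Q := P.limitsClosure lexShape
  have hQ : ObjectProperty.EssentiallySmall.{u} Q := inferInstance
  have h1 : Q.IsClosedUnderLimitsOfShape WalkingCospan :=
    inferInstanceAs ((P.limitsClosure lexShape).IsClosedUnderLimitsOfShape (lexShape true))
  have h2 : Q.IsClosedUnderLimitsOfShape (Discrete PEmpty) :=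
    inferInstanceAs ((P.limitsClosure lexShape).IsClosedUnderLimitsOfShape (lexShape false))
  have : HasTerminal Q.FullSubcategory := 
    inferInstanceAs (HasLimitsOfShape (Discrete PEmpty) Q.FullSubcategory)
  have : HasPullbacks Q.FullSubcategory := 
    inferInstanceAs (HasLimitsOfShape WalkingCospan Q.FullSubcategory)
  have : HasFiniteLimits Q.FullSubcategory := hasFiniteLimits_of_hasTerminal_and_pullbacks
  have : PreservesFiniteLimits Q.ι :=
    preservesFiniteLimits_of_preservesTerminal_and_pullbacks _
  let e := equivSmallModel.{u} Q.FullSubcategory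
  have : HasFiniteLimits (SmallModel.{u} Q.FullSubcategory) :=
    ⟨fun K _ _ => Adjunction.hasLimitsOfShape_of_equivalence e.inverse⟩
  refine ⟨SmallModel.{u} Q.FullSubcategory, inferInstance, inferInstance, e.inverse ⋙ Q.ι,
    inferInstance, inferInstance, comp_preservesFiniteLimits _ _, ⟨fun X => ?_⟩⟩
  obtain ⟨S, hS, hS'⟩ := h X
  refine J.superset_covering (fun Y f hf => ?_) hS
  obtain ⟨Z, g, k, hZ, rfl⟩ := hS' f hf
  let Z' : Q.FullSubcategory := ⟨Z, P.le_limitsClosure _ _ hZ⟩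
  let i : (e.inverse ⋙ Q.ι).obj (e.functor.obj Z') ≅ Z := Q.ι.mapIso (e.unitIso.app Z').symm
  exact ⟨⟨e.functor.obj Z', g ≫ i.inv, i.hom ≫ k, by simp⟩⟩

variable (J : GrothendieckTopology C) [IsDenselySmall J] [HasFiniteLimits C]

/-- By the comparison lemma, restriction to a small dense subcategory is an equivalence on sheaves,
which transports sheafification from the small site. -/
theorem hasSheafify_of_densely_small : HasSheafify J (Type u) := by
  obtain ⟨C₀, _, _, ι, _, _, _, _⟩ := exists_small_lex J
  exact Functor.IsDenseSubsite.hasSheafify_of_isEquivalence (ι.inducedTopology J) J ι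

theorem isGrothendieckTopos_sheaf : IsGrothendieckTopos.{u} (Sheaf J (Type u)) := by
  obtain ⟨C₀, _, _, ι, _, _, _, _⟩ := exists_small_lex J
  exact ⟨C₀, inferInstance, ι.inducedTopology J,
    ⟨(ι.sheafInducedTopologyEquivOfIsCoverDense J (Type u)).symm⟩⟩

end Sites

/-! ### Flat functors: extensions to presheaves that preserve finite limits -/

section Flat

variable {C₀ : Type u} [SmallCategory C₀]

/-- Colimit preserving functors on presheaves are determined by their values on representables. -/
def extensionIso {T : Type (u + 1)} [Category.{u} T] [HasColimitsOfSize.{u, u} T]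
    (L L' : (C₀ᵒᵖ ⥤ Type u) ⥤ T) [PreservesColimitsOfSize.{u, u} L]
    [PreservesColimitsOfSize.{u, u} L'] (e : uliftYoneda.{u} ⋙ L ≅ uliftYoneda.{u} ⋙ L') :
    L ≅ L' :=
  Presheaf.uniqueExtensionAlongULiftYoneda.{u, u, u, u, u + 1}
      (A := uliftYoneda.{u} ⋙ L') L e.symm ≪≫
    (Presheaf.uniqueExtensionAlongULiftYoneda.{u, u, u, u, u + 1}
      (A := uliftYoneda.{u} ⋙ L') L' (Iso.refl _)).symm

variable [HasFiniteLimits C₀]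

/-- The extension to presheaves of a finite limit preserving functor to sets preserves finite
limits. -/
lemma preservesFiniteLimits_extension (H : C₀ ⥤ Type u) [PreservesFiniteLimits H]
    (L : (C₀ᵒᵖ ⥤ Type u) ⥤ Type u) [PreservesColimitsOfSize.{u, u} L]
    (e : uliftYoneda.{u} ⋙ L ≅ H) : PreservesFiniteLimits L := by
  have := H.isCofiltered_elements
  -- M restricts a presheaf to the category of elements of H and takes the colimit. Since H is lex,
  -- that colimit is filtered, hence commutes with finite limits. M and L agree on representables.
  let M : (C₀ᵒᵖ ⥤ Type u) ⥤ Type u :=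
    (Functor.whiskeringLeft _ _ _).obj (CategoryOfElements.π H).op ⋙ colim
  have : PreservesFiniteLimits M := comp_preservesFiniteLimits _ _
  have : PreservesColimitsOfSize.{u, u} M := comp_preservesColimits _ _
  let e' : uliftYoneda.{u} ⋙ M ≅ H :=
    Functor.isoWhiskerRight (uliftYonedaIsoYoneda.{u} ≪≫ shrinkYonedaIsoYoneda.symm) M ≪≫
    (Functor.Elements.shrinkYonedaCompWhiskeringLeftObjπCompColimIso H)
  exact preservesFiniteLimits_of_natIso (extensionIso M L (e' ≪≫ e.symm))

/-- Finite limits of presheaves are computed objectwise, so the set-valued case applies after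
evaluation at each object of D. -/
lemma preservesFiniteLimits_leftKanExtension {D : Type u} [SmallCategory D]
    (H : C₀ ⥤ Dᵒᵖ ⥤ Type u) [PreservesFiniteLimits H] 
    (L : (C₀ᵒᵖ ⥤ Type u) ⥤ Dᵒᵖ ⥤ Type u) [PreservesColimitsOfSize.{u, u} L]
    (e : uliftYoneda.{u} ⋙ L ≅ H) :
    PreservesFiniteLimits L := by
  constructor
  intro K _ _
  apply preservesLimitsOfShape_of_evaluation
  intro d
  have : PreservesFiniteLimits (L ⋙ (evaluation _ _).obj d) :=
    preservesFiniteLimits_extension (H ⋙ (evaluation _ _).obj d) _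
      (Functor.isoWhiskerRight e ((evaluation _ _).obj d))
  infer_instance

end Flat

/-! ### Diaconescu's theorem for lex, densely small sites -/

section Geom

variable {C : Type w} [Category.{u} C] {J : GrothendieckTopology C} [HasSheafify J (Type u)]

variable (J) in
/-- The functor sending an object to the sheaf associated with the presheaf it represents. -/
abbrev ayoneda : C ⥤ Sheaf J (Type u) := yoneda ⋙ presheafToSheaf J (Type u)

variable {T : Type w'} [Category.{u} T] (F : C ⥤ T)
  (hF : ∀ t, Presieve.IsSheaf J (F.op ⋙ yoneda.obj t))

/-- The functor `t ↦ Hom(F -, t)` with values in sheaves. -/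
def nerveSheaf : T ⥤ Sheaf J (Type u) where
  obj t := ⟨F.op ⋙ yoneda.obj t, (isSheaf_iff_isSheaf_of_type _ _).2 (hF t)⟩
  map f := ⟨Functor.whiskerLeft F.op (yoneda.map f)⟩

variable {F hF}

/-- A left adjoint of `t ↦ Hom(F -, t)` extends `F`. -/
def ayonedaCompIso {inv : Sheaf J (Type u) ⥤ T} (adj : inv ⊣ nerveSheaf F hF) :
    F ≅ ayoneda J ⋙ inv := by
  let η : ∀ X : C, yoneda.obj X ⟶ ((nerveSheaf F hF).obj (inv.obj ((ayoneda J).obj X))).obj :=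
    fun X => toSheafify J (yoneda.obj X) ≫ (adj.unit.app ((ayoneda J).obj X)).hom
  let α : F ⟶ ayoneda J ⋙ inv :=
    { app := fun X => yonedaEquiv (η X)
      naturality := fun X Y f => by
        have h1 : yoneda.map f ≫ η Y = η X ≫ ((nerveSheaf F hF).map
            (inv.map ((ayoneda J).map f))).hom := by
          have e1 := congrArg (fun k => k.hom) (adj.unit.naturality ((ayoneda J).map f))
          have e2 := toSheafify_naturality J (yoneda.map f)
          dsimp only [η]
          rw [← Category.assoc, e2, Category.assoc, Category.assoc]
          congr 1
        have h2 := congrArg yonedaEquiv h1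
        rw [← yonedaEquiv_naturality] at h2
        exact h2 }
  have : ∀ X, IsIso (α.app X) := fun X => by
    rw [isIso_iff_coyoneda_map_bijective]
    intro t
    -- Precomposition with the component of α is the composite of three bijections: the adjunction,
    -- sheafification and Yoneda. So that component is invertible.
    have : (fun g : (ayoneda J ⋙ inv).obj X ⟶ t => α.app X ≫ g) =
        (adj.homEquiv _ _).trans (((sheafificationAdjunction J (Type u)).homEquiv _ _).trans
          yonedaEquiv) := by
      funext g
      simp only [Equiv.trans_apply, Adjunction.homEquiv_unit]
      exact (by rfl : yonedaEquiv (η X) ≫ g = yonedaEquiv (toSheafify J (yoneda.obj X) ≫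
        ((adj.unit.app ((ayoneda J).obj X)).hom ≫ ((nerveSheaf F hF).map g).hom)))
    rw [this]
    exact Equiv.bijective _
  exact @asIso _ _ _ _ α (NatIso.isIso_of_isIso_app α)

variable [IsDenselySmall J] [HasFiniteLimits C]

omit [HasSheafify J (Type u)] in

-- The left adjoint restricts a sheaf to a small dense lex subcategory, applies the left Kan
-- extension of F along Yoneda, and sheafifies. Each of the three steps preserves finite limits.
theorem exists_leftAdjoint_nerveSheaf {D : Type u} [SmallCategory D] {K : GrothendieckTopology D}
    (F : C ⥤ Sheaf K (Type u)) [PreservesFiniteLimits F]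
    (hF : ∀ t, Presieve.IsSheaf J (F.op ⋙ yoneda.obj t)) :
    ∃ inv : Sheaf J (Type u) ⥤ Sheaf K (Type u), Nonempty (inv ⊣ nerveSheaf F hF) ∧
      PreservesFiniteLimits inv := by
  obtain ⟨C₀, _, _, ι, _, _, _, _⟩ := exists_small_lex J
  let r : Sheaf J (Type u) ⥤ C₀ᵒᵖ ⥤ Type u :=
    ι.sheafPushforwardContinuous (Type u) (ι.inducedTopology J) J ⋙ sheafToPresheaf _ _
  have : PreservesFiniteLimits r := inferInstanceAs (PreservesFiniteLimits
    (sheafToPresheaf J (Type u) ⋙ (Functor.whiskeringLeft _ _ (Type u)).obj ι.op))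
  let H : C₀ ⥤ Dᵒᵖ ⥤ Type u := ι ⋙ F ⋙ sheafToPresheaf _ _
  have : PreservesFiniteLimits H := inferInstance
  let L : (C₀ᵒᵖ ⥤ Type u) ⥤ Dᵒᵖ ⥤ Type u := uliftYoneda.{u}.leftKanExtension H
  let α : H ⟶ uliftYoneda.{u} ⋙ L := uliftYoneda.{u}.leftKanExtensionUnit H
  have hα : L.IsLeftKanExtension α :=
    inferInstanceAs ((uliftYoneda.{u}.leftKanExtension H).IsLeftKanExtension _)
  let adj1 : L ⊣ Presheaf.restrictedULiftYoneda.{u} H :=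
    Presheaf.uliftYonedaAdjunction.{u, u, u, u, u + 1} L α
  have : PreservesColimitsOfSize.{u, u, u, u, u + 1, u + 1} L :=
    adj1.leftAdjoint_preservesColimits
  have : IsIso α := (Presheaf.isLeftKanExtension_along_uliftYoneda_iff.{u, u, u, u, u + 1} L α).1 hα |>.1
  let e : H ≅ uliftYoneda.{u} ⋙ L := asIso α
  have : PreservesFiniteLimits L := preservesFiniteLimits_leftKanExtension H L e.symm
  let adj := adj1.comp (sheafificationAdjunction K (Type u))
  let comm : 𝟭 _ ⋙ sheafToPresheaf K (Type u) ⋙ Presheaf.restrictedULiftYoneda.{u} H ≅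
      nerveSheaf F hF ⋙ r := NatIso.ofComponents (fun t => NatIso.ofComponents (fun c =>
        Equiv.toIso (Equiv.ulift.trans
          ((fullyFaithfulSheafToPresheaf K (Type u)).homEquiv (X := F.obj (ι.obj c.unop))
            (Y := t)).symm))
        (fun f => rfl)) (fun f => rfl)
  -- The adjunction exists at the level of presheaves on C₀. Its right adjoint takes values in the
  -- image of the fully faithful r, by `comm`, so it restricts.
  refine ⟨r ⋙ L ⋙ presheafToSheaf K (Type u), ⟨adj.restrictFullyFaithful
    (Functor.FullyFaithful.ofFullyFaithful r) (Functor.FullyFaithful.id _)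
    (Functor.rightUnitor _).symm comm⟩, ?_⟩
  have : PreservesFiniteLimits (L ⋙ presheafToSheaf K (Type u)) := comp_preservesFiniteLimits _ _
  exact comp_preservesFiniteLimits _ _

end Geom

/-! ### Epimorphic families in a topos -/

section Effective

lemma EpiFamily.map_leftAdjoint {C : Type w} [Category.{v} C] {D : Type w'} [Category.{v'} D]
    {A : Sort*} {X : C} {Y : A → C} {f : ∀ a, Y a ⟶ X} (hf : EpiFamily f) {L : C ⥤ D} {R : D ⥤ C}
    (adj : L ⊣ R) : EpiFamily fun a => L.map (f a) := fun Z p q h =>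
  (adj.homEquiv _ _).injective (hf _ _ fun a => by
    rw [← adj.homEquiv_naturality_left, ← adj.homEquiv_naturality_left, h a])

section Sheaves

variable {C : Type u} [SmallCategory C] {J : GrothendieckTopology C}

/-- Epimorphic families of sheaves are effective. -/
theorem EpiFamily.sheaf_effective {A : Sort*} {X Z : Sheaf J (Type u)} {Y : A → Sheaf J (Type u)}
    {f : ∀ a, Y a ⟶ X} (hf : EpiFamily f) (g : ∀ a, Y a ⟶ Z)
    (H : ∀ a b ⦃D : Sheaf J (Type u)⦄ (k : D ⟶ Y a) (l : D ⟶ Y b),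
      k ≫ f a = l ≫ f b → k ≫ g a = l ≫ g b) : ∃ φ : X ⟶ Z, ∀ a, f a ≫ φ = g a := by
  have H' : ∀ a b (d : C) (y : (Y a).obj.obj (op d)) (y' : (Y b).obj.obj (op d)),
      (f a).hom.app _ y = (f b).hom.app _ y' → (g a).hom.app _ y = (g b).hom.app _ y' := by
    intro a b d y y' h
    let Fn : Sheaf J (Type u) ⥤ Type u := sheafToPresheaf J (Type u) ⋙ (evaluation _ _).obj (op d)
    have sq := (IsPullback.of_hasPullback (f a) (f b)).map Fn
    obtain ⟨z, hz, hz'⟩ := Types.exists_of_isPullback sq y y' h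
    have e1 := H a b (pullback.fst _ _) (pullback.snd _ _) pullback.condition
    have e2 := ConcreteCategory.congr_hom
      (congrArg (fun t : pullback (f a) (f b) ⟶ Z => t.hom.app (op d)) e1) z
    have hz1 : (pullback.fst (f a) (f b)).hom.app (op d) z = y := hz
    have hz2 : (pullback.snd (f a) (f b)).hom.app (op d) z = y' := hz'
    have e3 : (g a).hom.app _ ((pullback.fst (f a) (f b)).hom.app (op d) z) =
      (g b).hom.app _ ((pullback.snd (f a) (f b)).hom.app (op d) z) := e2
    rwa [hz1, hz2] at e3
  have hZ := (isSheaf_iff_isSheaf_of_type J Z.obj).1 Z.property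
  have nat : ∀ {P Q : Sheaf J (Type u)} (h : P ⟶ Q) {c d : C} (k : d ⟶ c) (x : P.obj.obj (op c)),
      h.hom.app _ (P.obj.map k.op x) = Q.obj.map k.op (h.hom.app _ x) := fun h _ _ k x =>
    ConcreteCategory.congr_hom (h.hom.naturality k.op) x
  -- The value z at x is characterized by all local preimages of x at once, not just those over one
  -- chosen sieve. This makes naturality follow from uniqueness.
  have ex : ∀ (c : C) (x : X.obj.obj (op c)), ∃ z : Z.obj.obj (op c), ∀ (d : C) (k : d ⟶ c)
      (a : A) (y : (Y a).obj.obj (op d)), (f a).hom.app _ y = X.obj.map k.op x →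
        (g a).hom.app _ y = Z.obj.map k.op z := by
    intro c x
    obtain ⟨S, hS, h⟩ := locally_surjective hf x
    choose a y hy using h
    let fam : Presieve.FamilyOfElements Z.obj S.arrows := fun d k hk =>
      (g (a k hk)).hom.app _ (y k hk)
    have comp : fam.Compatible := by
      intro d₁ d₂ e k₁ k₂ l₁ l₂ h₁ h₂ hc
      change Z.obj.map k₁.op ((g _).hom.app _ _) = Z.obj.map k₂.op ((g _).hom.app _ _)
      rw [← nat, ← nat]
      apply H'
      rw [nat, nat, hy, hy, ← comp_apply, ← comp_apply, ← Functor.map_comp, ← Functor.map_comp,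
        ← op_comp, ← op_comp, hc]
    obtain ⟨z, hz, -⟩ := hZ S hS fam comp
    refine ⟨z, fun d k b y' hy' => ?_⟩
    refine (hZ _ (J.pullback_stable k hS)).isSeparatedFor.ext fun e l hl => ?_
    have e1 : Z.obj.map l.op (Z.obj.map k.op z) = fam (l ≫ k) hl := by
      rw [← hz (l ≫ k) hl, op_comp, Functor.map_comp, comp_apply]
    rw [← nat, e1]
    apply H'
    rw [nat, hy']
    refine Eq.trans ?_ (hy (l ≫ k) hl).symm
    rw [op_comp, Functor.map_comp, comp_apply]
  choose φ hφ using ex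
  have uniq : ∀ (c : C) (x : X.obj.obj (op c)) (z z' : Z.obj.obj (op c)),
      (∀ (d : C) (k : d ⟶ c) (a : A) (y : (Y a).obj.obj (op d)),
        (f a).hom.app _ y = X.obj.map k.op x → Z.obj.map k.op z = Z.obj.map k.op z') → z = z' := by
    intro c x z z' h
    obtain ⟨S, hS, h'⟩ := locally_surjective hf x
    refine (hZ S hS).isSeparatedFor.ext fun d k hk => ?_
    obtain ⟨a, y, hy⟩ := h' k hk
    exact h d k a y hy
  let Φ : X ⟶ Z := ⟨
    { app := fun c => ↾(φ c.unop)
      naturality := by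
        rintro ⟨c⟩ ⟨d⟩ ⟨k⟩
        ext x
        refine uniq d (X.obj.map k.op x) _ _ fun e l a y hy => ?_
        change Z.obj.map l.op (φ d (X.obj.map k.op x)) = Z.obj.map l.op (Z.obj.map k.op (φ c x))
        rw [← hφ d _ e l a y hy, ← comp_apply, ← Functor.map_comp, ← op_comp]
        refine hφ c x e (l ≫ k) a y ?_
        rw [hy, op_comp, Functor.map_comp, comp_apply] }⟩
  refine ⟨Φ, fun a => ?_⟩
  apply (sheafToPresheaf J (Type u)).map_injective
  ext ⟨c⟩ y
  change φ c ((f a).hom.app _ y) = (g a).hom.app _ y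
  have := hφ c ((f a).hom.app _ y) c (𝟙 c) a y (by simp)
  simpa using this.symm

end Sheaves

variable {T : Type w'} [Category.{v'} T] [IsGrothendieckTopos.{u} T]

variable (T) in
/-- A topos is equivalent to a category of sheaves on a small site. -/
lemma exists_equivalence : ∃ (C : Type u) (_ : SmallCategory C) (J : GrothendieckTopology C),
    Nonempty (T ≌ Sheaf J (Type u)) := IsGrothendieckTopos.exists_site

/-- Epimorphic families in a topos are effective. -/
theorem EpiFamily.effective {A : Sort*} {X Z : T} {Y : A → T}
    {f : ∀ a, Y a ⟶ X} (hf : EpiFamily f) (g : ∀ a, Y a ⟶ Z)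
    (H : ∀ a b ⦃D : T⦄ (k : D ⟶ Y a) (l : D ⟶ Y b), k ≫ f a = l ≫ f b → k ≫ g a = l ≫ g b) :
    ∃ φ : X ⟶ Z, ∀ a, f a ≫ φ = g a := by
  obtain ⟨C, _, J, ⟨e⟩⟩ := exists_equivalence.{u} T
  obtain ⟨φ, hφ⟩ := (hf.map_leftAdjoint e.toAdjunction).sheaf_effective
    (fun a => e.functor.map (g a)) (fun a b D k l h => by
      obtain ⟨k', hk'⟩ := e.functor.map_surjective ((e.functor.objObjPreimageIso D).hom ≫ k)
      obtain ⟨l', hl'⟩ := e.functor.map_surjective ((e.functor.objObjPreimageIso D).hom ≫ l)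
      rw [← cancel_epi (e.functor.objObjPreimageIso D).hom, ← Category.assoc, ← hk',
        ← Category.assoc, ← hl', ← Functor.map_comp, ← Functor.map_comp]
      refine congrArg e.functor.map (H a b k' l' (e.functor.map_injective ?_))
      rw [Functor.map_comp, Functor.map_comp, hk', hl', Category.assoc, Category.assoc, h])
  obtain ⟨ψ, rfl⟩ := e.functor.map_surjective φ
  exact ⟨ψ, fun a => e.functor.map_injective (by rw [Functor.map_comp, hφ])⟩

/-- Epimorphic families in a topos are stable under base change. -/
theorem EpiFamily.baseChange {A : Sort*} {X : T} {Y : A → T} {f : ∀ a, Y a ⟶ X}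
    (hf : EpiFamily f) {W Z : T} (g : W ⟶ X) (p q : W ⟶ Z)
    (H : ∀ a ⦃D : T⦄ (k : D ⟶ W) (l : D ⟶ Y a), k ≫ g = l ≫ f a → k ≫ p = k ≫ q) : p = q := by
  obtain ⟨C, _, J, ⟨e⟩⟩ := exists_equivalence.{u} T
  refine e.functor.map_injective (sheaf_epi_pullback (hf.map_leftAdjoint e.toAdjunction)
    (e.functor.map g) _ _ fun a D k l h => ?_)
  obtain ⟨k', hk'⟩ := e.functor.map_surjective ((e.functor.objObjPreimageIso D).hom ≫ k)
  obtain ⟨l', hl'⟩ := e.functor.map_surjective ((e.functor.objObjPreimageIso D).hom ≫ l)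
  rw [← cancel_epi (e.functor.objObjPreimageIso D).hom, ← Category.assoc, ← Category.assoc, ← hk',
    ← Functor.map_comp, ← Functor.map_comp]
  refine congrArg e.functor.map (H a k' l' (e.functor.map_injective ?_))
  rw [Functor.map_comp, Functor.map_comp, hk', hl', Category.assoc, Category.assoc, h]

/-- The presheaves `Hom(F -, t)` have unique amalgamations along sieves which `F` sends to
epimorphic families. -/
theorem isSheafFor_of_epiFamily {C : Type w} [Category.{v} C] [HasPullbacks C] (F : C ⥤ T)
    [PreservesLimitsOfShape WalkingCospan F] {X : C} {S : Sieve X}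
    (hS : EpiFamily fun f : {f : Σ Y, Y ⟶ X // S f.2} => F.map f.1.2) (t : T) :
    Presieve.IsSheafFor (F.op ⋙ yoneda.obj t) S.arrows := by
  intro x hx
  obtain ⟨φ, hφ⟩ := hS.effective (fun f => x f.1.2 f.2) (fun f g D k l h => by
    -- Compatibility is only known on objects coming from C. Since F preserves the pullback, any D
    -- over the two arrows factors through it.
    have sq := (IsPullback.of_hasPullback f.1.2 g.1.2).map F
    have e : F.map (pullback.fst f.1.2 g.1.2) ≫ x f.1.2 f.2 =
      F.map (pullback.snd f.1.2 g.1.2) ≫ x g.1.2 g.2 :=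
        hx (pullback.fst f.1.2 g.1.2) (pullback.snd f.1.2 g.1.2) f.2 g.2 pullback.condition
    have e1 := sq.lift_fst k l h
    have e2 := sq.lift_snd k l h
    refine (congrArg (fun r => r ≫ _) e1).symm.trans (Eq.trans ?_ (congrArg (fun r => r ≫ _) e2))
    exact (Category.assoc _ _ _).trans
      ((congrArg (fun r => sq.lift k l h ≫ r) e).trans (Category.assoc _ _ _).symm))
  exact ⟨φ, fun Y f hf => hφ ⟨⟨Y, f⟩, hf⟩,
    fun ψ hψ => hS _ _ fun f => (hψ f.1.2 f.2).trans (hφ f).symm⟩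

/-- A functor to a topos is epimorphic on covers if it sends covering sieves to epimorphic
families. -/
def EpiOnCovers {C : Type w} [Category.{v} C] (J : GrothendieckTopology C) {T : Type w'}
    [Category.{v'} T] (F : C ⥤ T) : Prop :=
  ∀ ⦃X : C⦄ ⦃S : Sieve X⦄, S ∈ J X → EpiFamily fun f : {f : Σ Y, Y ⟶ X // S f.2} => F.map f.1.2

/-- A finite limit preserving functor to a topos which is epimorphic on covers extends to the
inverse image of a geometric morphism. -/
theorem exists_geomMorphism {C : Type w} [Category.{u} C] {J : GrothendieckTopology C}
    [IsDenselySmall J] [HasFiniteLimits C] [HasSheafify J (Type u)] (F : C ⥤ T)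
    [PreservesFiniteLimits F] (hF : EpiOnCovers J F) :
    ∃ p : GeomMorphism T (Sheaf J (Type u)), Nonempty (F ≅ ayoneda J ⋙ p.inv) := by
  obtain ⟨D, _, K, ⟨e⟩⟩ := exists_equivalence.{u} T
  have : PreservesFiniteLimits (F ⋙ e.functor) := comp_preservesFiniteLimits _ _
  have : IsGrothendieckTopos.{u} (Sheaf K (Type u)) := ⟨D, inferInstance, K, ⟨CategoryTheory.Equivalence.refl⟩⟩
  -- The statement is proved for T a category of sheaves on a small site and carried back along an
  -- equivalence.
  have hF' : ∀ t, Presieve.IsSheaf J ((F ⋙ e.functor).op ⋙ yoneda.obj t) := fun t X S hS =>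
    isSheafFor_of_epiFamily (F ⋙ e.functor) ((hF hS).map_leftAdjoint e.toAdjunction) t
  obtain ⟨inv, ⟨adj⟩, _⟩ := exists_leftAdjoint_nerveSheaf (F ⋙ e.functor) hF'
  let i := ayonedaCompIso adj
  exact ⟨⟨inv ⋙ e.inverse, e.functor ⋙ nerveSheaf _ hF', adj.comp e.symm.toAdjunction,
    comp_preservesFiniteLimits _ _⟩, ⟨(Functor.rightUnitor F).symm ≪≫
      Functor.isoWhiskerLeft F e.unitIso ≪≫ (Functor.associator _ _ _).symm ≪≫
      Functor.isoWhiskerRight i e.inverse ≪≫ Functor.associator _ _ _⟩⟩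

end Effective

/-! ### Dense functors -/

section Dense

variable {C : Type w} [Category.{v} C] {L : Type w'} [Category.{v'} L]

/-- A functor `j : C ⥤ L` is dense if the functor sending an object `Y` of `L` to the presheaf
`Hom(j -, Y)` on `C` is fully faithful. -/
structure HomDense (j : C ⥤ L) : Prop where
  faithful : ∀ ⦃Y Z : L⦄ (f g : Y ⟶ Z), (∀ X (k : j.obj X ⟶ Y), k ≫ f = k ≫ g) → f = g
  full : ∀ ⦃Y Z : L⦄ (φ : ∀ X, (j.obj X ⟶ Y) → (j.obj X ⟶ Z)),
    (∀ ⦃X X' : C⦄ (f : X' ⟶ X) (k : j.obj X ⟶ Y), φ X' (j.map f ≫ k) = j.map f ≫ φ X k) →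
      ∃ h : Y ⟶ Z, ∀ X (k : j.obj X ⟶ Y), φ X k = k ≫ h

variable {j : C ⥤ L} {T : Type w''} [Category.{v''} T] {P Q : L ⥤ T} {R R' : T ⥤ L}

/-- Natural transformations out of a left adjoint are determined on a dense subcategory. -/
theorem HomDense.natTrans_ext (hj : HomDense j) (adj : P ⊣ R) {β β' : P ⟶ Q}
    (h : ∀ X, β.app (j.obj X) = β'.app (j.obj X)) : β = β' := by
  ext A
  refine (adj.homEquiv _ _).injective (hj.faithful _ _ fun X k => ?_)
  rw [← adj.homEquiv_naturality_left, ← adj.homEquiv_naturality_left, β.naturality, h,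
    β'.naturality]

/-- Natural transformations out of a left adjoint extend from a dense subcategory. -/
theorem HomDense.exists_natTrans (hj : HomDense j) (adj : P ⊣ R) (α : j ⋙ P ⟶ j ⋙ Q) :
    ∃ β : P ⟶ Q, ∀ X, β.app (j.obj X) = α.app X := by
  have ex : ∀ A : L, ∃ b : P.obj A ⟶ Q.obj A, ∀ X (k : j.obj X ⟶ A),
      P.map k ≫ b = α.app X ≫ Q.map k := by
    intro A
    -- After transposing along the adjunction, the required arrow P A ⟶ Q A becomes an arrow A ⟶ R
    -- (Q A), which fullness on the dense subcategory provides.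
    obtain ⟨h, hh⟩ := hj.full (Y := A) (Z := R.obj (Q.obj A))
      (fun X k => adj.homEquiv (j.obj X) (Q.obj A) (α.app X ≫ Q.map k)) (fun X X' f k => by
        rw [← adj.homEquiv_naturality_left]
        refine congrArg _ ?_
        have := α.naturality f
        dsimp at this
        rw [Functor.map_comp, ← Category.assoc, ← this, Category.assoc])
    refine ⟨(adj.homEquiv _ _).symm h, fun X k => (adj.homEquiv _ _).injective ?_⟩
    rw [adj.homEquiv_naturality_left, Equiv.apply_symm_apply, hh]
  choose b hb using ex
  refine ⟨⟨b, fun A B f => (adj.homEquiv _ _).injective (hj.faithful _ _ fun X k => ?_)⟩,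
    fun X => ?_⟩
  · rw [← adj.homEquiv_naturality_left, ← adj.homEquiv_naturality_left]
    refine congrArg _ ?_
    rw [← Category.assoc, ← Functor.map_comp, hb, ← Category.assoc, hb, Functor.map_comp,
      Category.assoc]
  · have := hb (j.obj X) X (𝟙 _)
    simpa using this

theorem HomDense.exists_natIso (hj : HomDense j) (adj : P ⊣ R) (adj' : Q ⊣ R')
    (α : j ⋙ P ≅ j ⋙ Q) : ∃ β : P ≅ Q, ∀ X, β.hom.app (j.obj X) = α.hom.app X := by
  obtain ⟨β, hβ⟩ := hj.exists_natTrans adj α.hom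
  obtain ⟨γ, hγ⟩ := hj.exists_natTrans adj' α.inv
  refine ⟨⟨β, γ, hj.natTrans_ext adj fun X => ?_, hj.natTrans_ext adj' fun X => ?_⟩, hβ⟩
  · rw [NatTrans.comp_app, hβ, hγ, ← NatTrans.comp_app, α.hom_inv_id]
    rfl
  · rw [NatTrans.comp_app, hβ, hγ, ← NatTrans.comp_app, α.inv_hom_id]
    rfl

end Dense

/-! ### Density of the sheafified Yoneda functor -/

section Ayoneda

variable {C : Type w} [Category.{u} C] (J : GrothendieckTopology C) [HasSheafify J (Type u)]

/-- Arrows from the sheaf associated with a representable presheaf. -/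
def ayonedaEquiv (X : C) (A : Sheaf J (Type u)) :
    ((ayoneda J).obj X ⟶ A) ≃ A.obj.obj (op X) :=
  ((sheafificationAdjunction J (Type u)).homEquiv (yoneda.obj X) A).trans yonedaEquiv

lemma ayonedaEquiv_comp {X : C} {A B : Sheaf J (Type u)} (k : (ayoneda J).obj X ⟶ A)
    (g : A ⟶ B) : ayonedaEquiv J X B (k ≫ g) = g.hom.app _ (ayonedaEquiv J X A k) := by
  simp only [ayonedaEquiv, Equiv.trans_apply, Adjunction.homEquiv_naturality_right]
  rfl

lemma ayonedaEquiv_map {X Y : C} {A : Sheaf J (Type u)} (f : Y ⟶ X)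
    (k : (ayoneda J).obj X ⟶ A) : ayonedaEquiv J Y A ((ayoneda J).map f ≫ k) =
      A.obj.map f.op (ayonedaEquiv J X A k) := by
  have := (sheafificationAdjunction J (Type u)).homEquiv_naturality_left (yoneda.map f) k
  simp only [ayonedaEquiv, Equiv.trans_apply]
  erw [this]
  rw [yonedaEquiv_naturality]

/-- The presheaf of arrows from sheafified representables to a sheaf A is A itself, by
`ayonedaEquiv`. Compatible families are then arrows of presheaves. -/
theorem homDense_ayoneda : HomDense (ayoneda J) where
  faithful A B f g h := by
    apply (sheafToPresheaf J (Type u)).map_injective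
    ext ⟨X⟩ a
    have := congrArg (ayonedaEquiv J X B) (h X ((ayonedaEquiv J X A).symm a))
    simp only [ayonedaEquiv_comp, Equiv.apply_symm_apply] at this
    exact this
  full A B φ hφ := by
    refine ⟨⟨
      { app := fun X => ↾(fun a => ayonedaEquiv J X.unop B
          (φ X.unop ((ayonedaEquiv J X.unop A).symm a)))
        naturality := ?_ }⟩, fun X k => ?_⟩
    · rintro ⟨X⟩ ⟨Y⟩ ⟨f⟩
      ext a
      obtain ⟨k, rfl⟩ := (ayonedaEquiv J X A).surjective a
      change ayonedaEquiv J Y B (φ Y ((ayonedaEquiv J Y A).symm (A.obj.map f.op _))) =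
        B.obj.map f.op (ayonedaEquiv J X B (φ X ((ayonedaEquiv J X A).symm _)))
      rw [← ayonedaEquiv_map, ← ayonedaEquiv_map, Equiv.symm_apply_apply, Equiv.symm_apply_apply,
        hφ]
    · apply (ayonedaEquiv J X B).injective
      rw [ayonedaEquiv_comp]
      change _ = ayonedaEquiv J X B (φ X ((ayonedaEquiv J X A).symm _))
      rw [Equiv.symm_apply_apply]

lemma epiOnCovers_ayoneda : EpiOnCovers J (ayoneda J) := by
  intro X S hS Z p q h
  apply (ayonedaEquiv J X Z).injective
  refine ((isSheaf_iff_isSheaf_of_type J Z.obj).1 Z.property S hS).isSeparatedFor.ext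
    fun Y f hf => ?_
  rw [← ayonedaEquiv_map, ← ayonedaEquiv_map]
  exact congrArg _ (h ⟨⟨Y, f⟩, hf⟩)

end Ayoneda

/-! ### The topology of epimorphic sieves -/

section EpiTop

variable {E : Type (u + 1)} [Category.{u} E] [IsGrothendieckTopos.{u} E]

variable (E) in
/-- The topology of the epimorphic sieves. -/
def epiTop : GrothendieckTopology E where
  sieves X := {S | ∀ ⦃Z : E⦄ (p q : X ⟶ Z), (∀ ⦃Y : E⦄ (f : Y ⟶ X), S f → f ≫ p = f ≫ q) → p = q}
  top_mem' X Z p q h := by simpa using h (𝟙 X) trivial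
  pullback_stable' X Y S f hS Z p q h := by
    have : EpiFamily fun k : {k : Σ Y, Y ⟶ X // S k.2} => k.1.2 := fun Z p q h =>
      hS p q fun Y k hk => h ⟨⟨Y, k⟩, hk⟩
    exact this.pullback' f p q fun k D a b e => h a (by
      change S (a ≫ f)
      rw [e]
      exact S.downward_closed k.2 b)
  transitive' X S hS R h Z p q H := hS p q fun Y f hf => h hf _ _ fun D k hk => by
    rw [← Category.assoc, ← Category.assoc]
    exact H _ hk

lemma EpiFamily.ofArrows_mem {A : Type*} {X : E} {Y : A → E} {f : ∀ a, Y a ⟶ X}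
    (hf : EpiFamily f) : Sieve.ofArrows Y f ∈ epiTop E X := fun _ p q h =>
  hf p q fun a => h _ (Sieve.ofArrows_mk _ _ a)

/-- If parallel arrows out of X always agree, the empty family on X is epimorphic; being effective,
it produces an arrow from X to every object, so X is initial. -/
lemma not_nonEmpty_iff {X : E} : ¬ NonEmpty X ↔ ∀ ⦃Z : E⦄ (p q : X ⟶ Z), p = q := by
  refine ⟨fun h Z p q => eq_of_not_nonEmpty h p q, fun h h' => ?_⟩
  have hf : EpiFamily (fun a : PEmpty.{1} => (a.elim : X ⟶ X)) := fun _ p q _ => h p q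
  have ex : ∀ Z : E, Nonempty (X ⟶ Z) := fun Z => by
    obtain ⟨φ, -⟩ := hf.effective (Z := Z) (fun a => a.elim) (fun a => a.elim)
    exact ⟨φ⟩
  exact h'.false (IsInitial.ofUniqueHom (fun Z => (ex Z).some) fun Z m => h _ _)

/-- Strictness of the initial object: the empty sieve covers Y, and its pullback covers X. -/
lemma not_nonEmpty_of_hom {X Y : E} (f : X ⟶ Y) (h : ¬ NonEmpty Y) : ¬ NonEmpty X := by
  rw [not_nonEmpty_iff]
  have h1 : (⊥ : Sieve Y) ∈ epiTop E Y := fun Z p q _ => eq_of_not_nonEmpty h p q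
  have h2 := (epiTop E).pullback_stable f h1
  exact fun Z p q => h2 p q fun D k hk => hk.elim

lemma NonEmpty.of_hom {X Y : E} (h : NonEmpty X) (f : X ⟶ Y) : NonEmpty Y := by
  by_contra h'
  exact not_nonEmpty_of_hom f h' h

/-- Empty objects contribute nothing to an epimorphic family, so membership need only be tested on
non-empty domains. -/
lemma mem_epiTop_of_nonEmpty {X : E} {R S : Sieve X} (hR : R ∈ epiTop E X)
    (h : ∀ ⦃Y : E⦄ (f : Y ⟶ X), NonEmpty Y → R f → S f) : S ∈ epiTop E X := fun Z p q H =>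
  hR p q fun Y f hf => by
    by_cases hY : NonEmpty Y
    · exact H f (h f hY hf)
    · exact eq_of_not_nonEmpty hY _ _

lemma exists_nonEmpty_of_mem {X : E} (hX : NonEmpty X) {S : Sieve X} (hS : S ∈ epiTop E X) :
    ∃ (Y : E) (f : Y ⟶ X), NonEmpty Y ∧ S f := by
  by_contra! h
  refine (not_nonEmpty_iff.2 fun _ p q => hS p q fun Y f hf => ?_) hX
  by_cases hY : NonEmpty Y
  · exact absurd hf (h Y f hY)
  · exact eq_of_not_nonEmpty hY _ _

/-- The arrows from the members of a generating family form an epimorphic sieve. -/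
lemma generators_mem {A : Type*} {G : A → E} (hG : ∀ ⦃X Y : E⦄ (p q : X ⟶ Y),
    (∀ a (k : G a ⟶ X), k ≫ p = k ≫ q) → p = q) (X : E) :
    Sieve.ofArrows (fun p : Σ a, G a ⟶ X => G p.1) (fun p => p.2) ∈ epiTop E X := fun _ p q h =>
  hG p q fun a k => h _ (Sieve.ofArrows_mk _ (fun p : Σ a, G a ⟶ X => p.2) ⟨a, k⟩)

lemma eq_of_locally {X Z : E} {p q : X ⟶ Z} {S : Sieve X} (hS : S ∈ epiTop E X)
    (h : ∀ ⦃Y : E⦄ (f : Y ⟶ X), S f → NonEmpty Y → f ≫ p = f ≫ q) : p = q := hS p q fun Y f hf => by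
  by_cases hY : NonEmpty Y
  · exact h f hf hY
  · exact eq_of_not_nonEmpty hY _ _

namespace LocConst

/-- Distinct elements of `S` give distinct sections over a non-empty object. -/
lemma sec_injective {S : Type u} {C U : E} (hC : NonEmpty C) {x y : S} {u : C ⟶ U}
    (h : sec x u = sec y u) : x = y := by
  classical
  by_contra hxy
  refine (not_nonEmpty_iff.2 fun Z p q => ?_) hC
  have hc : IsColimit (Cofan.mk ((gammaStar E).obj S) fun x : S => (pt x : ⊤_ E ⟶ _)) :=
    coproductIsCoproduct (fun _ : S => ⊤_ E)
  let c := (isColimit_prod _ hc C).some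
  -- The map m is p on the summand of x and q on all the others. If x and y had the same section,
  -- then p = q for any parallel pair out of C, and C would be empty.
  let m := Cofan.IsColimit.desc c fun z => prod.snd ≫ if z = x then p else q
  have hm : ∀ z, sec z (𝟙 C) ≫ m = if z = x then p else q := fun z => by
    have e1 : sec z (𝟙 C) = prod.lift (terminal.from C) (𝟙 C) ≫ prod.map (pt z) (𝟙 C) := by
      simp [sec]
    have e2 : prod.map (pt z) (𝟙 C) ≫ m = _ :=
      Cofan.IsColimit.fac c (fun z => prod.snd ≫ if z = x then p else q) z
    rw [e1, Category.assoc, e2]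
    simp
  have e : sec x (𝟙 C) = sec y (𝟙 C) := by
    have := congrArg (fun k => k ≫ prod.fst) h
    apply Limits.prod.hom_ext
    · simpa [sec] using this
    · simp [sec]
  have := (hm x).symm.trans ((congrArg (fun r => r ≫ m) e).trans (hm y))
  rwa [if_pos rfl, if_neg (Ne.symm hxy)] at this

/-- The summand inclusions cover γ^* S × U; pulled back along c, they give a sieve on which c is one
of the sections. -/
lemma mem_sec {S : Type u} {C U : E} (c : C ⟶ (gammaStar E).obj S ⨯ U) :
    ∃ R ∈ epiTop E C, ∀ ⦃D : E⦄ (k : D ⟶ C), R k → ∃ x : S, k ≫ c = sec x (k ≫ c ≫ prod.snd) := by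
  refine ⟨_, (epiTop E).pullback_stable c (sec_epi (S := S) U).ofArrows_mem, fun D k hk => ?_⟩
  obtain ⟨Z, h, _, ⟨x⟩, e⟩ := hk
  refine ⟨x, ?_⟩
  have := congrArg (fun r => r ≫ prod.snd) e
  simp only [Category.assoc] at this
  rw [← e, ← this, sec_comp]
  simp [sec]

end LocConst

end EpiTop

/-! ### Stalks of locally constant objects -/

section Stalks

variable {E : Type (u + 1)} [Category.{u} E] [IsGrothendieckTopos.{u} E] {𝒰 𝒱 𝒲 : Cover E}

namespace LocConst

lemma elt_hom {X Y : LocConst 𝒰} (f : X ⟶ Y) {i : 𝒰.I} (x : X.S i) :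
    X.elt i x ≫ f.f = Y.elt i (f.ϑ i x) := (comm_iff _ _ _).1 (f.comm i) x

/-- `X.Rel u v x y`: the sections `x` and `y` agree along `u` and `v`. -/
def Rel (X : LocConst 𝒰) {i j : 𝒰.I} {C : E} (u : C ⟶ 𝒰.U i) (v : C ⟶ 𝒰.U j) (x : X.S i)
    (y : X.S j) : Prop := u ≫ X.elt i x = v ≫ X.elt j y

variable {X Y : LocConst 𝒰} {i j k : 𝒰.I} {C D : E}

lemma Rel.comp {u : C ⟶ 𝒰.U i} {v : C ⟶ 𝒰.U j} {x : X.S i} {y : X.S j} (h : X.Rel u v x y)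
    (a : D ⟶ C) : X.Rel (a ≫ u) (a ≫ v) x y := by
  change (a ≫ u) ≫ _ = (a ≫ v) ≫ _
  rw [Category.assoc, Category.assoc, h]

lemma Rel.symm {u : C ⟶ 𝒰.U i} {v : C ⟶ 𝒰.U j} {x : X.S i} {y : X.S j} (h : X.Rel u v x y) :
    X.Rel v u y x := Eq.symm h

lemma Rel.trans {u : C ⟶ 𝒰.U i} {v : C ⟶ 𝒰.U j} {w : C ⟶ 𝒰.U k} {x : X.S i} {y : X.S j}
    {z : X.S k} (h : X.Rel u v x y) (h' : X.Rel v w y z) : X.Rel u w x z := Eq.trans h h'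

lemma Rel.map {u : C ⟶ 𝒰.U i} {v : C ⟶ 𝒰.U j} {x : X.S i} {y : X.S j} (h : X.Rel u v x y)
    (f : X ⟶ Y) : Y.Rel u v (f.ϑ i x) (f.ϑ j y) := by
  change _ ≫ _ = _ ≫ _
  rw [← elt_hom, ← elt_hom, ← Category.assoc, h, Category.assoc]

/-- The trivialization turns sections of X into sections of a constant sum, and these are separated
over a non-empty object. -/
lemma eq_of_elt (hC : NonEmpty C) {u : C ⟶ 𝒰.U i} {x y : X.S i}
    (h : u ≫ X.elt i x = u ≫ X.elt i y) : x = y := by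
  refine sec_injective hC (u := u) ?_
  rw [← cancel_mono (X.θ i).hom, sec_θ, sec_θ, h]

lemma Rel.unique (hC : NonEmpty C) {u : C ⟶ 𝒰.U i} {v : C ⟶ 𝒰.U j} {x : X.S i} {y y' : X.S j}
    (h : X.Rel u v x y) (h' : X.Rel u v x y') : y = y' := eq_of_elt hC (h.symm.trans h')

/-- The arrows along which a given element of `X` is one of the sections `S j`. -/
def eltSieve (X : LocConst 𝒰) (c : C ⟶ X.X) (v : C ⟶ 𝒰.U j) : Sieve C where
  arrows D k := ∃ y, k ≫ c = (k ≫ v) ≫ X.elt j y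
  downward_closed := by
    rintro D D' k ⟨y, hy⟩ l
    exact ⟨y, by simp [hy]⟩

/-- Over U j the object X is the constant sum on S j, so a generalized element of X lying over U j
is locally one of the sections. -/
lemma eltSieve_mem (X : LocConst 𝒰) (c : C ⟶ X.X) (v : C ⟶ 𝒰.U j) :
    eltSieve X c v ∈ epiTop E C := by
  obtain ⟨R, hR, h⟩ := mem_sec (prod.lift c v ≫ (X.θ j).inv)
  refine (epiTop E).superset_covering (fun D k hk => ?_) hR
  obtain ⟨y, hy⟩ := h k hk
  refine ⟨y, ?_⟩
  have e1 : (X.θ j).inv ≫ prod.snd = prod.snd := by rw [Iso.inv_comp_eq, X.θ_snd]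
  have e2 := congrArg (fun r => r ≫ (X.θ j).hom ≫ prod.fst) hy
  simp only [Category.assoc, Iso.inv_hom_id_assoc, e1, lift_fst_simp, lift_snd_simp] at e2
  rw [e2, ← Category.assoc (sec _ _), sec_θ]
  simp

/-- The arrows along which `x` is one of the sections `S j`. -/
def relSieve (X : LocConst 𝒰) (u : C ⟶ 𝒰.U i) (v : C ⟶ 𝒰.U j) (x : X.S i) : Sieve C where
  arrows D k := ∃ y, X.Rel (k ≫ u) (k ≫ v) x y
  downward_closed := by
    rintro D D' k ⟨y, hy⟩ l
    exact ⟨y, by simpa using hy.comp l⟩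

lemma relSieve_mem (X : LocConst 𝒰) (u : C ⟶ 𝒰.U i) (v : C ⟶ 𝒰.U j) (x : X.S i) :
    relSieve X u v x ∈ epiTop E C := by
  refine (epiTop E).superset_covering (fun D k hk => ?_) (eltSieve_mem X (u ≫ X.elt i x) v)
  obtain ⟨y, hy⟩ := hk
  exact ⟨y, by simpa [Rel] using hy⟩

/-- This is the basic transport of stalk elements: after shrinking to a non-empty D, every x has a
partner in S j. By `Rel.unique` the partner is determined. -/
lemma exists_rel (X : LocConst 𝒰) (hC : NonEmpty C) (u : C ⟶ 𝒰.U i) (v : C ⟶ 𝒰.U j) (x : X.S i) :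
    ∃ (D : E) (k : D ⟶ C) (y : X.S j), NonEmpty D ∧ X.Rel (k ≫ u) (k ≫ v) x y := by
  obtain ⟨D, k, hD, y, hy⟩ := exists_nonEmpty_of_mem hC (relSieve_mem X u v x)
  exact ⟨D, k, y, hD, hy⟩

/-- The arrows to an object which factor through the sections of `X`. -/
lemma coverSieve_mem (𝒰 : Cover E) (C : E) :
    (Sieve.mk (fun D (_ : D ⟶ C) => ∃ i, Nonempty (D ⟶ 𝒰.U i))
      (by rintro D D' _ ⟨i, ⟨v⟩⟩ l; exact ⟨i, ⟨l ≫ v⟩⟩)) ∈ epiTop E C := by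
  refine (epiTop E).superset_covering (fun D k hk => ?_)
    ((epiTop E).pullback_stable (terminal.from C) 𝒰.epi.ofArrows_mem)
  obtain ⟨_, v, _, ⟨i⟩, -⟩ := hk
  exact ⟨i, ⟨v⟩⟩

/-- The members of the cover are locally available over X, and there every arrow to X is locally a
section. -/
lemma elt_epi (X : LocConst 𝒰) : EpiFamily fun p : (Σ i, X.S i) => X.elt p.1 p.2 := by
  intro Z p q h
  refine coverSieve_mem 𝒰 X.X p q fun D k ⟨i, ⟨v⟩⟩ => ?_
  refine eltSieve_mem X k v _ _ fun D' l ⟨y, hy⟩ => ?_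
  have := h ⟨i, y⟩
  rw [← Category.assoc, hy, Category.assoc, this, ← Category.assoc, ← hy, Category.assoc]

lemma hom_ext_ϑ {f g : X ⟶ Y} (h : ∀ i x, f.ϑ i x = g.ϑ i x) : f = g := by
  refine hom_ext' (X.elt_epi _ _ fun p => ?_) (by funext i x; exact h i x)
  rw [elt_hom, elt_hom, h]

/-- The members of a cover are non-empty, so distinct stalk elements give distinct sections and the
arrow of E determines the functions on stalks. -/
lemma hom_ext_f {f g : X ⟶ Y} (h : f.f = g.f) : f = g := by
  refine hom_ext_ϑ fun i x => eq_of_elt (𝒰.nonempty i) (u := 𝟙 _) ?_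
  rw [← elt_hom, ← elt_hom, h]

/-- A family of functions on stalks compatible with the relations comes from an arrow. -/
theorem exists_hom (ϑ : ∀ i, X.S i → Y.S i)
    (h : ∀ ⦃i j : 𝒰.I⦄ ⦃C : E⦄ (u : C ⟶ 𝒰.U i) (v : C ⟶ 𝒰.U j) (x : X.S i) (y : X.S j),
      NonEmpty C → X.Rel u v x y → Y.Rel u v (ϑ i x) (ϑ j y)) :
    ∃ f : X ⟶ Y, f.ϑ = ϑ := by
  obtain ⟨φ, hφ⟩ := X.elt_epi.effective (fun p => Y.elt p.1 (ϑ p.1 p.2)) (fun a b C u v e => by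
    by_cases hC : NonEmpty C
    · exact h u v a.2 b.2 hC e
    · exact eq_of_not_nonEmpty hC _ _)
  exact ⟨⟨φ, ϑ, fun i => (comm_iff _ _ _).2 fun x => hφ ⟨i, x⟩⟩, rfl⟩

/-- An arrow of locally constant objects given by its action on stalks. -/
def homMk (ϑ : ∀ i, X.S i → Y.S i)
    (h : ∀ ⦃i j : 𝒰.I⦄ ⦃C : E⦄ (u : C ⟶ 𝒰.U i) (v : C ⟶ 𝒰.U j) (x : X.S i) (y : X.S j),
      NonEmpty C → X.Rel u v x y → Y.Rel u v (ϑ i x) (ϑ j y)) : X ⟶ Y :=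
  (exists_hom ϑ h).choose

@[simp] lemma homMk_ϑ (ϑ : ∀ i, X.S i → Y.S i) (h) (i : 𝒰.I) (x : X.S i) :
    (homMk (X := X) (Y := Y) ϑ h).ϑ i x = ϑ i x := by
  have := (exists_hom ϑ h).choose_spec
  exact congrFun (congrFun this i) x

lemma Rel.of_locally {u : C ⟶ 𝒰.U i} {v : C ⟶ 𝒰.U j} {x : X.S i} {y : X.S j} {S : Sieve C}
    (hS : S ∈ epiTop E C) (h : ∀ ⦃D : E⦄ (k : D ⟶ C), NonEmpty D → S k →
      X.Rel (k ≫ u) (k ≫ v) x y) : X.Rel u v x y :=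
  eq_of_locally hS fun D k hk hD => by simpa [Rel] using h k hD hk

/-- A jointly injective family of arrows reflects the relations between stalks. -/
lemma Rel.of_injective {K : Type*} {Z : K → LocConst 𝒰} (f : ∀ k, X ⟶ Z k)
    (hf : ∀ i (x y : X.S i), (∀ k, (f k).ϑ i x = (f k).ϑ i y) → x = y)
    {u : C ⟶ 𝒰.U i} {v : C ⟶ 𝒰.U j} {x : X.S i} {y : X.S j}
    (h : ∀ k, (Z k).Rel u v ((f k).ϑ i x) ((f k).ϑ j y)) : X.Rel u v x y := by
  -- Locally x has some partner z in S j. Its images agree with those of y by uniqueness in each Z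
  -- k, so z = y by joint injectivity.
  refine Rel.of_locally (relSieve_mem X u v x) fun D a hD ⟨z, hz⟩ => ?_
  rwa [hf j y z fun k => ((h k).comp a).unique hD (hz.map (f k))]

/-- Arrows bijective on stalks are isomorphisms. -/
lemma isIso_of_bijective (f : X ⟶ Y) (hf : ∀ i, Function.Bijective (f.ϑ i)) : IsIso f := by
  let e : ∀ i, X.S i ≃ Y.S i := fun i => Equiv.ofBijective _ (hf i)
  have he : ∀ i x, e i x = f.ϑ i x := fun i x => rfl
  let g : Y ⟶ X := homMk (fun i => (e i).symm) fun i j C u v x y hC h =>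
    Rel.of_injective (fun _ : Unit => f) (fun i x y h => (hf i).1 (h ())) fun _ => by
      rw [← he, ← he, Equiv.apply_symm_apply, Equiv.apply_symm_apply]
      exact h
  refine ⟨g, hom_ext_ϑ fun i x => ?_, hom_ext_ϑ fun i x => ?_⟩
  · simp [g, ← he]
  · simp [g, ← he]

/-- The arrows along which `S i` and `S j` are identified. -/
def chartSieve (X : LocConst 𝒰) (u : C ⟶ 𝒰.U i) (v : C ⟶ 𝒰.U j) : Sieve C where
  arrows D k := ∃ s : X.S i → X.S j, ∀ x, X.Rel (k ≫ u) (k ≫ v) x (s x)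
  downward_closed := by
    rintro D D' k ⟨s, hs⟩ l
    exact ⟨s, fun x => by simpa using (hs x).comp l⟩

/-- The covering condition concerns U i × U j; pulling back along (u, v) gives it on every span. -/
lemma IsCovering.chartSieve_mem (hX : IsCovering X) (u : C ⟶ 𝒰.U i) (v : C ⟶ 𝒰.U j) :
    chartSieve X u v ∈ epiTop E C := by
  refine (epiTop E).superset_covering (fun D k hk => ?_)
    ((epiTop E).pullback_stable (prod.lift u v) (hX.epi i j).ofArrows_mem)
  obtain ⟨_, l, _, ⟨t⟩, e⟩ := hk
  have e1 := congrArg (fun r => r ≫ prod.fst) e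
  have e2 := congrArg (fun r => r ≫ prod.snd) e
  simp only [Category.assoc, lift_fst_simp, lift_snd_simp] at e1 e2
  refine ⟨t.s, fun x => ?_⟩
  rw [← e1, ← e2]
  exact Rel.comp ((triple_iff _ _ _ _).1 t.comm x) l

/-- Converse of `IsCovering.chartSieve_mem`. A total function suffices: over a non-empty object it
is automatically a bijection, because the relation is symmetric, single-valued and locally total in
both directions. -/
lemma isCovering_of_chartSieve (hX : ∀ (i j : 𝒰.I) ⦃C : E⦄ (u : C ⟶ 𝒰.U i) (v : C ⟶ 𝒰.U j),
    NonEmpty C → chartSieve X u v ∈ epiTop E C) : IsCovering X := by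
  intro i j hij Z p q h
  refine eq_of_locally (hX i j prod.fst prod.snd hij) fun D k ⟨s, hs⟩ hD => ?_
  have hbij : Function.Bijective s := by
    refine ⟨fun x y e => ?_, fun y => ?_⟩
    · have := hs y
      rw [← e] at this
      exact this.symm.unique hD (hs x).symm |>.symm
    · obtain ⟨D', l, x, hD', hx⟩ := X.exists_rel hD (k ≫ prod.snd) (k ≫ prod.fst) y
      exact ⟨x, ((hs x).comp l).unique hD' hx.symm⟩
  let t : ActionTriple X i j := ⟨D, k ≫ prod.fst, k ≫ prod.snd, Equiv.ofBijective s hbij, hD,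
    (triple_iff _ _ _ _).2 hs⟩
  have ht : prod.lift t.u t.v = k := by
    apply Limits.prod.hom_ext <;> simp [t]
  have := h t
  simpa only [ht] using this

/-- An object with an injective arrow to a covering projection is a covering projection. -/
lemma IsCovering.of_injective {K : Type*} [Finite K] {Z : K → LocConst 𝒰}
    (hZ : ∀ k, IsCovering (Z k)) (f : ∀ k, X ⟶ Z k)
    (hf : ∀ i (x y : X.S i), (∀ k, (f k).ϑ i x = (f k).ϑ i y) → x = y) : IsCovering X := by
  refine isCovering_of_chartSieve fun i j C u v _ => ?_
  -- Finiteness of K is used here: only finitely many covering sieves may be intersected.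
  have hS : Sieve.mk (fun D (a : D ⟶ C) => ∀ k, chartSieve (Z k) u v a)
      (fun h l k => (chartSieve (Z k) u v).downward_closed (h k) l) ∈ epiTop E C := by
    have := Fintype.ofFinite K
    have key : ∀ s : Finset K, Sieve.mk (fun D (a : D ⟶ C) => ∀ k ∈ s, chartSieve (Z k) u v a)
      (fun h l k hk => (chartSieve (Z k) u v).downward_closed (h k hk) l) ∈ epiTop E C := by
      classical
      intro s
      induction s using Finset.induction with
      | empty =>
        refine (epiTop E).superset_covering (S := ⊤) (fun D a _ => ?_) ((epiTop E).top_mem C)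
        exact fun k hk => absurd hk (Finset.notMem_empty k)
      | insert k s _ ih =>
        refine (epiTop E).superset_covering (fun D a ha k' hk' => ?_)
          ((epiTop E).intersection_covering ((hZ k).chartSieve_mem u v) ih)
        rcases Finset.mem_insert.1 hk' with rfl | h
        · exact ha.1
        · exact ha.2 k' h
    refine (epiTop E).superset_covering (fun D a ha => ?_) (key Finset.univ)
    exact fun k => ha k (Finset.mem_univ k)
  refine mem_epiTop_of_nonEmpty hS fun D a hD h => ?_
  choose s hs using h
  -- The transports in the Z k lift to X because x has a partner over some non-empty D', whose image
  -- in each Z k must be the transported one.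
  have : ∀ x : X.S i, ∃ y : X.S j, ∀ k, (f k).ϑ j y = s k ((f k).ϑ i x) := fun x => by
    obtain ⟨D', l, y, hD', hy⟩ := X.exists_rel hD (a ≫ u) (a ≫ v) x
    exact ⟨y, fun k => (hy.map (f k)).unique hD' ((hs k _).comp l)⟩
  choose t ht using this
  refine ⟨t, fun x => Rel.of_injective f hf fun k => ?_⟩
  rw [ht]
  exact hs k _

/-- An object with a surjective arrow from a covering projection is a covering projection. -/
lemma IsCovering.of_surjective (hX : IsCovering X) (f : X ⟶ Y)
    (hf : ∀ i, Function.Surjective (f.ϑ i)) : IsCovering Y := by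
  refine isCovering_of_chartSieve fun i j C u v _ => ?_
  refine (epiTop E).superset_covering (fun D k hk => ?_) (hX.chartSieve_mem u v)
  obtain ⟨s, hs⟩ := hk
  choose g hg using hf i
  exact ⟨fun y => f.ϑ j (s (g y)), fun y => by simpa only [hg] using (hs (g y)).map f⟩

end LocConst

end Stalks

/-! ### Constructions of locally constant objects -/

section Constructions

variable {E : Type (u + 1)} [Category.{u} E] [IsGrothendieckTopos.{u} E] {𝒰 𝒱 𝒲 : Cover E}

namespace LocConst

/-- A locally constant object given by its sections. -/
theorem exists_trivialization {U X : E} {S : Type u} (e : S → (U ⟶ X))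
    (hA : EpiFamily fun x => prod.lift (e x) (𝟙 U))
    (hB : ∀ ⦃C : E⦄ (u : C ⟶ U) (x y : S), NonEmpty C → u ≫ e x = u ≫ e y → x = y) :
    ∃ θ : (gammaStar E).obj S ⨯ U ≅ X ⨯ U, ∀ x, sec x (𝟙 U) ≫ θ.hom = prod.lift (e x) (𝟙 U) := by
  -- Two sections coincide over a non-empty D only if their indices are equal, so effectivity
  -- imposes no further compatibility. The same holds for ψ, by `hB`.
  obtain ⟨φ, hφ⟩ := (sec_epi U).effective (fun x : S => prod.lift (e x) (𝟙 U))
    (fun x y D k l h => by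
      have h1 := congrArg (fun r => r ≫ prod.snd) h
      simp only [sec, Category.assoc, lift_snd_simp, Category.comp_id] at h1
      subst h1
      by_cases hD : NonEmpty D
      · rw [sec_comp, sec_comp] at h
        rw [sec_injective hD h]
      · exact eq_of_not_nonEmpty hD _ _)
  obtain ⟨ψ, hψ⟩ := hA.effective (fun x : S => sec x (𝟙 U)) (fun x y D k l h => by
      have h1 := congrArg (fun r => r ≫ prod.snd) h
      have h2 := congrArg (fun r => r ≫ prod.fst) h
      simp only [Category.assoc, lift_snd_simp, lift_fst_simp, Category.comp_id] at h1 h2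
      subst h1
      by_cases hD : NonEmpty D
      · rw [hB k x y hD h2]
      · exact eq_of_not_nonEmpty hD _ _)
  refine ⟨⟨φ, ψ, sec_epi U _ _ fun x => ?_, hA _ _ fun x => ?_⟩, hφ⟩
  · rw [← Category.assoc, hφ, hψ, Category.comp_id]
  · rw [← Category.assoc, hψ, hφ, Category.comp_id]

/-- A locally constant object given by its sections. -/
theorem exists_of_elt (X : E) (S : 𝒰.I → Type u) (e : ∀ i, S i → (𝒰.U i ⟶ X))
    (hA : ∀ i, EpiFamily fun x => prod.lift (e i x) (𝟙 (𝒰.U i)))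
    (hB : ∀ i ⦃C : E⦄ (u : C ⟶ 𝒰.U i) (x y : S i), NonEmpty C → u ≫ e i x = u ≫ e i y → x = y) :
    ∃ θ : ∀ i, (gammaStar E).obj (S i) ⨯ 𝒰.U i ≅ X ⨯ 𝒰.U i,
      ∃ h : ∀ i, (θ i).hom ≫ prod.snd = prod.snd,
        ∀ i x, (LocConst.mk X S θ h).elt i x = e i x := by
  choose θ hθ using fun i => exists_trivialization (e i) (hA i) (hB i)
  refine ⟨θ, fun i => sec_epi _ _ _ fun x => ?_, fun i x => ?_⟩
  · rw [← Category.assoc, hθ]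
    simp [sec]
  · change sec x (𝟙 _) ≫ (θ i).hom ≫ prod.fst = _
    rw [← Category.assoc, hθ]
    simp

/-- The constant object on a set. -/
def constant (𝒰 : Cover E) (S : Type u) : LocConst 𝒰 :=
  ⟨(gammaStar E).obj S, fun _ => S, fun _ => Iso.refl _, fun _ => Category.id_comp _⟩

lemma constant_elt {S : Type u} (i : 𝒰.I) (x : S) :
    (constant 𝒰 S).elt i x = terminal.from _ ≫ pt x := by
  change sec x (𝟙 _) ≫ 𝟙 _ ≫ prod.fst = _
  simp [sec]

lemma rel_constant {S : Type u} {i j : 𝒰.I} {C : E} (u : C ⟶ 𝒰.U i) (v : C ⟶ 𝒰.U j) (x : S) :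
    (constant 𝒰 S).Rel u v x x := by
  change u ≫ (constant 𝒰 S).elt i x = v ≫ (constant 𝒰 S).elt j x
  have e : u ≫ terminal.from _ = v ≫ terminal.from _ := Subsingleton.elim _ _
  rw [constant_elt, constant_elt]
  exact (Category.assoc _ _ _).symm.trans
    ((congrArg (fun r => r ≫ pt x) e).trans (Category.assoc _ _ _))

lemma isCovering_constant (𝒰 : Cover E) (S : Type u) : IsCovering (constant 𝒰 S) :=
  isCovering_of_chartSieve fun i j C u v _ => by
    refine (epiTop E).superset_covering (fun D k _ => ?_) ((epiTop E).top_mem C)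
    exact ⟨fun x => x, fun x => rel_constant _ _ x⟩

/-- Squares which are pullbacks on stalks. -/
structure IsStalkPullback {P X Y Z : LocConst 𝒰} (p : P ⟶ X) (q : P ⟶ Y) (f : X ⟶ Z)
    (g : Y ⟶ Z) : Prop where
  w : p ≫ f = q ≫ g
  inj : ∀ i z z', p.ϑ i z = p.ϑ i z' → q.ϑ i z = q.ϑ i z' → z = z'
  surj : ∀ i x y, f.ϑ i x = g.ϑ i y → ∃ z, p.ϑ i z = x ∧ q.ϑ i z = y

variable {P P' X Y Z : LocConst 𝒰} {p : P ⟶ X} {q : P ⟶ Y} {f : X ⟶ Z} {g : Y ⟶ Z}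

lemma IsStalkPullback.exists_lift (h : IsStalkPullback p q f g) (a : P' ⟶ X) (b : P' ⟶ Y)
    (e : a ≫ f = b ≫ g) : ∃ l : P' ⟶ P, l ≫ p = a ∧ l ≫ q = b := by
  have ex : ∀ i x, ∃ z, p.ϑ i z = a.ϑ i x ∧ q.ϑ i z = b.ϑ i x := fun i x =>
    h.surj i _ _ (congrFun (congrFun (congrArg Hom.ϑ e) i) x)
  choose t h1 h2 using ex
  refine ⟨homMk t fun i j C u v x y hC r => ?_, hom_ext_ϑ fun i x => ?_, hom_ext_ϑ fun i x => ?_⟩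
  -- The two projections are jointly injective on stalks, so the relation on P can be checked in X
  -- and in Y.
  · refine Rel.of_injective (K := Bool) (Z := fun k => if k then X else Y)
      (fun k => match k with | true => p | false => q)
      (fun i x y hh => h.inj i x y (hh true) (hh false)) ?_
    rintro (_ | _)
    · change Y.Rel u v (q.ϑ i (t i x)) (q.ϑ j (t j y))
      rw [h2, h2]
      exact r.map b
    · change X.Rel u v (p.ϑ i (t i x)) (p.ϑ j (t j y))
      rw [h1, h1]
      exact r.map a
  · simp [h1]
  · simp [h2]

lemma IsStalkPullback.hom_ext (h : IsStalkPullback p q f g) {a b : P' ⟶ P} (h1 : a ≫ p = b ≫ p)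
    (h2 : a ≫ q = b ≫ q) : a = b := hom_ext_ϑ fun i x => h.inj i _ _
  (congrFun (congrFun (congrArg Hom.ϑ h1) i) x) (congrFun (congrFun (congrArg Hom.ϑ h2) i) x)

lemma IsStalkPullback.isCovering (h : IsStalkPullback p q f g) (hX : IsCovering X)
    (hY : IsCovering Y) : IsCovering P :=
  IsCovering.of_injective (K := Bool) (Z := fun k => if k then X else Y)
    (fun k => match k with | true => hX | false => hY)
    (fun k => match k with | true => p | false => q)
    (fun i x y hh => h.inj i x y (hh true) (hh false))

variable (f g) in
-- The pullback in E is trivialized by the fibre products of the stalks: a generalized element of it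
-- is locally a pair of sections, and over a non-empty object two sections agree in Z only if their
-- indices do.
theorem exists_isStalkPullback : ∃ (P : LocConst 𝒰) (p : P ⟶ X) (q : P ⟶ Y),
    IsStalkPullback p q f g ∧ IsPullback p.f q.f f.f g.f := by
  let S : 𝒰.I → Type u := fun i => {z : X.S i × Y.S i // f.ϑ i z.1 = g.ϑ i z.2}
  have he : ∀ i (z : S i), X.elt i z.1.1 ≫ f.f = Y.elt i z.1.2 ≫ g.f := fun i z => by
    rw [elt_hom, elt_hom, z.2]
  let e : ∀ i, S i → (𝒰.U i ⟶ Limits.pullback f.f g.f) := fun i z => pullback.lift _ _ (he i z)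
  obtain ⟨θ, h, hθ⟩ := exists_of_elt (𝒰 := 𝒰) (Limits.pullback f.f g.f) S e
    (fun i W a b H => by
      have key : ∀ {D : E} (k : D ⟶ _ ⨯ 𝒰.U i) (x : X.S i) (y : Y.S i),
          NonEmpty D → k ≫ prod.fst ≫ pullback.fst _ _ = (k ≫ prod.snd) ≫ X.elt i x →
          k ≫ prod.fst ≫ pullback.snd _ _ = (k ≫ prod.snd) ≫ Y.elt i y → k ≫ a = k ≫ b := by
        intro D k x y hD h1 h2
        have hxy : f.ϑ i x = g.ϑ i y := eq_of_elt hD (u := k ≫ prod.snd) (by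
          rw [← elt_hom, ← elt_hom, ← Category.assoc, ← h1, ← Category.assoc (k ≫ _) (Y.elt i y),
            ← h2, Category.assoc, Category.assoc, Category.assoc, Category.assoc,
            pullback.condition])
        have hk : k = (k ≫ prod.snd) ≫ prod.lift (e i ⟨(x, y), hxy⟩) (𝟙 _) := by
          apply Limits.prod.hom_ext
          · apply Limits.pullback.hom_ext
            · simp only [Category.assoc, lift_fst_simp, h1, e,
                pullback.lift_fst]
            · simp only [Category.assoc, lift_fst_simp, h2, e,
                pullback.lift_snd]
          · simp
        have e1 := (congrArg (fun r => r ≫ a) hk).trans (Category.assoc _ _ _)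
        have e2 := (congrArg (fun r => r ≫ b) hk).trans (Category.assoc _ _ _)
        exact e1.trans ((congrArg (fun r => (k ≫ prod.snd) ≫ r) (H ⟨(x, y), hxy⟩)).trans e2.symm)
      refine eq_of_locally (eltSieve_mem X (prod.fst ≫ pullback.fst f.f g.f) prod.snd)
        fun D k ⟨x, hx⟩ _ => ?_
      refine eq_of_locally (eltSieve_mem Y (k ≫ prod.fst ≫ pullback.snd f.f g.f) (k ≫ prod.snd))
        fun D' l ⟨y, hy⟩ hD' => ?_
      have := key (l ≫ k) x y hD' (by simp only [Category.assoc] at hx ⊢; rw [hx])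
        (by simpa using hy)
      simpa using this)
    (fun i C u z z' hC h => by
      apply Subtype.ext
      apply Prod.ext
      · refine eq_of_elt hC (u := u) ?_
        have := congrArg (fun r => r ≫ pullback.fst _ _) h
        simpa only [e, Category.assoc, pullback.lift_fst] using this
      · refine eq_of_elt hC (u := u) ?_
        have := congrArg (fun r => r ≫ pullback.snd _ _) h
        simpa only [e, Category.assoc, pullback.lift_snd] using this)
  let P : LocConst 𝒰 := ⟨_, S, θ, h⟩
  have hP : ∀ i (z : S i), P.elt i z = e i z := hθ
  let p : P ⟶ X := ⟨pullback.fst _ _, fun i z => z.1.1, fun i => (comm_iff (X := P) _ _ _).2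
    fun z => by rw [hP]; exact pullback.lift_fst _ _ _⟩
  let q : P ⟶ Y := ⟨pullback.snd _ _, fun i z => z.1.2, fun i => (comm_iff (X := P) _ _ _).2
    fun z => by rw [hP]; exact pullback.lift_snd _ _ _⟩
  refine ⟨P, p, q, ⟨hom_ext_ϑ fun i z => z.2, fun i z z' h1 h2 => Subtype.ext (Prod.ext h1 h2),
    fun i x y hxy => ⟨⟨(x, y), hxy⟩, rfl, rfl⟩⟩, IsPullback.of_hasPullback _ _⟩

/-- A square which is a pullback on stalks is a pullback in the topos. -/
lemma IsStalkPullback.isPullback_f (h : IsStalkPullback p q f g) :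
    IsPullback p.f q.f f.f g.f := by
  -- Two stalkwise pullbacks of the same cospan are isomorphic, and the constructed one is also a
  -- pullback in E.
  obtain ⟨P', p', q', h', hp⟩ := exists_isStalkPullback f g
  obtain ⟨l, h1, h2⟩ := h'.exists_lift p q h.w
  obtain ⟨m, h3, h4⟩ := h.exists_lift p' q' h'.w
  have e1 : m ≫ l = 𝟙 _ := h'.hom_ext (by rw [Category.assoc, h1, h3, Category.id_comp])
    (by rw [Category.assoc, h2, h4, Category.id_comp])
  have e2 : l ≫ m = 𝟙 _ := h.hom_ext (by rw [Category.assoc, h3, h1, Category.id_comp])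
    (by rw [Category.assoc, h4, h2, Category.id_comp])
  let i : P'.X ≅ P.X := ⟨m.f, l.f, congrArg Hom.f e1, congrArg Hom.f e2⟩
  exact hp.of_iso i (Iso.refl _) (Iso.refl _) (Iso.refl _)
    ((Category.comp_id _).trans (congrArg Hom.f h3).symm)
    ((Category.comp_id _).trans (congrArg Hom.f h4).symm)
    ((Category.comp_id _).trans (Category.id_comp _).symm)
    ((Category.comp_id _).trans (Category.id_comp _).symm)

lemma IsStalkPullback.pullback (h : IsStalkPullback p q f g) (k : 𝒲 ⟶ 𝒰) :
    IsStalkPullback ((LocConst.pullback k).map p) ((LocConst.pullback k).map q)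
      ((LocConst.pullback k).map f) ((LocConst.pullback k).map g) where
  w := by rw [← Functor.map_comp, h.w, Functor.map_comp]
  inj i := h.inj (k.α i)
  surj i := h.surj (k.α i)

/-- Decidable closed parts of an object are given by arrows to a two-point object. -/
lemma exists_char (X : LocConst 𝒰) (T : ∀ i, X.S i → Prop)
    (hT : ∀ ⦃i j : 𝒰.I⦄ ⦃C : E⦄ (u : C ⟶ 𝒰.U i) (v : C ⟶ 𝒰.U j) (x : X.S i) (y : X.S j),
      NonEmpty C → X.Rel u v x y → (T i x ↔ T j y)) :
    ∃ χ : X ⟶ constant 𝒰 (ULift.{u} Prop), ∀ i x, χ.ϑ i x = ⟨T i x⟩ := by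
  refine ⟨homMk (fun i x => ⟨T i x⟩) fun i j C u v x y hC r => ?_, fun i x => homMk_ϑ _ _ i x⟩
  rw [propext (hT u v x y hC r)]
  exact rel_constant _ _ _

/-- Closed families of elements define subobjects. -/
lemma exists_sub (X : LocConst 𝒰) (T : ∀ i, X.S i → Prop)
    (hT : ∀ ⦃i j : 𝒰.I⦄ ⦃C : E⦄ (u : C ⟶ 𝒰.U i) (v : C ⟶ 𝒰.U j) (x : X.S i) (y : X.S j),
      NonEmpty C → X.Rel u v x y → (T i x ↔ T j y)) :
    ∃ (Y : LocConst 𝒰) (m : Y ⟶ X), (∀ i, Function.Injective (m.ϑ i)) ∧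
      ∀ i x, T i x ↔ ∃ y, m.ϑ i y = x := by
  obtain ⟨χ, hχ⟩ := exists_char X T hT
  -- The subobject is the stalkwise pullback of the point `True` along the characteristic arrow.
  let t : constant 𝒰 PUnit.{u + 1} ⟶ constant 𝒰 (ULift.{u} Prop) :=
    homMk (fun i _ => ⟨True⟩) fun i j C u v x y _ _ => rel_constant _ _ _
  have ht : ∀ i x, t.ϑ i x = ⟨True⟩ := fun i x => homMk_ϑ _ _ i x
  obtain ⟨Y, m, n, h, -⟩ := exists_isStalkPullback χ t
  refine ⟨Y, m, fun i y y' hy => h.inj i y y' hy rfl, fun i x => ⟨fun hx => ?_, ?_⟩⟩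
  · obtain ⟨z, hz, -⟩ := h.surj i x PUnit.unit 
      ((hχ i x).trans ((congrArg ULift.up (eq_true hx)).trans (ht i _).symm))
    exact ⟨z, hz⟩
  · rintro ⟨y, rfl⟩
    have e : χ.ϑ i (m.ϑ i y) = t.ϑ i (n.ϑ i y) := congrFun (congrFun (congrArg Hom.ϑ h.w) i) y
    exact of_eq_true (congrArg ULift.down ((hχ _ _).symm.trans (e.trans (ht _ _))))

end LocConst

end Constructions

/-- One object is chosen for each code that occurs. The codes lie in a small type and determine
objects up to isomorphism. -/
lemma essentiallySmall_of_code {C : Type w} [Category.{v} C] (P : ObjectProperty C) {K : Type u}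
    (c : ∀ X, P X → K) (hc : ∀ X Y (hX : P X) (hY : P Y), c X hX = c Y hY → Nonempty (X ≅ Y)) :
    ObjectProperty.EssentiallySmall.{u} P := by
  let R := {k : K // ∃ X hX, c X hX = k}
  let f : R → C := fun k => k.2.choose
  have : Small.{u} (Subtype (ObjectProperty.ofObj f)) := by
    refine small_of_surjective (f := fun k : R => (⟨f k, ObjectProperty.ofObj_apply _ _⟩ :
      Subtype (ObjectProperty.ofObj f))) ?_
    rintro ⟨_, ⟨k⟩⟩
    exact ⟨k, rfl⟩
  refine ⟨ObjectProperty.ofObj f, this, fun X hX => ?_⟩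
  let k : R := ⟨c X hX, X, hX, rfl⟩
  exact ⟨f k, ObjectProperty.ofObj_apply _ _, hc _ _ _ _ k.2.choose_spec.choose_spec.symm⟩

/-! ### Orbits -/

section Orbits

variable {E : Type (u + 1)} [Category.{u} E] [IsGrothendieckTopos.{u} E] {𝒰 : Cover E}

variable (E) in
/-- The index set of a family of generators. -/
def GenIdx : Type u := (exists_generators (E := E)).choose

/-- A small family of generators. -/
def gen : GenIdx E → E := (exists_generators (E := E)).choose_spec.choose

lemma gen_mem (X : E) :
    Sieve.ofArrows (fun p : Σ a, gen a ⟶ X => gen p.1) (fun p => p.2) ∈ epiTop E X :=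
  generators_mem (exists_generators (E := E)).choose_spec.choose_spec X

lemma exists_gen {X : E} (hX : NonEmpty X) : ∃ (a : GenIdx E), NonEmpty (gen a) ∧
    Nonempty (gen a ⟶ X) := by
  obtain ⟨Y, f, hY, _, h, _, ⟨a, k⟩, rfl⟩ := exists_nonEmpty_of_mem hX (gen_mem X)
  exact ⟨a, hY.of_hom h, ⟨k⟩⟩

variable (𝒰) in
/-- The spans from generators to members of a cover. -/
def GenSpan : Type u := Σ (i j : 𝒰.I) (a : GenIdx E), (gen a ⟶ 𝒰.U i) × (gen a ⟶ 𝒰.U j)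

namespace LocConst

variable {X Y : LocConst 𝒰}

variable (X) in
/-- Two elements are related along a span. -/
inductive SpanRel : GenSpan 𝒰 → (Σ i, X.S i) → (Σ i, X.S i) → Prop
  | mk {i j : 𝒰.I} {a : GenIdx E} (ha : NonEmpty (gen a)) (u : gen a ⟶ 𝒰.U i)
      (v : gen a ⟶ 𝒰.U j) (x : X.S i) (y : X.S j) (h : X.Rel u v x y) :
      SpanRel ⟨i, j, a, u, v⟩ ⟨i, x⟩ ⟨j, y⟩

lemma SpanRel.unique {m : GenSpan 𝒰} {p q q' : Σ i, X.S i} (h : SpanRel X m p q)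
    (h' : SpanRel X m p q') : q = q' := by
  obtain ⟨ha, u, v, x, y, r⟩ := h
  cases h' with
  | mk _ _ _ _ y' r' => rw [r.unique ha r']

variable (X) in
/-- Two elements are related along a chain of spans. -/
inductive ChainRel : List (GenSpan 𝒰) → (Σ i, X.S i) → (Σ i, X.S i) → Prop
  | nil (p : Σ i, X.S i) : ChainRel [] p p
  | cons {m : GenSpan 𝒰} {l : List (GenSpan 𝒰)} {p q r : Σ i, X.S i} (h : SpanRel X m p q)
      (h' : ChainRel l q r) : ChainRel (m :: l) p r

/-- A chain of spans out of non-empty generators acts as a partial function. Chains starting at a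
base point therefore name the elements of its orbit, which bounds the size of the orbit. -/
lemma ChainRel.unique {l : List (GenSpan 𝒰)} {p q q' : Σ i, X.S i} (h : ChainRel X l p q)
    (h' : ChainRel X l p q') : q = q' := by
  induction h with
  | nil p => cases h'; rfl
  | cons h _ ih =>
    cases h' with
    | cons h1 h2 => exact ih (by rwa [h.unique h1])

variable (X) in
/-- Two elements lie in the same orbit. -/
def Conn (p q : Σ i, X.S i) : Prop := ∃ l, ChainRel X l p q

lemma Conn.refl (p : Σ i, X.S i) : Conn X p p := ⟨[], .nil p⟩

lemma ChainRel.append {l l' : List (GenSpan 𝒰)} {p q r : Σ i, X.S i} (h : ChainRel X l p q)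
    (h' : ChainRel X l' q r) : ChainRel X (l ++ l') p r := by
  induction h with
  | nil p => exact h'
  | cons h _ ih => exact .cons h (ih h')

lemma Conn.trans {p q r : Σ i, X.S i} (h : Conn X p q) (h' : Conn X q r) : Conn X p r :=
  ⟨_, h.choose_spec.append h'.choose_spec⟩

lemma Conn.symm {p q : Σ i, X.S i} (h : Conn X p q) : Conn X q p := by
  obtain ⟨l, hl⟩ := h
  induction hl with
  | nil p => exact .refl p
  | cons h _ ih =>
    obtain ⟨ha, u, v, x, y, r⟩ := h
    exact ih.trans ⟨_, .cons (.mk ha v u y x r.symm) (.nil _)⟩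

lemma Rel.conn {i j : 𝒰.I} {C : E} {u : C ⟶ 𝒰.U i} {v : C ⟶ 𝒰.U j} {x : X.S i} {y : X.S j}
    (hC : NonEmpty C) (h : X.Rel u v x y) : Conn X ⟨i, x⟩ ⟨j, y⟩ := by
  obtain ⟨a, ha, ⟨k⟩⟩ := exists_gen hC
  exact ⟨_, .cons (.mk ha _ _ _ _ (h.comp k)) (.nil _)⟩

/-- The image of an arrow is closed under the orbit relation. -/
lemma Conn.mem_image (f : Y ⟶ X) {p q : Σ i, X.S i} (h : Conn X p q)
    (hp : ∃ z, f.ϑ p.1 z = p.2) : ∃ z, f.ϑ q.1 z = q.2 := by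
  obtain ⟨l, hl⟩ := h
  induction hl with
  | nil p => exact hp
  | cons h _ ih =>
    refine ih ?_
    obtain ⟨ha, u, v, x, y, r⟩ := h
    obtain ⟨z, hz⟩ := hp
    -- The preimage z is transported in Y over a smaller non-empty D; uniqueness in X identifies the
    -- image of the result with the next element of the chain.
    obtain ⟨D, k, z', hD, hz'⟩ := Y.exists_rel ha u v z
    refine ⟨z', (hz'.map f).unique hD ?_⟩
    rw [hz]
    exact r.comp k

/-- The orbit of an element. -/
lemma exists_orbit (X : LocConst 𝒰) (p : Σ i, X.S i) :
    ∃ (O : LocConst 𝒰) (m : O ⟶ X), (∀ i, Function.Injective (m.ϑ i)) ∧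
      ∀ i x, Conn X p ⟨i, x⟩ ↔ ∃ y, m.ϑ i y = x :=
  exists_sub X (fun i x => Conn X p ⟨i, x⟩) fun _ _ _ _ _ _ _ hC r =>
    ⟨fun h => h.trans (r.conn hC), fun h => h.trans (r.symm.conn hC)⟩

/-- The pullback P of Y along the inclusion of the orbit injects into Y, hence is a covering
projection. It surjects onto the orbit, because the image of f contains p and is closed under the
orbit relation; quotients of covering projections are covering projections. -/
lemma isCovering_orbit {O : LocConst 𝒰} {p : Σ i, X.S i} {m : O ⟶ X}
    (hm : ∀ i, Function.Injective (m.ϑ i)) (hO : ∀ i x, Conn X p ⟨i, x⟩ ↔ ∃ y, m.ϑ i y = x)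
    (hY : IsCovering Y) (f : Y ⟶ X) (hp : ∃ z, f.ϑ p.1 z = p.2) : IsCovering O := by
  obtain ⟨P, a, b, h, -⟩ := exists_isStalkPullback m f
  have w : ∀ i z, m.ϑ i (a.ϑ i z) = f.ϑ i (b.ϑ i z) := fun i z =>
    congrFun (congrFun (congrArg Hom.ϑ h.w) i) z
  have hP : IsCovering P := IsCovering.of_injective (K := Unit) (fun _ => hY) (fun _ => b)
    fun i x y e => h.inj i x y (hm i (by rw [w, w, e ()])) (e ())
  refine hP.of_surjective a fun i y => ?_
  obtain ⟨z, hz⟩ := ((hO i _).2 ⟨y, rfl⟩).mem_image f hp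
  obtain ⟨c, hc, -⟩ := h.surj i y z hz.symm
  exact ⟨c, hc⟩

/-- An object is a sum of covering projections if and only if its elements come from covering
projections. -/
theorem isSumOfCoverings_iff : IsSumOfCoverings X ↔
    ∀ i (x : X.S i), ∃ (Y : LocConst 𝒰) (f : Y ⟶ X) (y : Y.S i), IsCovering Y ∧ f.ϑ i y = x := by
  refine ⟨?_, fun h => ?_⟩
  · rintro ⟨A, Y, ι, hY, ⟨hι⟩⟩ i x
    obtain ⟨Z, κ, e, ⟨hκ⟩, he⟩ := exists_sum Y
    let H := isColimitOfComponents κ hκ e he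
    let k : Z ≅ X := H.coconePointUniqueUpToIso hι
    obtain ⟨⟨a, y⟩, hy⟩ := (e i).surjective (k.inv.ϑ i x)
    refine ⟨Y a, κ a ≫ k.hom, y, hY a, ?_⟩
    rw [comp_ϑ, ← he, hy]
    exact congrFun (congrFun (congrArg Hom.ϑ k.inv_hom_id) i) x
  · let s : Setoid (Σ i, X.S i) := ⟨Conn X, Conn.refl, Conn.symm, Conn.trans⟩
    choose O m hm hO using fun q : Quotient s => exists_orbit X q.out
    have hmem : ∀ i x, ∃ y, (m ⟦⟨i, x⟩⟧).ϑ i y = x := fun i x => (hO _ i x).1 (by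
      have := Quotient.exact (Quotient.out_eq (⟦⟨i, x⟩⟧ : Quotient s))
      exact this)
    choose o ho using hmem
    have hq : ∀ q i y, q = (⟦⟨i, (m q).ϑ i y⟩⟧ : Quotient s) := fun q i y => by
      exact (Quotient.out_eq q).symm.trans (Quotient.sound ((hO q i _).2 ⟨y, rfl⟩))
    -- The value of a cofan on an element of an orbit depends only on its image x in X. This allows
    -- the arrow out of X to be defined through the chosen lift `o i x` in the orbit of x.
    have key : ∀ (t : Cofan O) q i y x, (m q).ϑ i y = x →
        (t.inj q).ϑ i y = (t.inj ⟦⟨i, x⟩⟧).ϑ i (o i x) := by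
      rintro t q i y x rfl
      have : ∀ q', q = q' → ∀ z : (O q').S i, (m q').ϑ i z = (m q).ϑ i y →
          (t.inj q).ϑ i y = (t.inj q').ϑ i z := by
        rintro _ rfl z hz
        rw [hm q i hz]
      exact this _ (hq q i y) _ (ho _ _)
    refine ⟨Quotient s, O, m, fun q => ?_, ⟨Cofan.IsColimit.mk _ (fun t => homMk (X := X)
      (fun i x => (t.inj ⟦⟨i, x⟩⟧).ϑ i (o i x)) ?_) ?_ ?_⟩⟩
    · obtain ⟨Y, f, y, hY, hy⟩ := h q.out.1 q.out.2
      exact isCovering_orbit (hm q) (hO q) hY f ⟨y, hy⟩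
    · intro i j C u v x y hC r
      obtain ⟨z, hz⟩ := (hO ⟦⟨i, x⟩⟧ j y).1 (((hO _ i x).2 ⟨_, ho i x⟩).trans (r.conn hC))
      rw [← key t _ j z y hz]
      refine Rel.map ?_ _
      refine Rel.of_injective (K := Unit) (fun _ => m _) (fun i x y e => hm _ i (e ⟨⟩)) fun _ => ?_
      rwa [ho, hz]
    · intro t q
      refine hom_ext_ϑ fun i y => ?_
      exact (homMk_ϑ (X := X) _ _ i ((m q).ϑ i y)).trans (key t q i y _ rfl).symm
    · intro t f hf
      refine hom_ext_ϑ fun i x => ?_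
      refine Eq.trans ?_ (homMk_ϑ (X := X) _ _ i x).symm
      refine Eq.trans ?_ (congrFun (congrFun (congrArg Hom.ϑ (hf ⟦⟨i, x⟩⟧)) i) (o i x))
      exact congrArg (f.ϑ i) (ho i x).symm

variable (𝒰) in
/-- The covering projections with small stalks. -/
def smallStalks : ObjectProperty (CovProj 𝒰) := fun X =>
  ∀ i, Nonempty (X.obj.S i ↪ List (GenSpan 𝒰))

/-- Every element of a covering projection comes from one with small stalks. -/
lemma exists_smallStalks (X : CovProj 𝒰) {i : 𝒰.I} (x : X.obj.S i) :
    ∃ (Y : CovProj 𝒰) (f : Y ⟶ X) (y : Y.obj.S i), smallStalks 𝒰 Y ∧ f.hom.ϑ i y = x := by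
  obtain ⟨O, m, hm, hO⟩ := exists_orbit X.obj ⟨i, x⟩
  have hc := isCovering_orbit hm hO X.property (𝟙 X.obj) ⟨x, rfl⟩
  obtain ⟨y, hy⟩ := (hO i x).1 (.refl _)
  have : ∀ j (z : O.S j), ∃ l, ChainRel X.obj l ⟨i, x⟩ ⟨j, m.ϑ j z⟩ := fun j z =>
    (hO j _).2 ⟨z, rfl⟩
  choose l hl using this
  refine ⟨⟨O, hc⟩, ObjectProperty.homMk m, y, fun j => ⟨⟨l j, fun z z' e => ?_⟩⟩, hy⟩
  have h1 := hl j z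
  rw [e] at h1
  have := h1.unique (hl j z')
  exact hm j (eq_of_heq (Sigma.mk.inj this).2)

/-- Once the stalks are embedded in lists of spans, an object is determined up to isomorphism by the
images of these embeddings and by the relations along generator spans. Both range over a small type.
-/
instance essentiallySmall_smallStalks :
    ObjectProperty.EssentiallySmall.{u} (smallStalks 𝒰) := by
  let c : ∀ X : CovProj 𝒰, smallStalks 𝒰 X → (∀ _ : 𝒰.I, Set (List (GenSpan 𝒰))) ×
      Set (GenSpan 𝒰 × List (GenSpan 𝒰) × List (GenSpan 𝒰)) := fun X hX =>
    (fun i => Set.range (hX i).some, fun t => ∃ (x : X.obj.S t.1.1) (y : X.obj.S t.1.2.1),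
      X.obj.Rel t.1.2.2.2.1 t.1.2.2.2.2 x y ∧ (hX _).some x = t.2.1 ∧ (hX _).some y = t.2.2)
  have key : ∀ X Y hX hY, c X hX = c Y hY → ∃ f : X.obj ⟶ Y.obj,
      ∀ i x, (hY i).some (f.ϑ i x) = (hX i).some x := by
    intro X Y hX hY h
    have h1 : ∀ i x, ∃ y, (hY i).some y = (hX i).some x := fun i x => by
      have e : Set.range (hX i).some = Set.range (hY i).some := congrFun (congrArg Prod.fst h) i
      have : (hX i).some x ∈ Set.range (hY i).some := by
        rw [← e]
        exact ⟨x, rfl⟩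
      exact this
    choose t ht using h1
    refine ⟨homMk t fun i j C u v x y hC r => ?_, fun i x => by rw [homMk_ϑ, ht]⟩
    -- Relations along arbitrary spans are detected on generators, which the code records.
    refine Rel.of_locally (gen_mem C) fun D k hD hk => ?_
    obtain ⟨_, l, _, ⟨a, k⟩, rfl⟩ := hk
    have h2 : ((⟨i, j, a, k ≫ u, k ≫ v⟩ : GenSpan 𝒰), (hX i).some x, (hX j).some y) ∈
        (c X hX).2 := ⟨x, y, r.comp k, rfl, rfl⟩
    rw [h] at h2
    obtain ⟨x', y', r', hx, hy⟩ := h2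
    have ex : x' = t i x := (hY i).some.injective (hx.trans (ht i x).symm)
    have ey : y' = t j y := (hY j).some.injective (hy.trans (ht j y).symm)
    subst ex ey
    simpa using r'.comp l
  refine essentiallySmall_of_code _ c fun X Y hX hY h => ?_
  obtain ⟨f, hf⟩ := key X Y hX hY h
  obtain ⟨g, hg⟩ := key Y X hY hX h.symm
  refine ⟨ObjectProperty.isoMk _ ⟨f, g, hom_ext_ϑ fun i x => (hX i).some.injective ?_,
    hom_ext_ϑ fun i x => (hY i).some.injective ?_⟩⟩
  · rw [comp_ϑ, hg, hf, id_ϑ]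
  · rw [comp_ϑ, hf, hg, id_ϑ]

end LocConst

end Orbits

/-- Sets are the sheaves on the one-point site with the trivial topology. This lets stalk functors
be treated as geometric morphisms out of `Type u`. -/
instance isGrothendieckTopos_type : IsGrothendieckTopos.{u} (Type u) := by
  refine ⟨Discrete PUnit.{u + 1}, inferInstance, ⊥, ⟨?_⟩⟩
  exact (Functor.equiv.{u} (C := Type u)).symm.trans
    ((Discrete.opposite PUnit.{u + 1}).symm.congrLeft.trans (sheafBotEquivalence _).symm)

/-- The characteristic function of the union of the images and the constant function `True` agree on
every member of the family. -/
lemma EpiFamily.type_surjective {A : Type*} {X : Type u} {Y : A → Type u} {f : ∀ a, Y a ⟶ X}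
    (hf : EpiFamily f) (x : X) : ∃ a y, f a y = x := by
  have := hf (Z := ULift.{u} Prop) (↾fun x => ULift.up (∃ a y, f a y = x))
    (↾fun _ => ULift.up True) fun a => by
    ext y
    have h : ∃ b z, f b z = f a y := ⟨a, y, rfl⟩
    exact iff_of_true h trivial
  have := congrArg ULift.down (ConcreteCategory.congr_hom this x)
  exact of_eq_true this

/-! ### The site of covering projections trivialized by a cover -/

section Site

variable {E : Type (u + 1)} [Category.{u} E] [IsGrothendieckTopos.{u} E] {𝒰 𝒱 𝒲 : Cover E}

namespace LocConst

lemma ϑ_congr {X Y : LocConst 𝒰} {f g : X ⟶ Y} (h : f = g) (i : 𝒰.I) (x : X.S i) :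
    f.ϑ i x = g.ϑ i x := by rw [h]

variable (𝒰) in
/-- The constant covering projection on a set. -/
def constCov (S : Type u) : CovProj 𝒰 := ⟨constant 𝒰 S, isCovering_constant 𝒰 S⟩

lemma exists_covPullback {X Y : CovProj 𝒰} {Z : LocConst 𝒰} (f : X.obj ⟶ Z) (g : Y.obj ⟶ Z) :
    ∃ (P : CovProj 𝒰) (p : P ⟶ X) (q : P ⟶ Y), IsStalkPullback p.hom q.hom f g := by
  obtain ⟨P, p, q, h, -⟩ := exists_isStalkPullback f g
  exact ⟨⟨P, h.isCovering X.property Y.property⟩, ObjectProperty.homMk p, ObjectProperty.homMk q, h⟩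

lemma IsStalkPullback.isPullback_cov {P X Y Z : CovProj 𝒰} {p : P ⟶ X} {q : P ⟶ Y} {f : X ⟶ Z}
    {g : Y ⟶ Z} (h : IsStalkPullback p.hom q.hom f.hom g.hom) : IsPullback p q f g := by
  have w : p ≫ f = q ≫ g := ObjectProperty.hom_ext _ h.w
  have ex : ∀ s : PullbackCone f g, ∃ l : s.pt ⟶ P, l ≫ p = s.fst ∧ l ≫ q = s.snd := fun s => by
    obtain ⟨l, h1, h2⟩ := h.exists_lift s.fst.hom s.snd.hom
      (congrArg (fun r => r.hom) s.condition)
    exact ⟨ObjectProperty.homMk l, ObjectProperty.hom_ext _ h1, ObjectProperty.hom_ext _ h2⟩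
  choose l h1 h2 using ex
  exact ⟨⟨w⟩, ⟨PullbackCone.IsLimit.mk w l h1 h2 fun s m e1 e2 => ObjectProperty.hom_ext _
    (h.hom_ext (congrArg (fun r => r.hom) (e1.trans (h1 s).symm))
      (congrArg (fun r => r.hom) (e2.trans (h2 s).symm)))⟩⟩

variable (𝒰) in
/-- The constant object on a point is terminal. -/
def isTerminalConst : IsTerminal (constCov 𝒰 PUnit.{u + 1}) :=
  IsTerminal.ofUniqueHom (fun _ => ObjectProperty.homMk (P := IsCovering) (Y := constCov 𝒰 PUnit)
    (homMk (Y := constant 𝒰 PUnit.{u + 1}) (fun _ _ => PUnit.unit)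
      fun _ _ _ _ _ _ _ _ _ => rel_constant _ _ _))
    fun _ _ => ObjectProperty.hom_ext _ (hom_ext_ϑ fun _ _ => rfl)

instance : HasFiniteLimits (CovProj 𝒰) := by
  have : HasTerminal (CovProj 𝒰) := (isTerminalConst 𝒰).hasTerminal
  have : ∀ {X Y Z : CovProj 𝒰} {f : X ⟶ Z} {g : Y ⟶ Z}, HasLimit (cospan f g) := by
    intro X Y Z f g
    obtain ⟨P, p, q, h⟩ := exists_covPullback f.hom g.hom
    exact h.isPullback_cov.hasPullback
  have : HasPullbacks (CovProj 𝒰) := hasPullbacks_of_hasLimit_cospan _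
  exact hasFiniteLimits_of_hasTerminal_and_pullbacks

/-- Recognition of the functors on covering projections which preserve finite limits. -/
theorem preservesFiniteLimits_of_stalkPullback {T : Type w} [Category.{v} T] (F : CovProj 𝒰 ⥤ T)
    (h1 : Nonempty (IsTerminal (F.obj (constCov 𝒰 PUnit.{u + 1}))))
    (h2 : ∀ {P X Y Z : CovProj 𝒰} (p : P ⟶ X) (q : P ⟶ Y) (f : X ⟶ Z) (g : Y ⟶ Z),
      IsStalkPullback p.hom q.hom f.hom g.hom →
        IsPullback (F.map p) (F.map q) (F.map f) (F.map g)) : PreservesFiniteLimits F := by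
  have t1 : PreservesLimit (Functor.empty.{0} (CovProj 𝒰)) F :=
    preservesLimit_of_preserves_limit_cone (isTerminalConst 𝒰)
      ((isLimitMapConeEmptyConeEquiv F _).symm h1.some)
  have : PreservesLimitsOfShape (Discrete PEmpty.{1}) F := preservesLimitsOfShape_pempty_of_preservesTerminal F
  have t2 : ∀ {X Y Z : CovProj 𝒰} (f : X ⟶ Z) (g : Y ⟶ Z), PreservesLimit (cospan f g) F := by
    intro X Y Z f g
    obtain ⟨P, p, q, h⟩ := exists_covPullback f.hom g.hom
    exact preservesLimit_of_preserves_limit_cone h.isPullback_cov.isLimit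
      ((isLimitMapConePullbackConeEquiv F h.isPullback_cov.w).symm (h2 p q f g h).isLimit)
  have : PreservesLimitsOfShape WalkingCospan F :=
    ⟨fun {K} => preservesLimit_of_iso_diagram F (diagramIsoCospan K).symm⟩
  exact preservesFiniteLimits_of_preservesTerminal_and_pullbacks F

variable (𝒰) in
/-- The topology of the sieves which are jointly surjective on stalks. -/
def stalkTop : GrothendieckTopology (CovProj 𝒰) where
  sieves X := {S | ∀ i (x : X.obj.S i), ∃ (Y : CovProj 𝒰) (f : Y ⟶ X) (y : Y.obj.S i),
    S f ∧ f.hom.ϑ i y = x}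
  top_mem' X i x := ⟨X, 𝟙 X, x, trivial, rfl⟩
  pullback_stable' X Y S g hS i y := by
    obtain ⟨Z, f, z, hf, hz⟩ := hS i (g.hom.ϑ i y)
    obtain ⟨P, p, q, h⟩ := exists_covPullback f.hom g.hom
    obtain ⟨t, -, ht⟩ := h.surj i z y hz
    refine ⟨P, q, t, ?_, ht⟩
    have e : q ≫ g = p ≫ f := ObjectProperty.hom_ext _ h.w.symm
    change S (q ≫ g)
    rw [e]
    exact S.downward_closed hf p
  transitive' X S hS R hR i x := by
    obtain ⟨Y, f, y, hf, rfl⟩ := hS i x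
    obtain ⟨Z, g, z, hg, rfl⟩ := hR hf i y
    exact ⟨Z, g ≫ f, z, hg, rfl⟩

instance : IsDenselySmall (stalkTop 𝒰) where
  exists_dense := by
    -- The arrows factoring through objects with small stalks reach every element of X, since every
    -- element lies in an orbit.
    refine ⟨smallStalks 𝒰, inferInstance, fun X => ?_⟩
    refine ⟨⟨fun Y f => ∃ (Z : CovProj 𝒰) (g : Y ⟶ Z) (h : Z ⟶ X), smallStalks 𝒰 Z ∧ g ≫ h = f,
      ?_⟩, fun i x => ?_, fun Y f h => h⟩
    · rintro Y Y' f ⟨Z, g, h, hZ, rfl⟩ k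
      exact ⟨Z, k ≫ g, h, hZ, Category.assoc _ _ _⟩
    · obtain ⟨Y, f, y, hY, hy⟩ := exists_smallStalks X x
      exact ⟨Y, f, y, ⟨Y, 𝟙 Y, f, hY, Category.id_comp _⟩, hy⟩

instance : HasSheafify (stalkTop 𝒰) (Type u) := hasSheafify_of_densely_small _

instance : IsGrothendieckTopos.{u} (Sheaf (stalkTop 𝒰) (Type u)) := isGrothendieckTopos_sheaf _

/-- The union of the images on stalks is closed under `Rel`, so it has a characteristic arrow to a
constant covering projection; epimorphicity forces this arrow to be constantly true. -/
lemma surjective_of_epiFamily {A : Type*} {X : GCat 𝒰} {Y : A → GCat 𝒰} {f : ∀ a, Y a ⟶ X}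
    (hf : EpiFamily f) {i : 𝒰.I} (x : X.obj.S i) : ∃ a y, (f a).hom.ϑ i y = x := by
  obtain ⟨χ, hχ⟩ := exists_char X.obj (fun i x => ∃ a y, (f a).hom.ϑ i y = x) (by
    have key : ∀ ⦃i j : 𝒰.I⦄ ⦃C : E⦄ (u : C ⟶ 𝒰.U i) (v : C ⟶ 𝒰.U j) (x : X.obj.S i)
        (y : X.obj.S j), NonEmpty C → X.obj.Rel u v x y → (∃ a y, (f a).hom.ϑ i y = x) →
          ∃ a x, (f a).hom.ϑ j x = y := by
      rintro i j C u v _ y hC r ⟨a, x, rfl⟩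
      obtain ⟨D, k, z, hD, hz⟩ := (Y a).obj.exists_rel hC u v x
      exact ⟨a, z, (hz.map (f a).hom).unique hD (r.comp k)⟩
    exact fun i j C u v x y hC r => ⟨key u v x y hC r, key v u y x hC r.symm⟩)
  let τ : X.obj ⟶ constant 𝒰 (ULift.{u} Prop) := homMk (Y := constant 𝒰 (ULift.{u} Prop))
    (fun _ _ => ⟨True⟩) fun _ _ _ _ _ _ _ _ _ => rel_constant _ _ _
  have hτ : ∀ i x, τ.ϑ i x = ⟨True⟩ := fun i x =>
    homMk_ϑ (Y := constant 𝒰 (ULift.{u} Prop)) _ _ i x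
  let K : GCat 𝒰 := ⟨constant 𝒰 (ULift.{u} Prop), (isCovering_constant 𝒰 _).isSum⟩
  have h := hf (Z := K) (ObjectProperty.homMk χ) (ObjectProperty.homMk τ) fun a =>
    ObjectProperty.hom_ext _ (hom_ext_ϑ fun i y => (hχ i _).trans
      ((congrArg ULift.up (eq_true ⟨a, y, rfl⟩)).trans (hτ i _).symm))
  have e : χ.ϑ i x = τ.ϑ i x := ϑ_congr (congrArg (fun r => r.hom) h) i x
  exact of_eq_true (congrArg ULift.down ((hχ i x).symm.trans (e.trans (hτ i x))))

lemma epiFamily_of_surjective {A : Type*} {X : GCat 𝒰} {Y : A → GCat 𝒰} {f : ∀ a, Y a ⟶ X}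
    (hf : ∀ i (x : X.obj.S i), ∃ a y, (f a).hom.ϑ i y = x) : EpiFamily f := fun Z p q h =>
  ObjectProperty.hom_ext _ (hom_ext_ϑ fun i x => by
    obtain ⟨a, y, rfl⟩ := hf i x
    exact ϑ_congr (congrArg (fun r => r.hom) (h a)) i y)

/-- Arrows can be glued from arrows on covering projections. -/
theorem exists_glue {X Z : LocConst 𝒰} (S : ∀ Y : CovProj 𝒰, (Y.obj ⟶ X) → Prop)
    (φ : ∀ (Y : CovProj 𝒰) (f : Y.obj ⟶ X), S Y f → (Y.obj ⟶ Z))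
    (hS : ∀ i (x : X.S i), ∃ (Y : CovProj 𝒰) (f : Y.obj ⟶ X) (y : Y.obj.S i), S Y f ∧ f.ϑ i y = x)
    (hφ : ∀ (Y Y' : CovProj 𝒰) (f : Y.obj ⟶ X) (f' : Y'.obj ⟶ X) (hf : S Y f) (hf' : S Y' f')
      (W : CovProj 𝒰) (a : W ⟶ Y) (b : W ⟶ Y'), a.hom ≫ f = b.hom ≫ f' →
        a.hom ≫ φ Y f hf = b.hom ≫ φ Y' f' hf') :
    ∃ h : X ⟶ Z, ∀ Y f hf, f ≫ h = φ Y f hf := by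
  choose Y f y hf hy using hS
  -- A stalk element is sent to the value at a chosen lift. Independence of the lift (`ht`) follows
  -- by comparing two lifts on a pullback of covering projections, which is again a covering
  -- projection.
  let t : ∀ i, X.S i → Z.S i := fun i x => (φ _ (f i x) (hf i x)).ϑ i (y i x)
  have ht : ∀ i x Y' (f' : Y'.obj ⟶ X) hf' y', f'.ϑ i y' = x →
      (φ Y' f' hf').ϑ i y' = t i x := by
    intro i x Y' f' hf' y' e
    obtain ⟨P, p, q, h⟩ := exists_covPullback f' (f i x)
    obtain ⟨z, rfl, h2⟩ := h.surj i y' (y i x) (e.trans (hy i x).symm)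
    dsimp only [t]
    rw [← h2]
    exact ϑ_congr (hφ _ _ _ _ hf' (hf i x) P p q h.w) i z
  refine ⟨homMk t fun i j C u v x x' hC r => ?_, fun Y f hf => hom_ext_ϑ fun i y => ?_⟩
  · refine Rel.of_locally (relSieve_mem (Y i x).obj u v (y i x)) fun D k hD ⟨y', hy'⟩ => ?_
    rw [← ht j x' (Y i x) (f i x) (hf i x) y']
    · exact hy'.map _
    · refine (hy'.map (f i x)).unique hD ?_
      rw [hy]
      exact r.comp k
  · rw [comp_ϑ, homMk_ϑ]
    exact (ht i _ Y f hf y rfl).symm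

variable (𝒰) in
-- Every element of an object of G_𝒰 comes from a covering projection, so arrows are determined by,
-- and can be glued from, their restrictions to covering projections.
theorem homDense_incl : HomDense (incl 𝒰) where
  faithful Y Z f g h := ObjectProperty.hom_ext _ (hom_ext_ϑ fun i x => by
    obtain ⟨W, k, y, hW, rfl⟩ := isSumOfCoverings_iff.1 Y.property i x
    exact ϑ_congr (congrArg (fun r => r.hom)
      (h ⟨W, hW⟩ (ObjectProperty.homMk (Y := Y) k))) i y)
  full Y Z φ hφ := by
    obtain ⟨h, hh⟩ := exists_glue (X := Y.obj) (Z := Z.obj) (fun _ _ => True)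
      (fun X k _ => (φ X (ObjectProperty.homMk (Y := Y) k)).hom) (fun i x => by
        obtain ⟨W, k, y, hW, e⟩ := isSumOfCoverings_iff.1 Y.property i x
        exact ⟨⟨W, hW⟩, k, y, trivial, e⟩)
      (fun X X' k k' _ _ W a b e => by
        have e1 := hφ a (ObjectProperty.homMk (Y := Y) k)
        have e2 := hφ b (ObjectProperty.homMk (Y := Y) k')
        have e3 : (incl 𝒰).map a ≫ ObjectProperty.homMk (Y := Y) k =
          (incl 𝒰).map b ≫ ObjectProperty.homMk (Y := Y) k' := ObjectProperty.hom_ext _ e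
        rw [e3] at e1
        exact congrArg (fun r => r.hom) (e1.symm.trans e2))
    exact ⟨ObjectProperty.homMk h, fun X k => ObjectProperty.hom_ext _ (hh X k.hom trivial).symm⟩

lemma isSheaf_incl (Z : GCat 𝒰) : Presieve.IsSheaf (stalkTop 𝒰) ((incl 𝒰).op ⋙ yoneda.obj Z) := by
  intro X S hS x hx
  obtain ⟨h, hh⟩ := exists_glue (X := X.obj) (Z := Z.obj)
    (fun Y f => S (ObjectProperty.homMk (Y := X) f))
    (fun Y f hf => (x (ObjectProperty.homMk (Y := X) f) hf).hom)
    (fun i x => by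
      obtain ⟨Y, f, y, hf, e⟩ := hS i x
      exact ⟨Y, f.hom, y, hf, e⟩)
    (fun Y Y' f f' hf hf' W a b e =>
      congrArg (fun r => r.hom) (hx a b hf hf' (ObjectProperty.hom_ext _ e)))
  refine ⟨ObjectProperty.homMk h, fun Y f hf => ObjectProperty.hom_ext _ (hh Y f.hom hf),
    fun g hg => ObjectProperty.hom_ext _ (hom_ext_ϑ fun i z => ?_)⟩
  obtain ⟨Y, f, y, hf, rfl⟩ := hS i z
  have e1 := ϑ_congr (congrArg (fun r => r.hom) (hg f hf)) i y
  have e2 := ϑ_congr (hh Y f.hom hf) i y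
  exact e1.trans e2.symm

end LocConst

end Site

/-- Arrows between sheaves associated with representable presheaves are locally represented. -/
theorem exists_locally_ayoneda {C : Type w} [Category.{u} C] {J : GrothendieckTopology C}
    [HasSheafify J (Type u)] {X Y : C} (κ : (ayoneda J).obj Y ⟶ (ayoneda J).obj X) :
    ∃ S ∈ J Y, ∀ ⦃Z : C⦄ (f : Z ⟶ Y), S f →
      ∃ t : Z ⟶ X, (ayoneda J).map f ≫ κ = (ayoneda J).map t := by
  let A := (ayoneda J).obj X
  let e : A.obj.obj (op X) := ayonedaEquiv J X A (𝟙 _)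
  have he : ∀ {Z : C} (t : Z ⟶ X), ayonedaEquiv J Z A ((ayoneda J).map t) = A.obj.map t.op e := by
    intro Z t
    rw [← ayonedaEquiv_map, Category.comp_id]
  -- G consists of the sections that are restrictions of the universal one e. Since e lies in the
  -- sheafification M of G, the identity of A factors through M, and every section of A is locally
  -- in G.
  let G : Subfunctor A.obj :=
    { obj := fun c => {x | ∃ t : c.unop ⟶ X, A.obj.map t.op e = x}
      map := by
        rintro U V i x ⟨t, rfl⟩
        exact ⟨i.unop ≫ t, ConcreteCategory.congr_hom (A.obj.map_comp t.op i) e⟩ }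
  have hX := (isSheaf_iff_isSheaf_of_type J A.obj).1 A.property
  have hs : Presieve.IsSheaf J (G.sheafify J).toFunctor := Subfunctor.sheafify_isSheaf G hX
  let M : Sheaf J (Type u) := ⟨(G.sheafify J).toFunctor, (isSheaf_iff_isSheaf_of_type _ _).2 hs⟩
  let m : M ⟶ A := ⟨(G.sheafify J).ι⟩
  have heG : e ∈ (G.sheafify J).obj (op X) :=
    G.le_sheafify J _ ⟨𝟙 X, ConcreteCategory.congr_hom (A.obj.map_id (op X)) e⟩
  let r : A ⟶ M := (ayonedaEquiv J X M).symm ⟨e, heG⟩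
  have hr' : ayonedaEquiv J X M r = ⟨e, heG⟩ := Equiv.apply_symm_apply _ _
  have hr : r ≫ m = 𝟙 A := (ayonedaEquiv J X A).injective
    ((ayonedaEquiv_comp J r m).trans (congrArg (m.hom.app (op X)) hr'))
  have hs : ayonedaEquiv J Y A κ ∈ (G.sheafify J).obj (op Y) := by
    have h2 := congrArg (fun t => t.hom.app (op Y)) hr
    have h3 := ConcreteCategory.congr_hom h2 (ayonedaEquiv J Y A κ)
    have h4 : m.hom.app (op Y) (r.hom.app (op Y) (ayonedaEquiv J Y A κ)) = _ := h3
    have h5 := (r.hom.app (op Y) (ayonedaEquiv J Y A κ)).2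
    have h6 : (r.hom.app (op Y) (ayonedaEquiv J Y A κ)).1 = ayonedaEquiv J Y A κ := h4
    rwa [h6] at h5
  refine ⟨_, hs, fun Z f ⟨t, ht⟩ => ⟨t, (ayonedaEquiv J Z A).injective ?_⟩⟩
  rw [he, ayonedaEquiv_map]
  exact ht.symm

/-! ### Realizing sheaves on the covering projections as locally constant objects -/

section GTopos

variable {E : Type (u + 1)} [Category.{u} E] [IsGrothendieckTopos.{u} E] {𝒰 𝒱 𝒲 : Cover E}

/-- A topos is cartesian closed. The adjoint is needed so that density applies to functors followed
by multiplication with U i. -/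
lemma prodRight_isLeftAdjoint (U : E) : (prod.functor.flip.obj U).IsLeftAdjoint := by
  obtain ⟨C, _, J, ⟨e⟩⟩ := IsGrothendieckTopos.exists_site (E := E)
  let : CartesianMonoidalCategory E := CartesianMonoidalCategory.ofHasFiniteProducts
  let : MonoidalClosed E :=
    @cartesianClosedOfEquiv (Sheaf J (Type u)) _ _ E _ _ e.symm sheafMonoidalClosed
  let i : prod.functor.obj U ≅ prod.functor.flip.obj U :=
    NatIso.ofComponents (fun X => prod.braiding U X) (by
      intro X Y f
      change prod.map (𝟙 U) f ≫ (prod.braiding U Y).hom =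
        (prod.braiding U X).hom ≫ prod.map f (𝟙 U)
      apply Limits.prod.hom_ext <;> simp)
  exact Functor.isLeftAdjoint_of_iso (tensorIsoProd U ≪≫ i)

lemma gammaStar_isLeftAdjoint : (gammaStar E).IsLeftAdjoint := ⟨_, ⟨sigmaConstAdj (⊤_ E)⟩⟩

namespace LocConst

variable (𝒰) in
/-- The underlying object of a covering projection. -/
def underlying : CovProj 𝒰 ⥤ E where
  obj X := X.obj.X
  map f := f.hom.f

variable (𝒰) in
/-- The stalks of a covering projection. -/
def stalk (i : 𝒰.I) : CovProj 𝒰 ⥤ Type u where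
  obj X := X.obj.S i
  map f := ↾(f.hom.ϑ i)

instance : PreservesFiniteLimits (underlying 𝒰) := by
  refine preservesFiniteLimits_of_stalkPullback _ ⟨?_⟩ fun p q f g h => h.isPullback_f
  let j : (gammaStar E).obj PUnit.{u + 1} ≅ ⊤_ E :=
    { hom := terminal.from _
      inv := pt PUnit.unit
      hom_inv_id := Sigma.hom_ext _ _ fun x => by
        change pt x ≫ terminal.from _ ≫ pt PUnit.unit = pt x ≫ 𝟙 _
        have : pt x ≫ terminal.from ((gammaStar E).obj PUnit.{u + 1}) = 𝟙 _ :=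
          Subsingleton.elim _ _
        rw [← Category.assoc, this, Category.id_comp, Category.comp_id]
      inv_hom_id := Subsingleton.elim _ _ }
  exact terminalIsTerminal.ofIso j.symm

instance (i : 𝒰.I) : PreservesFiniteLimits (stalk 𝒰 i) := by
  refine preservesFiniteLimits_of_stalkPullback _ ⟨?_⟩ fun {P X Y Z} p q f g h => ?_
  · exact Types.isTerminalPUnit
  · rw [Types.isPullback_iff]
    refine ⟨?_, ?_, ?_⟩
    · ext z
      exact ϑ_congr h.w i z
    · exact fun z z' h' => h.inj i z z' h'.1 h'.2
    · exact fun x y e => h.surj i x y e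

/-- A stalkwise surjective sieve reaches every section U i ⟶ X, and these sections are jointly
epimorphic. -/
lemma epiOnCovers_underlying : EpiOnCovers (stalkTop 𝒰) (underlying 𝒰) := by
  intro X S hS Z p q H
  refine X.obj.elt_epi p q fun x => ?_
  obtain ⟨Y, f, y, hf, hy⟩ := hS x.1 x.2
  have e := elt_hom f.hom y
  rw [hy] at e
  have h1 := congrArg (fun r => Y.obj.elt _ y ≫ r) (H ⟨⟨Y, f⟩, hf⟩)
  refine (congrArg (fun r => r ≫ p) e.symm).trans ((Category.assoc _ _ _).trans (h1.trans ?_))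
  exact (Category.assoc _ _ _).symm.trans (congrArg (fun r => r ≫ q) e)

lemma epiOnCovers_stalk (i : 𝒰.I) : EpiOnCovers (stalkTop 𝒰) (stalk 𝒰 i) := by
  intro X S hS Z p q H
  ext x
  obtain ⟨Y, f, y, hf, rfl⟩ := hS i x
  exact ConcreteCategory.congr_hom (H ⟨⟨Y, f⟩, hf⟩) y

variable (𝒰) in
theorem exists_underlyingPoint : ∃ p : GeomMorphism E (Sheaf (stalkTop 𝒰) (Type u)),
    Nonempty (underlying 𝒰 ≅ ayoneda (stalkTop 𝒰) ⋙ p.inv) :=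
  exists_geomMorphism _ epiOnCovers_underlying

theorem exists_stalkPoint (i : 𝒰.I) : ∃ p : GeomMorphism (Type u) (Sheaf (stalkTop 𝒰) (Type u)),
    Nonempty (stalk 𝒰 i ≅ ayoneda (stalkTop 𝒰) ⋙ p.inv) :=
  exists_geomMorphism _ (epiOnCovers_stalk i)

variable (𝒰) in
/-- The trivializations as a natural isomorphism. -/
def trivialization (i : 𝒰.I) : stalk 𝒰 i ⋙ gammaStar E ⋙ prod.functor.flip.obj (𝒰.U i) ≅
    underlying 𝒰 ⋙ prod.functor.flip.obj (𝒰.U i) :=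
  NatIso.ofComponents (fun X => X.obj.θ i) fun f => f.hom.comm i

variable (𝒰) in
/-- A sheaf on the site of covering projections defines a locally constant object. -/
theorem exists_realization : ∃ (M : Sheaf (stalkTop 𝒰) (Type u) ⥤ GCat 𝒰),
    Nonempty (ayoneda (stalkTop 𝒰) ⋙ M ≅ incl 𝒰) ∧
    ∀ i, ∃ p : GeomMorphism (Type u) (Sheaf (stalkTop 𝒰) (Type u)),
      ∃ e : ∀ A, p.inv.obj A ≅ (M.obj A).obj.S i, ∀ {A B} (f : A ⟶ B) x,
        (M.map f).hom.ϑ i ((e A).hom x) = (e B).hom (p.inv.map f x) := by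
  obtain ⟨p, ⟨α⟩⟩ := exists_underlyingPoint 𝒰
  choose q hq using fun i : 𝒰.I => exists_stalkPoint i
  let a := fun i => (hq i).some
  -- On representables the trivializations form a natural isomorphism. Both sides are left adjoints,
  -- so it extends uniquely to all sheaves.
  have hβ : ∀ i, ∃ β : (q i).inv ⋙ gammaStar E ⋙ prod.functor.flip.obj (𝒰.U i) ≅
      p.inv ⋙ prod.functor.flip.obj (𝒰.U i), ∀ X : CovProj 𝒰,
        prod.map ((gammaStar E).map ((a i).hom.app X)) (𝟙 _) ≫ β.hom.app ((ayoneda _).obj X) =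
          (X.obj.θ i).hom ≫ prod.map (α.hom.app X) (𝟙 _) := by
    intro i
    have := prodRight_isLeftAdjoint (𝒰.U i)
    have := gammaStar_isLeftAdjoint (E := E)
    have adj1 := ((q i).adj.comp (Adjunction.ofIsLeftAdjoint (gammaStar E))).comp
      (Adjunction.ofIsLeftAdjoint (prod.functor.flip.obj (𝒰.U i)))
    have adj2 := p.adj.comp (Adjunction.ofIsLeftAdjoint (prod.functor.flip.obj (𝒰.U i)))
    obtain ⟨β, hβ⟩ := (homDense_ayoneda (stalkTop 𝒰)).exists_natIso adj1 adj2
      (Functor.isoWhiskerRight (a i).symm (gammaStar E ⋙ prod.functor.flip.obj (𝒰.U i)) ≪≫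
        trivialization 𝒰 i ≪≫ Functor.isoWhiskerRight α (prod.functor.flip.obj (𝒰.U i)))
    refine ⟨β, fun X => ?_⟩
    have e1 := hβ X
    let k := (gammaStar E ⋙ prod.functor.flip.obj (𝒰.U i)).mapIso ((a i).app X)
    exact (congrArg (fun r => k.hom ≫ r) e1).trans (k.hom_inv_id_assoc _)
  choose β hβ using hβ
  -- Being over U i is an equality of transformations into a constant functor; by density it is
  -- enough to check it on representables.
  have hs : ∀ i A, (β i).hom.app A ≫ prod.snd = prod.snd := by
    intro i
    have := prodRight_isLeftAdjoint (𝒰.U i)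
    have := gammaStar_isLeftAdjoint (E := E)
    have adj1 := ((q i).adj.comp (Adjunction.ofIsLeftAdjoint (gammaStar E))).comp
      (Adjunction.ofIsLeftAdjoint (prod.functor.flip.obj (𝒰.U i)))
    let s1 : (q i).inv ⋙ gammaStar E ⋙ prod.functor.flip.obj (𝒰.U i) ⟶
        (Functor.const _).obj (𝒰.U i) :=
      { app := fun A => (β i).hom.app A ≫ prod.snd
        naturality := fun A B f => by
          have e1 := (β i).hom.naturality f
          refine (Category.assoc _ _ _).symm.trans ((congrArg (fun r => r ≫ prod.snd) e1).trans ?_)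
          refine (Category.assoc _ _ _).trans ?_
          change _ ≫ prod.map _ (𝟙 _) ≫ prod.snd = _
          rw [prod.map_snd, Category.comp_id]
          exact (Category.comp_id _).symm }
    let s2 : (q i).inv ⋙ gammaStar E ⋙ prod.functor.flip.obj (𝒰.U i) ⟶
        (Functor.const _).obj (𝒰.U i) :=
      { app := fun A => prod.snd
        naturality := fun A B f => by
          change prod.map _ (𝟙 _) ≫ prod.snd = _
          rw [prod.map_snd]
          rfl }
    have : s1 = s2 := (homDense_ayoneda (stalkTop 𝒰)).natTrans_ext adj1 fun X => by
      let k := (gammaStar E ⋙ prod.functor.flip.obj (𝒰.U i)).mapIso ((a i).app X)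
      refine (cancel_epi k.hom).1 ?_
      refine (Category.assoc _ _ _).symm.trans ((congrArg (fun r => r ≫ prod.snd) (hβ i X)).trans ?_)
      change _ = prod.map ((gammaStar E).map ((a i).hom.app X)) (𝟙 (𝒰.U i)) ≫ prod.snd
      rw [prod.map_snd, Category.comp_id]
      exact (Category.assoc _ _ _).trans ((congrArg (fun r => (X.obj.θ i).hom ≫ r)
        ((prod.map_snd _ _).trans (Category.comp_id _))).trans (X.obj.θ_snd i))
    exact fun A => congrArg (fun r => r.app A) this
  let M₀ : Sheaf (stalkTop 𝒰) (Type u) ⥤ LocConst 𝒰 :=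
    { obj := fun A => ⟨p.inv.obj A, fun i => (q i).inv.obj A, fun i => (β i).app A,
        fun i => hs i A⟩
      map := fun f => ⟨p.inv.map f, fun i => (q i).inv.map f, fun i => (β i).hom.naturality f⟩
      map_id := fun A => hom_ext_ϑ fun i x =>
        ConcreteCategory.congr_hom ((q i).inv.map_id A) x
      map_comp := fun f g => hom_ext_ϑ fun i x =>
        ConcreteCategory.congr_hom ((q i).inv.map_comp f g) x }
  let γ : ∀ X : CovProj 𝒰, X.obj ⟶ M₀.obj ((ayoneda (stalkTop 𝒰)).obj X) := fun X =>
    ⟨α.hom.app X, fun i => (a i).hom.app X, fun i => hβ i X⟩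
  have hγ : ∀ X, IsIso (γ X) := fun X => isIso_of_bijective _ fun i => by
    have : IsIso ((a i).hom.app X) := inferInstance
    exact (isIso_iff_bijective _).1 this
  -- A sheaf is covered by representables and the stalk functor preserves epimorphic families, so
  -- each stalk element comes from a covering projection.
  have hM : ∀ A, IsSumOfCoverings (M₀.obj A) := fun A => isSumOfCoverings_iff.2 fun i x => by
    have h1 : EpiFamily fun k : Σ X, (ayoneda (stalkTop 𝒰)).obj X ⟶ A => k.2 :=
      fun Z f g h => (homDense_ayoneda (stalkTop 𝒰)).faithful f g fun X k => h ⟨X, k⟩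
    obtain ⟨k, y, hy⟩ := (h1.map_leftAdjoint (q i).adj).type_surjective x
    refine ⟨k.1.obj, γ k.1 ≫ M₀.map k.2, (a i).inv.app k.1 y, k.1.property, ?_⟩
    have e := ConcreteCategory.congr_hom ((a i).inv_hom_id_app k.1) y
    exact (congrArg (fun r => (q i).inv.map k.2 r) e).trans hy
  refine ⟨ObjectProperty.lift _ M₀ hM, ⟨(NatIso.ofComponents (fun X =>
    ObjectProperty.isoMk _ (@asIso _ _ _ _ (γ X) (hγ X))) fun {X Y} f =>
      ObjectProperty.hom_ext _ (hom_ext_ϑ fun i x => ?_)).symm⟩, fun i => ⟨q i, fun A => Iso.refl _,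
        fun f x => rfl⟩⟩
  exact ConcreteCategory.congr_hom ((a i).hom.naturality f) x

end LocConst

end GTopos

/-! ### G_𝒰 is the topos of sheaves on the covering projections -/

section GTopos

variable {E : Type (u + 1)} [Category.{u} E] [IsGrothendieckTopos.{u} E] {𝒰 𝒱 𝒲 : Cover E}

namespace LocConst

variable (𝒰) in
/-- The functor sending an object of `G_𝒰` to the sheaf of its sections on the covering
projections. -/
abbrev sectionSheaf : GCat 𝒰 ⥤ Sheaf (stalkTop 𝒰) (Type u) :=
  nerveSheaf (incl 𝒰) fun Z => isSheaf_incl Z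

lemma sectionSheaf_fullyFaithful : (sectionSheaf 𝒰).Full ∧ (sectionSheaf 𝒰).Faithful := by
  constructor
  · refine ⟨fun {Y Z} g => ?_⟩
    obtain ⟨h, hh⟩ := (homDense_incl 𝒰).full (fun X k => g.hom.app (op X) k) fun X X' f k =>
      ConcreteCategory.congr_hom (g.hom.naturality f.op) k
    refine ⟨h, (sheafToPresheaf _ _).map_injective ?_⟩
    ext X k
    exact (hh X.unop k).symm
  · refine ⟨fun {Y Z} f g h => (homDense_incl 𝒰).faithful f g fun X k => ?_⟩
    have e := congrArg (fun r => r.hom.app (op X)) h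
    exact ConcreteCategory.congr_hom e k

lemma exists_equalizer_element {T : Type w} [Category.{v} T] [HasEqualizers T] {F : T ⥤ Type u}
    [PreservesLimitsOfShape WalkingParallelPair F] {A B : T} (a b : A ⟶ B) (x : F.obj A)
    (h : F.map a x = F.map b x) :
    ∃ y : F.obj (equalizer a b), F.map (equalizer.ι a b) y = x :=
  (Types.unique_of_type_equalizer _ _ (isLimitForkMapOfIsLimit F _ (equalizerIsEqualizer a b))
    x h).exists

variable (𝒰) in
-- The stalks of the realization M are inverse images of points, hence preserve epimorphic families
-- (`surj`) and equalizers (`inj`). These two facts make the comparison of a sheaf with the sections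
-- of its realization locally surjective and locally injective.
theorem exists_realizationIso : ∃ (M : Sheaf (stalkTop 𝒰) (Type u) ⥤ GCat 𝒰),
    Nonempty (ayoneda (stalkTop 𝒰) ⋙ M ≅ incl 𝒰) ∧
      Nonempty (𝟭 _ ≅ M ⋙ sectionSheaf 𝒰) := by
  obtain ⟨M, ⟨α⟩, hM⟩ := exists_realization 𝒰
  choose p e he using hM
  let γ : ∀ {X : CovProj 𝒰} {A} (_ : (ayoneda (stalkTop 𝒰)).obj X ⟶ A),
    (incl 𝒰).obj X ⟶ M.obj A := fun {X A} k => α.inv.app X ≫ M.map k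
  have γ_comp : ∀ {X : CovProj 𝒰} {A B} (k : (ayoneda (stalkTop 𝒰)).obj X ⟶ A) (f : A ⟶ B),
      γ (k ≫ f) = γ k ≫ M.map f := fun k f => by
    simp only [γ, Functor.map_comp, Category.assoc]
  have γ_map : ∀ {X Y : CovProj 𝒰} {A} (f : Y ⟶ X) (k : (ayoneda (stalkTop 𝒰)).obj X ⟶ A),
      γ ((ayoneda _).map f ≫ k) = (incl 𝒰).map f ≫ γ k := fun f k => by
    have := α.inv.naturality f
    simp only [γ, Functor.map_comp]
    rw [← Category.assoc, ← Category.assoc, this]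
    rfl
  have surj : ∀ A (i : 𝒰.I) (x : (M.obj A).obj.S i), ∃ (X : CovProj 𝒰)
      (k : (ayoneda (stalkTop 𝒰)).obj X ⟶ A) (y : X.obj.S i), (γ k).hom.ϑ i y = x := by
    intro A i x
    have h1 : EpiFamily fun k : Σ X, (ayoneda (stalkTop 𝒰)).obj X ⟶ A => k.2 :=
      fun Z f g h => (homDense_ayoneda (stalkTop 𝒰)).faithful f g fun X k => h ⟨X, k⟩
    obtain ⟨k, y, hy⟩ := (h1.map_leftAdjoint (p i).adj).type_surjective ((e i A).inv x)
    refine ⟨k.1, k.2, (α.hom.app k.1).hom.ϑ i ((e i _).hom y), ?_⟩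
    have e1 := ϑ_congr (congrArg (fun r => r.hom) (α.hom_inv_id_app k.1)) i ((e i _).hom y)
    refine (congrArg ((M.map k.2).hom.ϑ i) e1).trans ((he i k.2 y).trans ?_)
    rw [hy]
    exact ConcreteCategory.congr_hom (e i A).inv_hom_id x
  have inj : ∀ {A B} (a b : A ⟶ B) (i : 𝒰.I) (x : (M.obj A).obj.S i),
      (M.map a).hom.ϑ i x = (M.map b).hom.ϑ i x → ∃ (X : CovProj 𝒰)
      (k : (ayoneda (stalkTop 𝒰)).obj X ⟶ A) (y : X.obj.S i), k ≫ a = k ≫ b ∧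
        (γ k).hom.ϑ i y = x := by
    intro A B a b i x h
    have := (p i).lex
    have ex : (e i A).hom ((e i A).inv x) = x :=
      ConcreteCategory.congr_hom (e i A).inv_hom_id x
    have hB : Function.Injective (e i B).hom :=
      ((isIso_iff_bijective (e i B).hom).1 inferInstance).1
    -- If a and b agree at x on stalks, then x lies in the stalk of their equalizer, which is in
    -- turn covered by representables.
    obtain ⟨y, hy⟩ := exists_equalizer_element (F := (p i).inv) a b ((e i A).inv x) (hB (by
      rw [← he, ← he, ex, h]))
    obtain ⟨X, k, z, hz⟩ := surj (equalizer a b) i ((e i _).hom y)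
    refine ⟨X, k ≫ equalizer.ι a b, z, ?_, ?_⟩
    · rw [Category.assoc, Category.assoc, equalizer.condition]
    · rw [γ_comp]
      refine (congrArg ((M.map (equalizer.ι a b)).hom.ϑ i) hz).trans ?_
      rw [he, hy, ex]
  let ν : ∀ A, A ⟶ (sectionSheaf 𝒰).obj (M.obj A) := fun A =>
    ⟨{ app := fun X => ↾(fun a => γ ((ayonedaEquiv _ X.unop A).symm a))
       naturality := by
        rintro ⟨X⟩ ⟨Y⟩ ⟨f⟩
        ext a
        change γ ((ayonedaEquiv _ Y A).symm (A.obj.map f.op a)) =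
          (incl 𝒰).map f ≫ γ ((ayonedaEquiv _ X A).symm a)
        rw [← γ_map]
        congr 1
        rw [Equiv.symm_apply_eq, ayonedaEquiv_map, Equiv.apply_symm_apply] }⟩
  have h1 : ∀ A, Sheaf.IsLocallyInjective (ν A) := fun A => ⟨by
    rintro ⟨X⟩ a b h i z
    have h' : γ ((ayonedaEquiv _ X A).symm a) = γ ((ayonedaEquiv _ X A).symm b) := h
    have hz : ∀ k : (ayoneda (stalkTop 𝒰)).obj X ⟶ A,
        (M.map k).hom.ϑ i ((α.inv.app X).hom.ϑ i z) = (γ k).hom.ϑ i z := fun k => rfl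
    obtain ⟨Y, κ, y, hκ, hy⟩ := inj ((ayonedaEquiv _ X A).symm a) ((ayonedaEquiv _ X A).symm b) i
      ((α.inv.app X).hom.ϑ i z) (by rw [hz, hz, h'])
    -- κ is only an arrow between sheafified representables. On a cover it comes from an arrow t of
    -- the site, along which a and b agree.
    obtain ⟨S, hS, hS'⟩ := exists_locally_ayoneda κ
    obtain ⟨Y', f, y', hf, rfl⟩ := hS i y
    obtain ⟨t, ht⟩ := hS' f hf
    refine ⟨Y', t, y', ?_, ?_⟩
    · change A.obj.map t.op a = A.obj.map t.op b
      have := congrArg (fun r => ayonedaEquiv _ Y' A ((ayoneda _).map f ≫ r)) hκ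
      simp only [← Category.assoc, ht] at this
      simpa only [ayonedaEquiv_map, Equiv.apply_symm_apply] using this
    · have e1 : γ ((ayoneda _).map f ≫ κ) = (incl 𝒰).map t ≫ γ (𝟙 _) := by
        rw [ht, ← γ_map, Category.comp_id]
      have e2 : γ (𝟙 ((ayoneda (stalkTop 𝒰)).obj X)) = α.inv.app X := by
        refine Eq.trans ?_ (Category.comp_id (α.inv.app X))
        exact congrArg (fun r => α.inv.app X ≫ r) (M.map_id _)
      rw [γ_map, e2] at e1
      have e3 := ϑ_congr (congrArg (fun r => r.hom) e1) i y'
      have e4 : (α.inv.app X).hom.ϑ i (t.hom.ϑ i y') = (α.inv.app X).hom.ϑ i z :=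
        e3.symm.trans hy
      have e5 := congrArg ((α.hom.app X).hom.ϑ i) e4
      have e6 := fun z => ϑ_congr (congrArg (fun r => r.hom) (α.inv_hom_id_app X)) i z
      exact (e6 _).symm.trans (e5.trans (e6 _))⟩
  have h2 : ∀ A, Sheaf.IsLocallySurjective (ν A) := fun A => ⟨by
    intro X h i z
    let h' : (incl 𝒰).obj X ⟶ M.obj A := h
    obtain ⟨Y, k, y, hy⟩ := surj A i (h'.hom.ϑ i z)
    -- Pulling h back along γ k gives a covering projection over which h comes from a section of A.
    obtain ⟨P, p, q, hP⟩ := exists_covPullback h'.hom (γ k).hom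
    obtain ⟨t, rfl, -⟩ := hP.surj i z y hy.symm
    refine ⟨P, p, t, ⟨ayonedaEquiv _ P A ((ayoneda _).map q ≫ k), ?_⟩, rfl⟩
    change γ ((ayonedaEquiv _ P A).symm _) = (incl 𝒰).map p ≫ h'
    rw [Equiv.symm_apply_apply, γ_map]
    exact ObjectProperty.hom_ext _ hP.w.symm⟩
  have h3 : ∀ A, IsIso (ν A) := fun A =>
    (Sheaf.isLocallyBijective_iff_isIso (ν A)).1 ⟨h1 A, h2 A⟩
  refine ⟨M, ⟨α⟩, ⟨NatIso.ofComponents (fun A => asIso (ν A)) fun {A B} f => ?_⟩⟩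
  apply (sheafToPresheaf _ _).map_injective
  ext ⟨X⟩ a
  change γ ((ayonedaEquiv _ X B).symm (f.hom.app _ a)) =
    γ ((ayonedaEquiv _ X A).symm a) ≫ M.map f
  rw [← γ_comp]
  congr 1
  rw [Equiv.symm_apply_eq, ayonedaEquiv_comp, Equiv.apply_symm_apply]

variable (𝒰) in
theorem sectionSheaf_isEquivalence : (sectionSheaf 𝒰).IsEquivalence := by
  obtain ⟨M, -, ⟨h⟩⟩ := exists_realizationIso 𝒰
  have := sectionSheaf_fullyFaithful (𝒰 := 𝒰)
  exact { faithful := this.2, full := this.1, essSurj := ⟨fun A => ⟨M.obj A, ⟨(h.app A).symm⟩⟩⟩ }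

/-- The sheaf of sections of a covering projection is the one it represents. -/
theorem exists_ayonedaIso : Nonempty (ayoneda (stalkTop 𝒰) ≅ incl 𝒰 ⋙ sectionSheaf 𝒰) := by
  obtain ⟨M, ⟨α⟩, ⟨h⟩⟩ := exists_realizationIso 𝒰
  exact ⟨(Functor.rightUnitor _).symm ≪≫ Functor.isoWhiskerLeft _ h ≪≫
    (Functor.associator _ _ _).symm ≪≫ Functor.isoWhiskerRight α _⟩

instance : IsGrothendieckTopos.{u} (GCat 𝒰) := by
  have := sectionSheaf_isEquivalence 𝒰
  obtain ⟨C, _, J, ⟨e⟩⟩ := IsGrothendieckTopos.exists_site (E := Sheaf (stalkTop 𝒰) (Type u))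
  exact ⟨C, inferInstance, J, ⟨(sectionSheaf 𝒰).asEquivalence.trans e⟩⟩

/-- A finite limit preserving functor on covering projections which is epimorphic on covers extends
to the inverse image of a geometric morphism. -/
theorem exists_geomMorphism_GCat {T : Type w} [Category.{v} T] [IsGrothendieckTopos.{u} T]
    (F : CovProj 𝒰 ⥤ T) [PreservesFiniteLimits F] (hF : EpiOnCovers (stalkTop 𝒰) F) :
    ∃ p : GeomMorphism T (GCat 𝒰), Nonempty (F ≅ incl 𝒰 ⋙ p.inv) := by
  have := sectionSheaf_isEquivalence 𝒰
  obtain ⟨p, ⟨α⟩⟩ := exists_geomMorphism F hF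
  have := p.lex
  let e := (sectionSheaf 𝒰).asEquivalence
  refine ⟨⟨sectionSheaf 𝒰 ⋙ p.inv, p.dir ⋙ e.inverse, e.toAdjunction.comp p.adj,
    comp_preservesFiniteLimits _ _⟩, ⟨α ≪≫ Functor.isoWhiskerRight exists_ayonedaIso.some p.inv ≪≫
      Functor.associator _ _ _⟩⟩

end LocConst

end GTopos

/-! ### Transition morphisms between the topoi G_𝒰 -/

section Transition

variable {E : Type (u + 1)} [Category.{u} E] [IsGrothendieckTopos.{u} E] {𝒰 𝒱 𝒲 : Cover E}

namespace LocConst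

lemma IsStalkPullback.isPullback_GCat {P X Y Z : GCat 𝒰} {p : P ⟶ X} {q : P ⟶ Y} {f : X ⟶ Z}
    {g : Y ⟶ Z} (h : IsStalkPullback p.hom q.hom f.hom g.hom) : IsPullback p q f g := by
  have w : p ≫ f = q ≫ g := ObjectProperty.hom_ext _ h.w
  have ex : ∀ s : PullbackCone f g, ∃ l : s.pt ⟶ P, l ≫ p = s.fst ∧ l ≫ q = s.snd := fun s => by
    obtain ⟨l, h1, h2⟩ := h.exists_lift s.fst.hom s.snd.hom
      (congrArg (fun r => r.hom) s.condition)
    exact ⟨ObjectProperty.homMk l, ObjectProperty.hom_ext _ h1, ObjectProperty.hom_ext _ h2⟩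
  choose l h1 h2 using ex
  exact ⟨⟨w⟩, ⟨PullbackCone.IsLimit.mk w l h1 h2 fun s m e1 e2 => ObjectProperty.hom_ext _
    (h.hom_ext (congrArg (fun r => r.hom) (e1.trans (h1 s).symm))
      (congrArg (fun r => r.hom) (e2.trans (h2 s).symm)))⟩⟩

/-- An object with one-point stalks is terminal. -/
lemma isTerminal_of_unique (X : GCat 𝒰) (x : ∀ i, X.obj.S i) (hx : ∀ i (y : X.obj.S i), y = x i) :
    Nonempty (IsTerminal X) :=
  ⟨IsTerminal.ofUniqueHom (fun Y => ObjectProperty.homMk (homMk (fun i _ => x i)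
    fun i j C u v _ _ _ _ => Rel.of_locally (relSieve_mem X.obj u v (x i)) fun D k _ ⟨y, hy⟩ => by
      rwa [hx j y] at hy)) fun Y m => ObjectProperty.hom_ext _ (hom_ext_ϑ fun i y => (hx _ _).trans
        (hx _ _).symm)⟩

instance (h : 𝒰 ⟶ 𝒱) : PreservesFiniteLimits (covPullback h ⋙ incl 𝒰) :=
  preservesFiniteLimits_of_stalkPullback _
    (isTerminal_of_unique _ (fun _ => PUnit.unit) fun _ _ => rfl)
    fun _ _ _ _ hp => IsStalkPullback.isPullback_GCat (hp.pullback h)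

lemma epiOnCovers_covPullback (h : 𝒰 ⟶ 𝒱) :
    EpiOnCovers (stalkTop 𝒱) (covPullback h ⋙ incl 𝒰) := fun X S hS =>
  epiFamily_of_surjective fun i x => by
    obtain ⟨Y, f, y, hf, e⟩ := hS (h.α i) x
    exact ⟨⟨⟨Y, f⟩, hf⟩, y, e⟩

/-- The functors `(h, α)^*` are the inverse images of geometric morphisms. -/
theorem exists_geomMorphism_transition (h : 𝒰 ⟶ 𝒱) :
    ∃ p : GeomMorphism (GCat 𝒰) (GCat 𝒱), p.inv = transition h := by
  obtain ⟨p, ⟨α⟩⟩ := exists_geomMorphism_GCat _ (epiOnCovers_covPullback h)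
  let α' : incl 𝒱 ⋙ transition h ≅ incl 𝒱 ⋙ p.inv := α
  -- The pullback functor restricted to covering projections extends to a geometric morphism p. The
  -- remaining point is that β, from the inverse image of p to `transition h`, is invertible. Only p
  -- is known to have an adjoint, so β is shown bijective on stalks by presenting each element
  -- through covering projections.
  obtain ⟨β, hβ⟩ := (homDense_incl 𝒱).exists_natTrans p.adj α'.inv
  have nat : ∀ {Y : CovProj 𝒱} {A : GCat 𝒱} (f : (incl 𝒱).obj Y ⟶ A) i
      (y : Y.obj.S (h.α i)), (β.app A).hom.ϑ i ((p.inv.map f).hom.ϑ i ((α'.hom.app Y).hom.ϑ i y)) =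
        f.hom.ϑ (h.α i) y := by
    intro Y A f i y
    have e1 := ϑ_congr (congrArg (fun r => r.hom) (β.naturality f)) i ((α'.hom.app Y).hom.ϑ i y)
    rw [hβ] at e1
    have e2 := ϑ_congr (congrArg (fun r => r.hom) (α'.hom_inv_id_app Y)) i y
    exact e1.trans (congrArg (f.hom.ϑ (h.α i)) e2)
  have surj : ∀ {A : GCat 𝒱} i (x : (p.inv.obj A).obj.S i), ∃ (Y : CovProj 𝒱)
      (f : (incl 𝒱).obj Y ⟶ A) (y : Y.obj.S (h.α i)),
        (p.inv.map f).hom.ϑ i ((α'.hom.app Y).hom.ϑ i y) = x := by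
    intro A i x
    have h1 : EpiFamily fun k : Σ X, (incl 𝒱).obj X ⟶ A => k.2 :=
      fun Z f g h => (homDense_incl 𝒱).faithful f g fun X k => h ⟨X, k⟩
    obtain ⟨k, y, hy⟩ := surjective_of_epiFamily (h1.map_leftAdjoint p.adj) x
    refine ⟨k.1, k.2, (α'.inv.app k.1).hom.ϑ i y, ?_⟩
    have e2 := ϑ_congr (congrArg (fun r => r.hom) (α'.inv_hom_id_app k.1)) i y
    exact (congrArg ((p.inv.map k.2).hom.ϑ i) e2).trans hy
  have iso : ∀ A, IsIso (β.app A) := by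
    intro A
    have : IsIso (β.app A).hom := isIso_of_bijective _ fun i => by
      refine ⟨fun x x' hx => ?_, fun x => ?_⟩
      · obtain ⟨Y, f, y, rfl⟩ := surj i x
        obtain ⟨Y', f', y', rfl⟩ := surj i x'
        have hy : f.hom.ϑ (h.α i) y = f'.hom.ϑ (h.α i) y' :=
          (nat f i y).symm.trans (hx.trans (nat f' i y'))
        obtain ⟨P, a, b, hP⟩ := exists_covPullback f.hom f'.hom
        obtain ⟨z, rfl, rfl⟩ := hP.surj _ y y' hy
        have w : (incl 𝒱).map a ≫ f = (incl 𝒱).map b ≫ f' := ObjectProperty.hom_ext _ hP.w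
        have e : ∀ {Y : CovProj 𝒱} (f : (incl 𝒱).obj Y ⟶ A) (a : P ⟶ Y),
            (p.inv.map f).hom.ϑ i ((α'.hom.app Y).hom.ϑ i (a.hom.ϑ _ z)) =
              (p.inv.map ((incl 𝒱).map a ≫ f)).hom.ϑ i ((α'.hom.app P).hom.ϑ i z) := by
          intro Y f a
          rw [Functor.map_comp]
          exact congrArg ((p.inv.map f).hom.ϑ i)
            (ϑ_congr (congrArg (fun r => r.hom) (α'.hom.naturality a)) i z)
        rw [e, e, w]
      · obtain ⟨Y, f, y, hY, e⟩ := isSumOfCoverings_iff.1 A.property (h.α i) x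
        exact ⟨_, (nat (Y := ⟨Y, hY⟩) (ObjectProperty.homMk f) i y).trans e⟩
    let k := asIso (β.app A).hom
    exact ⟨ObjectProperty.homMk k.inv, ObjectProperty.hom_ext _ k.hom_inv_id,
      ObjectProperty.hom_ext _ k.inv_hom_id⟩
  have : IsIso β := NatIso.isIso_of_isIso_app β
  have := p.lex
  exact ⟨⟨transition h, p.dir, p.adj.ofNatIsoLeft (asIso β),
    preservesFiniteLimits_of_natIso (asIso β)⟩, rfl⟩

end LocConst

end Transition

/-! ### The category of all covering projections -/

section CGSite

variable {E : Type (u + 1)} [Category.{u} E] [IsGrothendieckTopos.{u} E] {𝒰 𝒱 𝒲 : Cover E}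

/-- Arrows are determined by their composites with arrows from non-empty generators. -/
lemma eq_of_gen {X Z : E} {p q : X ⟶ Z}
    (h : ∀ a (k : gen a ⟶ X), NonEmpty (gen a) → k ≫ p = k ≫ q) : p = q := by
  refine (exists_generators (E := E)).choose_spec.choose_spec p q fun a k => ?_
  by_cases ha : NonEmpty (gen a)
  · exact h a k ha
  · exact eq_of_not_nonEmpty ha _ _

namespace CG

/-- The arrows along which `f` is given by a map between stalks. -/
def arrowSieve (A B : CG E) (f : A.obj.X ⟶ B.obj.X) {C : E} {i : A.cover.I} {j : B.cover.I}
    (u : C ⟶ A.cover.U i) (v : C ⟶ B.cover.U j) : Sieve C where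
  arrows D k := ∃ s : A.obj.S i → B.obj.S j, ∀ x,
    (k ≫ u) ≫ A.obj.elt i x ≫ f = (k ≫ v) ≫ B.obj.elt j (s x)
  downward_closed := by
    rintro D D' k ⟨s, hs⟩ l
    exact ⟨s, fun x => by simpa using congrArg (fun r => l ≫ r) (hs x)⟩

lemma pullback_arrowSieve (A B : CG E) (f : A.obj.X ⟶ B.obj.X) {C D : E} {i : A.cover.I}
    {j : B.cover.I} (u : C ⟶ A.cover.U i) (v : C ⟶ B.cover.U j) (k : D ⟶ C) :
    (arrowSieve A B f u v).pullback k = arrowSieve A B f (k ≫ u) (k ≫ v) := by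
  ext D' l
  change (∃ s : A.obj.S i → B.obj.S j, ∀ x, ((l ≫ k) ≫ u) ≫ _ = ((l ≫ k) ≫ v) ≫ _) ↔
    ∃ s : A.obj.S i → B.obj.S j, ∀ x, (l ≫ k ≫ u) ≫ _ = (l ≫ k ≫ v) ≫ _
  simp only [Category.assoc]

/-- Over a member of the common refinement the stalk map is that of the lift; local charts of A and
of B carry it to the given u and v. Both covering conditions are used. -/
lemma IsArrow.mem {A B : CG E} {f : A.obj.X ⟶ B.obj.X} (hf : IsArrow A B f) {C : E}
    {i : A.cover.I} {j : B.cover.I} (u : C ⟶ A.cover.U i) (v : C ⟶ B.cover.U j) :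
    arrowSieve A B f u v ∈ epiTop E C := by
  obtain ⟨𝒲, h, l, a, ha⟩ := hf
  refine (epiTop E).transitive (LocConst.coverSieve_mem 𝒲 C) _ fun D k ⟨m, ⟨w⟩⟩ => ?_
  rw [pullback_arrowSieve]
  refine (epiTop E).superset_covering (fun D' b hb => ?_) ((epiTop E).intersection_covering
    (A.covering.chartSieve_mem (k ≫ u) (w ≫ h.h m))
    (B.covering.chartSieve_mem (w ≫ l.h m) (k ≫ v)))
  obtain ⟨⟨s, hs⟩, ⟨t, ht⟩⟩ := hb
  refine ⟨fun x => t (a.ϑ m (s x)), fun x => ?_⟩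
  have e1 := LocConst.elt_hom a (s x)
  have e2 : (h.h m ≫ A.obj.elt (h.α m) (s x)) ≫ f = l.h m ≫ B.obj.elt (l.α m) (a.ϑ m (s x)) :=
    (congrArg (fun r => _ ≫ r) ha).symm.trans <|
    (congrArg (fun r => r ≫ a.f) (LocConst.pullbackObj_elt h A.obj m (s x))).symm.trans
      (e1.trans (LocConst.pullbackObj_elt l B.obj m _))
  have e3 := hs x
  have e4 := ht (a.ϑ m (s x))
  simp only [LocConst.Rel, Category.assoc] at e2 e3 e4 ⊢
  rw [← e4]
  rw [← e2, ← Category.assoc, ← Category.assoc, ← Category.assoc b, ← Category.assoc,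
    ← Category.assoc, ← Category.assoc]
  simp only [Category.assoc]
  exact (by simpa using congrArg (fun r => r ≫ f) e3)

/-- The non-empty generators with a span to the two covers along which f is given by a stalk map
form a common refinement, and f lifts over it tautologically. -/
theorem isArrow_of_mem {A B : CG E} {f : A.obj.X ⟶ B.obj.X}
    (hf : ∀ ⦃C : E⦄ (i : A.cover.I) (j : B.cover.I) (u : C ⟶ A.cover.U i) (v : C ⟶ B.cover.U j),
      arrowSieve A B f u v ∈ epiTop E C) : IsArrow A B f := by
  let I := Σ (i : A.cover.I) (j : B.cover.I) (a : GenIdx E),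
    { k : (gen a ⟶ A.cover.U i) × (gen a ⟶ B.cover.U j) // NonEmpty (gen a) ∧
      ∃ s : A.obj.S i → B.obj.S j, ∀ x, k.1 ≫ A.obj.elt i x ≫ f = k.2 ≫ B.obj.elt j (s x) }
  let 𝒲 : Cover E :=
    { I := I
      U := fun z => gen z.2.2.1
      nonempty := fun z => z.2.2.2.2.1
      epi := fun Z p q H => A.cover.epi p q fun i => by
        refine eq_of_locally (LocConst.coverSieve_mem B.cover (A.cover.U i)) fun C u ⟨j, ⟨v⟩⟩ _ => ?_
        refine eq_of_locally (hf i j u v) fun D k ⟨s, hs⟩ hD => ?_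
        refine eq_of_gen fun a l ha => ?_
        have := H ⟨i, j, a, (l ≫ k ≫ u, l ≫ k ≫ v), ha, s, fun x => by
          simpa using congrArg (fun r => l ≫ r) (hs x)⟩
        have t1 : l ≫ k ≫ u ≫ terminal.from (A.cover.U i) = terminal.from (gen a) :=
          Subsingleton.elim _ _
        simp only [← Category.assoc] at t1 ⊢
        rw [t1]
        exact this }
  let h : 𝒲 ⟶ A.cover := ⟨fun z => z.1, fun z => z.2.2.2.1.1⟩
  let l : 𝒲 ⟶ B.cover := ⟨fun z => z.2.1, fun z => z.2.2.2.1.2⟩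
  refine ⟨𝒲, h, l, ⟨f, fun z => z.2.2.2.2.2.choose, fun z =>
    (LocConst.comm_iff _ _ _).2 fun x => ?_⟩, rfl⟩
  have h1 := z.2.2.2.2.2.choose_spec x
  have e1 := LocConst.pullbackObj_elt h A.obj z x
  have e2 := LocConst.pullbackObj_elt l B.obj z (z.2.2.2.2.2.choose x)
  exact (congrArg (fun r => r ≫ f) e1).trans ((Category.assoc _ _ _).trans (h1.trans e2.symm))

lemma hom_ext {A B : CG E} {f g : A ⟶ B} (h : f.1 = g.1) : f = g := Subtype.ext h

variable (𝒰) in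
/-- The constant object on a point is terminal. -/
def isTerminalLam : IsTerminal ((lam 𝒰).obj (LocConst.constCov 𝒰 PUnit.{u + 1})) := by
  let t : IsTerminal ((gammaStar E).obj PUnit.{u + 1}) :=
    (LocConst.isTerminalConst 𝒰).isTerminalObj (LocConst.underlying 𝒰)
  exact IsTerminal.ofUniqueHom (fun A => ⟨t.from A.obj.X, isArrow_of_mem fun C i j u v => by
    refine (epiTop E).superset_covering (S := ⊤) (fun D k _ => ?_) ((epiTop E).top_mem C)
    exact ⟨fun _ => PUnit.unit, fun x => t.hom_ext _ _⟩⟩) fun A m => hom_ext (t.hom_ext _ _)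

/-- The underlying square is a pullback in E. The induced arrow belongs to cG(E) because the stalk
maps of its two components, available locally, combine in the stalkwise pullback. -/
lemma isPullback_lam {P X Y Z : CovProj 𝒰} {p : P ⟶ X} {q : P ⟶ Y} {f : X ⟶ Z} {g : Y ⟶ Z}
    (h : LocConst.IsStalkPullback p.hom q.hom f.hom g.hom) :
    IsPullback ((lam 𝒰).map p) ((lam 𝒰).map q) ((lam 𝒰).map f) ((lam 𝒰).map g) := by
  have sq : IsPullback p.hom.f q.hom.f f.hom.f g.hom.f := h.isPullback_f
  have w : (lam 𝒰).map p ≫ (lam 𝒰).map f = (lam 𝒰).map q ≫ (lam 𝒰).map g := hom_ext sq.w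
  have ex : ∀ s : PullbackCone ((lam 𝒰).map f) ((lam 𝒰).map g), ∃ l : s.pt ⟶ (lam 𝒰).obj P,
      l ≫ (lam 𝒰).map p = s.fst ∧ l ≫ (lam 𝒰).map q = s.snd := by
    intro s
    have e : s.fst.1 ≫ f.hom.f = s.snd.1 ≫ g.hom.f := congrArg Subtype.val s.condition
    obtain ⟨l, l1, l2⟩ : ∃ l : s.pt.obj.X ⟶ P.obj.X, l ≫ p.hom.f = s.fst.1 ∧
        l ≫ q.hom.f = s.snd.1 := ⟨sq.lift s.fst.1 s.snd.1 e, sq.lift_fst _ _ _, sq.lift_snd _ _ _⟩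
    refine ⟨⟨l, isArrow_of_mem fun C i (j : 𝒰.I) u (v : C ⟶ 𝒰.U j) => ?_⟩, hom_ext l1, hom_ext l2⟩
    refine mem_epiTop_of_nonEmpty ((epiTop E).intersection_covering (s.fst.2.mem u v)
      (s.snd.2.mem u v)) fun D k hD ⟨ha, hb⟩ => ?_
    let f₁ : s.pt.obj.X ⟶ X.obj.X := s.fst.1
    let g₁ : s.pt.obj.X ⟶ Y.obj.X := s.snd.1
    have e' : f₁ ≫ f.hom.f = g₁ ≫ g.hom.f := e
    obtain ⟨a, ha'⟩ : ∃ a : s.pt.obj.S i → X.obj.S j, ∀ x,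
      (k ≫ u) ≫ s.pt.obj.elt i x ≫ f₁ = (k ≫ v) ≫ X.obj.elt j (a x) := ha
    obtain ⟨b, hb'⟩ : ∃ b : s.pt.obj.S i → Y.obj.S j, ∀ x,
      (k ≫ u) ≫ s.pt.obj.elt i x ≫ g₁ = (k ≫ v) ≫ Y.obj.elt j (b x) := hb
    have hab : ∀ x, f.hom.ϑ j (a x) = g.hom.ϑ j (b x) := fun x => by
      refine LocConst.eq_of_elt hD (u := k ≫ v) ?_
      rw [← LocConst.elt_hom, ← LocConst.elt_hom, ← Category.assoc, ← ha',
        ← Category.assoc _ (Y.obj.elt j (b x)), ← hb']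
      simp only [Category.assoc, e']
    choose z h1 h2 using fun x => h.surj j (a x) (b x) (hab x)
    refine ⟨z, fun x => sq.hom_ext ?_ ?_⟩
    · have e1 := LocConst.elt_hom p.hom (z x)
      rw [h1] at e1
      refine Eq.trans ?_ ((ha' x).trans ?_)
      · exact (Category.assoc _ _ _).trans (congrArg (fun r => (k ≫ u) ≫ r)
          ((Category.assoc _ _ _).trans (congrArg (fun r => s.pt.obj.elt i x ≫ r) l1)))
      · rw [← e1]
        exact (Category.assoc _ _ _).symm
    · have e1 := LocConst.elt_hom q.hom (z x)
      rw [h2] at e1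
      refine Eq.trans ?_ ((hb' x).trans ?_)
      · exact (Category.assoc _ _ _).trans (congrArg (fun r => (k ≫ u) ≫ r)
          ((Category.assoc _ _ _).trans (congrArg (fun r => s.pt.obj.elt i x ≫ r) l2)))
      · rw [← e1]
        exact (Category.assoc _ _ _).symm
  choose l h1 h2 using ex
  exact ⟨⟨w⟩, ⟨PullbackCone.IsLimit.mk w l h1 h2 fun s m e1 e2 => hom_ext (sq.hom_ext
    (congrArg Subtype.val (e1.trans (h1 s).symm)) (congrArg Subtype.val (e2.trans (h2 s).symm)))⟩⟩

instance : PreservesFiniteLimits (lam 𝒰) :=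
  LocConst.preservesFiniteLimits_of_stalkPullback _ ⟨isTerminalLam 𝒰⟩
    fun _ _ _ _ h => isPullback_lam h

/-- Every cospan comes from covering projections trivialized by one cover. -/
theorem exists_lam_cospan {A B C : CG E} (f : A ⟶ C) (g : B ⟶ C) :
    ∃ (𝒵 : Cover E) (X Y Z : CovProj 𝒵) (f' : X ⟶ Z) (g' : Y ⟶ Z) (a : (lam 𝒵).obj X ≅ A)
      (b : (lam 𝒵).obj Y ≅ B) (c : (lam 𝒵).obj Z ≅ C),
      (lam 𝒵).map f' ≫ c.hom = a.hom ≫ f ∧ (lam 𝒵).map g' ≫ c.hom = b.hom ≫ g := by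
  obtain ⟨f, 𝒲, h, l, a, rfl⟩ := f
  obtain ⟨g, 𝒲', h', l', b, rfl⟩ := g
  -- The two lifts end in inverse images of C along different refinements. After a further
  -- refinement, e identifies these over the identity of C.
  obtain ⟨𝒵, k, k', e, he⟩ := LocConst.exists_refinement l l' C.covering
  let Z : CovProj 𝒵 := (covPullback (k' ≫ l')).obj ⟨C.obj, C.covering⟩
  let X : CovProj 𝒵 := (covPullback (k ≫ h)).obj ⟨A.obj, A.covering⟩
  let Y : CovProj 𝒵 := (covPullback (k' ≫ h')).obj ⟨B.obj, B.covering⟩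
  let f' : X ⟶ Z := ObjectProperty.homMk ((LocConst.pullbackCompIso k h A.obj).hom ≫
    (LocConst.pullback k).map a ≫ (LocConst.pullbackCompIso k l C.obj).inv ≫ e)
  let g' : Y ⟶ Z := ObjectProperty.homMk ((LocConst.pullbackCompIso k' h' B.obj).hom ≫
    (LocConst.pullback k').map b ≫ (LocConst.pullbackCompIso k' l' C.obj).inv)
  refine ⟨𝒵, X, Y, Z, f', g', lamIso (k ≫ h) ⟨A.obj, A.covering⟩,
    lamIso (k' ≫ h') ⟨B.obj, B.covering⟩, lamIso (k' ≫ l') ⟨C.obj, C.covering⟩,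
    hom_ext ?_, hom_ext ?_⟩
  · change (𝟙 _ ≫ a.f ≫ 𝟙 _ ≫ e.f) ≫ 𝟙 _ = 𝟙 _ ≫ a.f
    rw [he]
    exact (Category.comp_id _).trans (congrArg (fun r => 𝟙 _ ≫ r)
      ((congrArg (fun r => a.f ≫ r) (Category.comp_id _)).trans (Category.comp_id _)))
  · change (𝟙 _ ≫ b.f ≫ 𝟙 _) ≫ 𝟙 _ = 𝟙 _ ≫ b.f
    exact (Category.comp_id _).trans (congrArg (fun r => 𝟙 _ ≫ r) (Category.comp_id _))

variable (E) in
/-- The cover by the non-empty generators satisfying a condition. -/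
def genCover (T : Set (GenIdx E)) (hT : ∀ a ∈ T, NonEmpty (gen a))
    (hT' : EpiFamily fun a : T => terminal.from (gen a.1)) : Cover E :=
  ⟨T, fun a => gen a.1, fun a => hT a a.2, hT'⟩

/-- Covers form a large collection, but the covers given by sets of generators form a small one, and
they refine all the others. -/
lemma exists_genCover (𝒰 : Cover E) : ∃ (T : Set (GenIdx E)) (hT : ∀ a ∈ T, NonEmpty (gen a))
    (hT' : EpiFamily fun a : T => terminal.from (gen a.1)),
      Nonempty (genCover E T hT hT' ⟶ 𝒰) := by
  refine ⟨{a | NonEmpty (gen a) ∧ ∃ i, Nonempty (gen a ⟶ 𝒰.U i)}, fun a h => h.1, ?_, ?_⟩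
  · intro Z p q H
    refine 𝒰.epi p q fun i => eq_of_gen fun a l ha => ?_
    have := H ⟨a, ha, i, ⟨l⟩⟩
    have t1 : l ≫ terminal.from (𝒰.U i) = terminal.from (gen a) := Subsingleton.elim _ _
    rw [← Category.assoc, ← Category.assoc, t1]
    exact this
  · choose i hi using fun a : {a : GenIdx E | NonEmpty (gen a) ∧ ∃ i, Nonempty (gen a ⟶ 𝒰.U i)} =>
      a.2.2
    exact ⟨⟨i, fun a => (hi a).some⟩⟩

variable (E) in
lemma nonempty_cover : Nonempty (Cover E) :=
  ⟨⟨{a : GenIdx E // NonEmpty (gen a)}, fun a => gen a.1, fun a => a.2, fun Z p q H =>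
    eq_of_gen fun a l ha => by
      have : l = terminal.from _ := Subsingleton.elim _ _
      rw [this]
      exact H ⟨a, ha⟩⟩⟩

instance : HasFiniteLimits (CG E) := by
  have : HasTerminal (CG E) := (isTerminalLam (nonempty_cover E).some).hasTerminal
  have : ∀ {X Y Z : CG E} {f : X ⟶ Z} {g : Y ⟶ Z}, HasLimit (cospan f g) := by
    intro A B C f g
    obtain ⟨𝒵, X, Y, Z, f', g', a, b, c, h1, h2⟩ := exists_lam_cospan f g
    obtain ⟨P, p, q, h⟩ := LocConst.exists_covPullback f'.hom g'.hom
    exact ((isPullback_lam h).of_iso (Iso.refl _) a b c (fst' := (lam 𝒵).map p ≫ a.hom)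
      (snd' := (lam 𝒵).map q ≫ b.hom) (by simp) (by simp) h1 h2).hasPullback
  have : HasPullbacks (CG E) := hasPullbacks_of_hasLimit_cospan _
  exact hasFiniteLimits_of_hasTerminal_and_pullbacks

/-- Recognition of the functors on `cG(E)` which preserve finite limits. -/
theorem preservesFiniteLimits_of_lam {T : Type w} [Category.{v} T] (F : CG E ⥤ T)
    (hF : ∀ 𝒰 : Cover E, PreservesFiniteLimits (lam 𝒰 ⋙ F)) : PreservesFiniteLimits F := by
  let 𝒰 := (nonempty_cover E).some
  have t1 : PreservesLimit (Functor.empty.{0} (CG E)) F :=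
    preservesLimit_of_preserves_limit_cone (isTerminalLam 𝒰)
      ((isLimitMapConeEmptyConeEquiv F _).symm
        ((LocConst.isTerminalConst 𝒰).isTerminalObj (lam 𝒰 ⋙ F)))
  have : PreservesLimitsOfShape (Discrete PEmpty.{1}) F :=
    preservesLimitsOfShape_pempty_of_preservesTerminal F
  have t2 : ∀ {A B C : CG E} (f : A ⟶ C) (g : B ⟶ C), PreservesLimit (cospan f g) F := by
    intro A B C f g
    obtain ⟨𝒵, X, Y, Z, f', g', a, b, c, h1, h2⟩ := exists_lam_cospan f g
    obtain ⟨P, p, q, h⟩ := LocConst.exists_covPullback f'.hom g'.hom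
    have sq : IsPullback ((lam 𝒵).map p ≫ a.hom) ((lam 𝒵).map q ≫ b.hom) f g :=
      (isPullback_lam h).of_iso (Iso.refl _) a b c (by simp) (by simp) h1 h2
    have sq' : IsPullback (F.map ((lam 𝒵).map p ≫ a.hom)) (F.map ((lam 𝒵).map q ≫ b.hom))
        (F.map f) (F.map g) :=
      (h.isPullback_cov.map (lam 𝒵 ⋙ F)).of_iso (Iso.refl _) (F.mapIso a) (F.mapIso b)
        (F.mapIso c) (by simp) (by simp) (by simp [← Functor.map_comp, h1])
        (by simp [← Functor.map_comp, h2])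
    exact preservesLimit_of_preserves_limit_cone sq.isLimit
      ((isLimitMapConePullbackConeEquiv F sq.w).symm sq'.isLimit)
  have : PreservesLimitsOfShape WalkingCospan F :=
    ⟨fun {K} => preservesLimit_of_iso_diagram F (diagramIsoCospan K).symm⟩
  exact preservesFiniteLimits_of_preservesTerminal_and_pullbacks F

/-- The families generating the topology are covering. -/
lemma ofArrows_mem_topology {X : CovProj 𝒰} {A : Type u} {Y : A → CovProj 𝒰} {f : ∀ a, Y a ⟶ X}
    (hf : EpiFamily (fun a => (incl 𝒰).map (f a))) :
    Sieve.ofArrows _ (fun a => (lam 𝒰).map (f a)) ∈ topology E ((lam 𝒰).obj X) := by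
  rw [topology, GrothendieckTopology.mem_sInf]
  exact fun J hJ => hJ 𝒰 X A Y f hf

/-- Choosing one arrow of S for each stalk element produces a small epimorphic family, one of those
generating the topology. -/
lemma lam_mem_topology {X : CovProj 𝒰} {S : Sieve X} (hS : S ∈ LocConst.stalkTop 𝒰 X)
    {R : Sieve ((lam 𝒰).obj X)} (hR : ∀ ⦃Y : CovProj 𝒰⦄ (f : Y ⟶ X), S f → R ((lam 𝒰).map f)) :
    R ∈ topology E ((lam 𝒰).obj X) := by
  choose Y f y hf hy using hS
  have h1 : EpiFamily fun p : (Σ i, X.obj.S i) => (incl 𝒰).map (f p.1 p.2) :=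
    LocConst.epiFamily_of_surjective fun i x => ⟨⟨i, x⟩, y i x, hy i x⟩
  refine (topology E).superset_covering ?_ (ofArrows_mem_topology h1)
  rw [Sieve.ofArrows, Sieve.generate_le_iff]
  rintro _ _ ⟨p⟩
  exact hR _ (hf p.1 p.2)

instance : IsDenselySmall (topology E) where
  exists_dense := by
    let K := {T : Set (GenIdx E) // ∃ _ : ∀ a ∈ T, NonEmpty (gen a),
      EpiFamily fun a : T => terminal.from (gen a.1)}
    let 𝒢 : K → Cover E := fun t => genCover E t.1 t.2.choose t.2.choose_spec
    -- Any object of cG(E) is isomorphic to its inverse image along a refinement by a cover of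
    -- generators, where objects with small stalks are dense.
    refine ⟨⨆ t : K, (LocConst.smallStalks (𝒢 t)).map (lam (𝒢 t)), inferInstance, fun A => ?_⟩
    obtain ⟨T, hT, hT', ⟨h⟩⟩ := exists_genCover A.cover
    let t : K := ⟨T, hT, hT'⟩
    let X : CovProj (𝒢 t) := (covPullback h).obj ⟨A.obj, A.covering⟩
    let e : (lam (𝒢 t)).obj X ≅ A := lamIso h ⟨A.obj, A.covering⟩
    let P : ObjectProperty (CG E) := ⨆ t : K, (LocConst.smallStalks (𝒢 t)).map (lam (𝒢 t))
    let S : Sieve A := ⟨fun Y f => ∃ (Z : CG E) (g : Y ⟶ Z) (h : Z ⟶ A), P Z ∧ g ≫ h = f, by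
      rintro Y Y' f ⟨Z, g, h, hZ, rfl⟩ k
      exact ⟨Z, k ≫ g, h, hZ, Category.assoc _ _ _⟩⟩
    refine ⟨S, ?_, fun Y f hf => hf⟩
    have h1 : S.pullback e.hom ∈ topology E ((lam (𝒢 t)).obj X) := by
      refine lam_mem_topology (X := X) (S := ⟨fun Y f => ∃ (Z : CovProj (𝒢 t)) (g : Y ⟶ Z)
        (h : Z ⟶ X), LocConst.smallStalks _ Z ∧ g ≫ h = f, ?_⟩) (fun i x => ?_) fun Y f hf => ?_
      · rintro Y Y' f ⟨Z, g, h, hZ, rfl⟩ k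
        exact ⟨Z, k ≫ g, h, hZ, Category.assoc _ _ _⟩
      · obtain ⟨Y, f, y, hY, hy⟩ := LocConst.exists_smallStalks X x
        exact ⟨Y, f, y, ⟨Y, 𝟙 Y, f, hY, Category.id_comp _⟩, hy⟩
      · obtain ⟨Z, g, h, hZ, rfl⟩ := hf
        refine ⟨(lam (𝒢 t)).obj Z, (lam (𝒢 t)).map g, (lam (𝒢 t)).map h ≫ e.hom, ?_, by simp⟩
        exact le_iSup (fun t : K => (LocConst.smallStalks (𝒢 t)).map (lam (𝒢 t))) t _
          (ObjectProperty.prop_map_obj _ _ hZ)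
    have h2 := (topology E).pullback_stable e.inv h1
    rwa [← Sieve.pullback_comp, e.inv_hom_id, Sieve.pullback_id] at h2

instance : HasSheafify (topology E) (Type u) := hasSheafify_of_densely_small _

end CG

variable (E) in
theorem isGrothendieckTopos_GTopos : IsGrothendieckTopos.{u} (GTopos E) :=
  isGrothendieckTopos_sheaf _

end CGSite

/-! ### The functor on `cG(E)` defined by a pseudo-cone -/

section Cone

variable {E : Type (u + 1)} [Category.{u} E] [IsGrothendieckTopos.{u} E] {𝒰 𝒱 𝒲 : Cover E}

/-- The disjoint union of two covers. -/
def Cover.sum (𝒲 𝒲' : Cover E) : Cover E where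
  I := 𝒲.I ⊕ 𝒲'.I
  U := Sum.elim 𝒲.U 𝒲'.U
  nonempty i := by
    cases i with
    | inl i => exact 𝒲.nonempty i
    | inr i => exact 𝒲'.nonempty i
  epi := fun _ p q H => 𝒲.epi p q fun i => H (.inl i)

def Cover.inl (𝒲 𝒲' : Cover E) : 𝒲 ⟶ 𝒲.sum 𝒲' := ⟨Sum.inl, fun _ => 𝟙 _⟩

def Cover.inr (𝒲 𝒲' : Cover E) : 𝒲' ⟶ 𝒲.sum 𝒲' := ⟨Sum.inr, fun _ => 𝟙 _⟩

def Cover.desc {𝒲 𝒲' : Cover E} (h : 𝒲 ⟶ 𝒰) (h' : 𝒲' ⟶ 𝒰) : 𝒲.sum 𝒲' ⟶ 𝒰 :=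
  ⟨Sum.elim h.α h'.α, fun i => match i with
    | .inl i => h.h i
    | .inr i => h'.h i⟩

lemma Cover.inl_desc {𝒲 𝒲' : Cover E} (h : 𝒲 ⟶ 𝒰) (h' : 𝒲' ⟶ 𝒰) :
    Cover.inl 𝒲 𝒲' ≫ Cover.desc h h' = h :=
  Cover.Hom.ext rfl (heq_of_eq (funext fun _ => Category.id_comp _))

lemma Cover.inr_desc {𝒲 𝒲' : Cover E} (h : 𝒲 ⟶ 𝒰) (h' : 𝒲' ⟶ 𝒰) :
    Cover.inr 𝒲 𝒲' ≫ Cover.desc h h' = h' :=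
  Cover.Hom.ext rfl (heq_of_eq (funext fun _ => Category.id_comp _))

/-- An object of `cG(E)` as an object of one of the topoi `G_𝒰`. -/
abbrev CG.toGCat (A : CG E) : GCat A.cover := ⟨A.obj, A.covering.isSum⟩

variable {T : Type w'} [Category.{v'} T] (d : PseudoCone E T)

namespace PseudoCone

/-- The arrow defined by an arrow between pullbacks along refinements. -/
def lift {A B : CG E} (h : 𝒲 ⟶ A.cover) (l : 𝒲 ⟶ B.cover)
    (a : (LocConst.pullback h).obj A.obj ⟶ (LocConst.pullback l).obj B.obj) :
    (d.leg A.cover).inv.obj A.toGCat ⟶ (d.leg B.cover).inv.obj B.toGCat :=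
  (d.iso h).inv.app A.toGCat ≫ (d.leg 𝒲).inv.map (X := (transition h).obj A.toGCat)
    (Y := (transition l).obj B.toGCat) (ObjectProperty.homMk a) ≫ (d.iso l).hom.app B.toGCat

variable {d}

/-- Passing to a finer cover changes nothing: this is naturality of `d.iso k` together with the
coherence of d for composites. An arrow of P_𝒰 is determined by its underlying arrow of E, so a'
need only have the right `f`. -/
lemma lift_restrict {A B : CG E} {𝒵 : Cover E} {h : 𝒲 ⟶ A.cover} {l : 𝒲 ⟶ B.cover}
    {a : (LocConst.pullback h).obj A.obj ⟶ (LocConst.pullback l).obj B.obj} (k : 𝒵 ⟶ 𝒲)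
    {h' : 𝒵 ⟶ A.cover} {l' : 𝒵 ⟶ B.cover} (eh : k ≫ h = h') (el : k ≫ l = l')
    {a' : (LocConst.pullback h').obj A.obj ⟶ (LocConst.pullback l').obj B.obj} (ha : a'.f = a.f) :
    d.lift h' l' a' = d.lift h l a := by
  subst eh el
  let m : (transition h).obj A.toGCat ⟶ (transition l).obj B.toGCat := ObjectProperty.homMk a
  let m' : (transition (k ≫ h)).obj A.toGCat ⟶ (transition (k ≫ l)).obj B.toGCat :=
    ObjectProperty.homMk a'
  have e1 : m' ≫ (transitionComp k l B.toGCat).hom =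
      (transitionComp k h A.toGCat).hom ≫ (transition k).map m :=
    ObjectProperty.hom_ext _ (LocConst.hom_ext_f
      ((Category.comp_id _).trans (ha.trans (Category.id_comp _).symm)))
  have e2 := (d.iso k).hom.naturality m
  have e3 := d.iso_comp k h A.toGCat
  have e4 := d.iso_comp k l B.toGCat
  change (d.iso (k ≫ h)).inv.app A.toGCat ≫ (d.leg 𝒵).inv.map m' ≫
      (d.iso (k ≫ l)).hom.app B.toGCat =
    (d.iso h).inv.app A.toGCat ≫ (d.leg 𝒲).inv.map m ≫ (d.iso l).hom.app B.toGCat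
  refine ((d.iso (k ≫ h)).app A.toGCat).inv_comp_eq.2 ?_
  change _ = (d.iso (k ≫ h)).hom.app A.toGCat ≫ _
  have e5 : (d.iso h).hom.app A.toGCat ≫ (d.iso h).inv.app A.toGCat = 𝟙 _ :=
    (d.iso h).hom_inv_id_app _
  rw [e3, e4, ← Category.assoc ((d.leg 𝒵).inv.map m'), ← Functor.map_comp, e1, Functor.map_comp]
  simp only [Category.assoc]
  congr 1
  rw [← Category.assoc ((d.iso h).hom.app A.toGCat), e5, Category.id_comp]
  exact (Category.assoc _ _ _).symm.trans
    ((congrArg (fun r => r ≫ (d.iso l).hom.app B.toGCat) e2).trans (Category.assoc _ _ _))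

lemma lift_eq {A B : CG E} {𝒲' : Cover E} {h : 𝒲 ⟶ A.cover} {l : 𝒲 ⟶ B.cover}
    {a : (LocConst.pullback h).obj A.obj ⟶ (LocConst.pullback l).obj B.obj}
    {h' : 𝒲' ⟶ A.cover} {l' : 𝒲' ⟶ B.cover}
    {a' : (LocConst.pullback h').obj A.obj ⟶ (LocConst.pullback l').obj B.obj} (ha : a.f = a'.f) :
    d.lift h l a = d.lift h' l' a' := by
  let f : A.obj.X ⟶ B.obj.X := a.f
  have k1 : ∀ i x, (h.h i ≫ A.obj.elt _ x) ≫ f = l.h i ≫ B.obj.elt _ (a.ϑ i x) := fun i x =>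
    (congrArg (fun r => r ≫ f) (LocConst.pullbackObj_elt h A.obj i x)).symm.trans
      ((LocConst.elt_hom a x).trans (LocConst.pullbackObj_elt l B.obj i _))
  have k2 : ∀ i x, (h'.h i ≫ A.obj.elt _ x) ≫ f = l'.h i ≫ B.obj.elt _ (a'.ϑ i x) := fun i x =>
    (congrArg (fun r => r ≫ f) (LocConst.pullbackObj_elt h' A.obj i x)).symm.trans
      ((congrArg (fun r => _ ≫ r) ha).trans
        ((LocConst.elt_hom a' x).trans (LocConst.pullbackObj_elt l' B.obj i _)))
  -- The stalk functions of a and a' are put side by side over the disjoint union of the covers,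
  -- over the same f. Both a and a' are then restrictions of b.
  let b : (LocConst.pullback (Cover.desc h h')).obj A.obj ⟶
      (LocConst.pullback (Cover.desc l l')).obj B.obj :=
    ⟨f, fun i => match i with
      | .inl i => a.ϑ i
      | .inr i => a'.ϑ i, fun i => (LocConst.comm_iff _ _ _).2 fun x => by
        refine (congrArg (fun r => r ≫ f)
          (LocConst.pullbackObj_elt (Cover.desc h h') A.obj i x)).trans ?_
        refine Eq.trans ?_ (LocConst.pullbackObj_elt (Cover.desc l l') B.obj i _).symm
        cases i with
        | inl i => exact k1 i x
        | inr i => exact k2 i x⟩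
  exact (lift_restrict (a := b) (Cover.inl 𝒲 𝒲') (Cover.inl_desc h h') (Cover.inl_desc l l')
    rfl).trans (lift_restrict (a := b) (Cover.inr 𝒲 𝒲') (Cover.inr_desc h h')
      (Cover.inr_desc l l') ha.symm).symm

lemma lift_id (A : CG E) (h : 𝒲 ⟶ A.cover) : d.lift (A := A) (B := A) h h (𝟙 _) = 𝟙 _ := by
  have e : (ObjectProperty.homMk (𝟙 ((LocConst.pullback h).obj A.obj)) :
    (transition h).obj A.toGCat ⟶ (transition h).obj A.toGCat) = 𝟙 _ := rfl
  rw [lift, e, CategoryTheory.Functor.map_id]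
  exact (congrArg (fun r => (d.iso h).inv.app A.toGCat ≫ r) (Category.id_comp _)).trans
    ((d.iso h).inv_hom_id_app _)

/-- After a refinement on which the two inverse images of B are identified by e, composition takes
place in one P_𝒵. Since e lies over the identity, its lift is the identity, which makes the
structural isomorphisms in the middle cancel. -/
lemma lift_comp {A B C : CG E} {𝒲' : Cover E} {h : 𝒲 ⟶ A.cover} {l : 𝒲 ⟶ B.cover}
    {a : (LocConst.pullback h).obj A.obj ⟶ (LocConst.pullback l).obj B.obj}
    {l' : 𝒲' ⟶ B.cover} {m : 𝒲' ⟶ C.cover}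
    {b : (LocConst.pullback l').obj B.obj ⟶ (LocConst.pullback m).obj C.obj} {𝒵 : Cover E}
    {h' : 𝒵 ⟶ A.cover} {m' : 𝒵 ⟶ C.cover}
    {c : (LocConst.pullback h').obj A.obj ⟶ (LocConst.pullback m').obj C.obj}
    (hc : c.f = ((a.f : A.obj.X ⟶ B.obj.X) ≫ (b.f : B.obj.X ⟶ C.obj.X) : A.obj.X ⟶ C.obj.X)) :
    d.lift h' m' c = d.lift h l a ≫ d.lift l' m b := by
  obtain ⟨𝒵, k, k', e, he⟩ := LocConst.exists_refinement l l' B.covering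
  let a' : (LocConst.pullback (k ≫ h)).obj A.obj ⟶ (LocConst.pullback (k ≫ l)).obj B.obj :=
    (LocConst.pullbackCompIso k h A.obj).hom ≫ (LocConst.pullback k).map a ≫
      (LocConst.pullbackCompIso k l B.obj).inv
  have ha' : a'.f = a.f := (Category.id_comp _).trans (Category.comp_id a.f)
  let b' : (LocConst.pullback (k' ≫ l')).obj B.obj ⟶ (LocConst.pullback (k' ≫ m)).obj C.obj :=
    (LocConst.pullbackCompIso k' l' B.obj).hom ≫ (LocConst.pullback k').map b ≫
      (LocConst.pullbackCompIso k' m C.obj).inv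
  have hb' : b'.f = b.f := (Category.id_comp _).trans (Category.comp_id b.f)
  rw [← lift_restrict k rfl rfl ha', ← lift_restrict k' rfl rfl hb',
    lift_eq (a' := a' ≫ e ≫ b') (hc.trans ?_)]
  · have e1 : d.lift (k ≫ l) (k' ≫ l') e = 𝟙 _ := by
      rw [← lift_id B (𝟙 B.cover)]
      exact lift_eq he
    let ma : (transition (k ≫ h)).obj A.toGCat ⟶ (transition (k ≫ l)).obj B.toGCat :=
      ObjectProperty.homMk a'
    let me : (transition (k ≫ l)).obj B.toGCat ⟶ (transition (k' ≫ l')).obj B.toGCat :=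
      ObjectProperty.homMk e
    let mb : (transition (k' ≫ l')).obj B.toGCat ⟶ (transition (k' ≫ m)).obj C.toGCat :=
      ObjectProperty.homMk b'
    have e2 : (d.leg 𝒵).inv.map me = (d.iso (k ≫ l)).hom.app B.toGCat ≫
        (d.iso (k' ≫ l')).inv.app B.toGCat := by
      have e3 : (d.iso (k ≫ l)).inv.app B.toGCat ≫ (d.leg 𝒵).inv.map me ≫
        (d.iso (k' ≫ l')).hom.app B.toGCat = 𝟙 _ := e1
      have e4 := ((d.iso (k ≫ l)).app B.toGCat).inv_comp_eq.1 e3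
      exact (((d.iso (k' ≫ l')).app B.toGCat).eq_comp_inv.2
        (e4.trans (Category.comp_id _)))
    change (d.iso (k ≫ h)).inv.app A.toGCat ≫ (d.leg 𝒵).inv.map (ma ≫ me ≫ mb) ≫
        (d.iso (k' ≫ m)).hom.app C.toGCat =
      ((d.iso (k ≫ h)).inv.app A.toGCat ≫ (d.leg 𝒵).inv.map ma ≫
        (d.iso (k ≫ l)).hom.app B.toGCat) ≫ (d.iso (k' ≫ l')).inv.app B.toGCat ≫
          (d.leg 𝒵).inv.map mb ≫ (d.iso (k' ≫ m)).hom.app C.toGCat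
    rw [Functor.map_comp, Functor.map_comp, e2]
    simp only [Category.assoc]
  · have : (a' ≫ e ≫ b').f = a'.f ≫ e.f ≫ b'.f := rfl
    rw [this, he, ha', hb']
    exact (congrArg (fun r => a.f ≫ r) (Category.id_comp _)).symm

variable (d) in
/-- The functor on `cG(E)` defined by a pseudo-cone. -/
def functor : CG E ⥤ T where
  obj A := (d.leg A.cover).inv.obj A.toGCat
  map {A B} f := d.lift f.2.choose_spec.choose f.2.choose_spec.choose_spec.choose
    f.2.choose_spec.choose_spec.choose_spec.choose
  map_id A := by
    rw [← lift_id A (𝟙 A.cover)]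
    exact lift_eq (𝟙 A : A ⟶ A).2.choose_spec.choose_spec.choose_spec.choose_spec
  map_comp {A B C} f g := by
    refine lift_comp ?_
    refine ((f ≫ g).2.choose_spec.choose_spec.choose_spec.choose_spec).trans ?_
    exact (congrArg₂ (fun (r : A.obj.X ⟶ B.obj.X) (s : B.obj.X ⟶ C.obj.X) => r ≫ s)
      f.2.choose_spec.choose_spec.choose_spec.choose_spec
      g.2.choose_spec.choose_spec.choose_spec.choose_spec).symm

lemma functor_map {A B : CG E} (f : A ⟶ B) {h : 𝒲 ⟶ A.cover} {l : 𝒲 ⟶ B.cover}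
    {a : (LocConst.pullback h).obj A.obj ⟶ (LocConst.pullback l).obj B.obj} (ha : a.f = f.1) :
    d.functor.map f = d.lift h l a :=
  lift_eq ((Exists.choose_spec f.2.choose_spec.choose_spec.choose_spec).trans ha.symm)

lemma functor_map_lam {X Y : CovProj 𝒰} (f : X ⟶ Y) :
    d.functor.map ((lam 𝒰).map f) = (d.leg 𝒰).inv.map ((incl 𝒰).map f) := by
  rw [functor_map (d := d) ((lam 𝒰).map f) (h := 𝟙 𝒰) (l := 𝟙 𝒰)
    (a := (LocConst.pullback (𝟙 𝒰)).map f.hom) rfl]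
  exact ((d.iso (𝟙 𝒰)).app ((incl 𝒰).obj X)).inv_comp_eq.2
    ((d.iso (𝟙 𝒰)).hom.naturality ((incl 𝒰).map f))

lemma functor_map_lamIso (h : 𝒰 ⟶ 𝒱) (X : CovProj 𝒱) :
    d.functor.map (lamIso h X).hom = (d.iso h).hom.app ((incl 𝒱).obj X) := by
  rw [functor_map (d := d) (lamIso h X).hom (h := 𝟙 𝒰) (l := h)
    (a := (LocConst.pullbackIdIso ((LocConst.pullback h).obj X.obj)).hom) rfl]
  refine ((d.iso (𝟙 𝒰)).app ((transition h).obj ((incl 𝒱).obj X))).inv_comp_eq.2 ?_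
  exact congrArg (fun r => r ≫ (d.iso h).hom.app ((incl 𝒱).obj X))
    (d.iso_id 𝒰 ((transition h).obj ((incl 𝒱).obj X))).symm

variable (d) in
/-- The functor defined by a pseudo-cone extends its legs. -/
def lamFunctorIso (𝒰 : Cover E) : lam 𝒰 ⋙ d.functor ≅ incl 𝒰 ⋙ (d.leg 𝒰).inv :=
  NatIso.ofComponents (fun _ => Iso.refl _) fun f =>
    (Category.comp_id _).trans ((functor_map_lam f).trans (Category.id_comp _).symm)

instance : PreservesFiniteLimits (incl 𝒰) :=
  LocConst.preservesFiniteLimits_of_stalkPullback _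
    (LocConst.isTerminal_of_unique _ (fun _ => PUnit.unit) fun _ _ => rfl)
    fun _ _ _ _ h => LocConst.IsStalkPullback.isPullback_GCat h

instance : PreservesFiniteLimits d.functor :=
  CG.preservesFiniteLimits_of_lam _ fun 𝒰 => by
    have := (d.leg 𝒰).lex
    have : PreservesFiniteLimits (incl 𝒰 ⋙ (d.leg 𝒰).inv) := comp_preservesFiniteLimits _ _
    exact preservesFiniteLimits_of_natIso (d.lamFunctorIso 𝒰).symm

end PseudoCone

/-- The sieves whose pullbacks are sent to epimorphic families by a functor form a topology. -/
def epiTopology {C : Type w} [Category.{v} C] (F : C ⥤ T) : GrothendieckTopology C where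
  sieves X := {S | ∀ ⦃Y : C⦄ (g : Y ⟶ X) ⦃Z : T⦄ (p q : F.obj Y ⟶ Z),
    (∀ ⦃W : C⦄ (k : W ⟶ Y), S (k ≫ g) → F.map k ≫ p = F.map k ≫ q) → p = q}
  top_mem' X Y g Z p q h := by simpa using h (𝟙 Y) trivial
  pullback_stable' X Y S f hS W g Z p q h := hS (g ≫ f) p q fun V k hk => h k (by
    change S ((k ≫ g) ≫ f)
    simpa using hk)
  transitive' X S hS R hR Y g Z p q h := hS g p q fun W k hk =>
    hR hk (𝟙 W) _ _ fun V m hm => by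
      have hm' : R ((m ≫ k) ≫ g) := by
        have : R ((m ≫ 𝟙 W) ≫ k ≫ g) := hm
        simpa using this
      have := h (m ≫ k) hm'
      rw [Functor.map_comp, Category.assoc, Category.assoc] at this
      exact this

/-- By minimality of `topology E`, it is enough that the generating families lie in `epiTopology
d.functor`. The legs preserve epimorphic families, and pullbacks of these stay epimorphic because
the functor preserves pullbacks. -/
lemma PseudoCone.epiOnCovers_functor [IsGrothendieckTopos.{u} T] :
    EpiOnCovers (topology E) d.functor := by
  have hle : topology E ≤ epiTopology d.functor := by
    refine sInf_le fun 𝒰 X A Y f hf W g Z p q h => ?_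
    have h1 : EpiFamily fun a => d.functor.map ((lam 𝒰).map (f a)) := by
      simp only [functor_map_lam]
      exact hf.map_leftAdjoint (d.leg 𝒰).adj
    refine h1.baseChange (d.functor.map g) p q fun a V k l e => ?_
    have sq := (IsPullback.of_hasPullback g ((lam 𝒰).map (f a))).map d.functor
    rw [← sq.lift_fst k l e, Category.assoc, Category.assoc]
    refine congrArg (fun r => sq.lift k l e ≫ r) (h _ ?_)
    rw [pullback.condition]
    exact Sieve.downward_closed _ (Sieve.ofArrows_mk _ _ a) _
  intro X S hS Z p q h
  exact hle X hS (𝟙 X) p q fun W k hk => h ⟨⟨W, k⟩, by simpa using hk⟩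

end Cone

/-! ### Pseudo-cones and functors on `cG(E)` -/

section Extends

variable {E : Type (u + 1)} [Category.{u} E] [IsGrothendieckTopos.{u} E] {𝒰 𝒱 𝒲 : Cover E}

variable {T : Type w'} [Category.{v'} T] {T' : Type w''} [Category.{v''} T']

namespace CG

/-- An object of `cG(E)` as a covering projection. -/
abbrev toCovProj (A : CG E) : CovProj A.cover := ⟨A.obj, A.covering⟩

/-- Up to the isomorphisms `lamIso`, every arrow of cG(E) comes from a single category of covering
projections. Naturality on cG(E) is thereby reduced to these categories and to compatibility with
`lamIso`. -/
lemma fac {A B : CG E} (f : A ⟶ B) {h : 𝒲 ⟶ A.cover} {l : 𝒲 ⟶ B.cover}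
    {a : (LocConst.pullback h).obj A.obj ⟶ (LocConst.pullback l).obj B.obj} (ha : a.f = f.1) :
    (lamIso h A.toCovProj).hom ≫ f = (lam 𝒲).map (X := (covPullback h).obj A.toCovProj)
      (Y := (covPullback l).obj B.toCovProj) (ObjectProperty.homMk a) ≫
        (lamIso l B.toCovProj).hom :=
  hom_ext ((Category.id_comp f.1).trans (ha.symm.trans (Category.comp_id _).symm))

lemma lamIso_naturality (h : 𝒰 ⟶ 𝒱) {X Y : CovProj 𝒱} (f : X ⟶ Y) :
    (lam 𝒰).map ((covPullback h).map f) ≫ (lamIso h Y).hom = (lamIso h X).hom ≫ (lam 𝒱).map f :=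
  hom_ext ((Category.comp_id f.hom.f).trans (Category.id_comp _).symm)

/-- The isomorphisms `lamIso` as a natural isomorphism. -/
def lamNatIso (h : 𝒰 ⟶ 𝒱) : covPullback h ⋙ lam 𝒰 ≅ lam 𝒱 :=
  NatIso.ofComponents (fun X => lamIso h X) fun f => lamIso_naturality h f

end CG

/-- A pseudo-cone extends a functor on `cG(E)`. -/
structure PseudoCone.Extension (d : PseudoCone E T) (G : CG E ⥤ T) where
  ι : ∀ 𝒰 : Cover E, lam 𝒰 ⋙ G ≅ incl 𝒰 ⋙ (d.leg 𝒰).inv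
  comm : ∀ {𝒰 𝒱 : Cover E} (h : 𝒰 ⟶ 𝒱) (X : CovProj 𝒱),
    (ι 𝒰).hom.app ((covPullback h).obj X) ≫ (d.iso h).hom.app ((incl 𝒱).obj X) =
      G.map (lamIso h X).hom ≫ (ι 𝒱).hom.app X

namespace PseudoCone

variable {d d' : PseudoCone E T} {G G' : CG E ⥤ T}

lemma hom_ext_incl {τ τ' : d ⟶ d'} (H : ∀ (𝒰 : Cover E) (X : CovProj 𝒰),
    NatTrans.app (PseudoCone.Hom.τ τ 𝒰) ((incl 𝒰).obj X) =
      NatTrans.app (PseudoCone.Hom.τ τ' 𝒰) ((incl 𝒰).obj X)) : τ = τ' :=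
  PseudoCone.Hom.ext (funext fun 𝒰 =>
    (LocConst.homDense_incl 𝒰).natTrans_ext (d.leg 𝒰).adj fun X => H 𝒰 X)

namespace Extension

variable (e : Extension d G) (e' : Extension d' G')

theorem exists_hom (φ : G ⟶ G') : ∃ τ : d ⟶ d', ∀ (𝒰 : Cover E) (X : CovProj 𝒰),
    NatTrans.app (PseudoCone.Hom.τ τ 𝒰) ((incl 𝒰).obj X) =
      (e.ι 𝒰).inv.app X ≫ φ.app ((lam 𝒰).obj X) ≫ (e'.ι 𝒰).hom.app X := by
  have H : ∀ 𝒰 : Cover E, ∃ t : (d.leg 𝒰).inv ⟶ (d'.leg 𝒰).inv, ∀ X : CovProj 𝒰,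
      t.app ((incl 𝒰).obj X) =
        (e.ι 𝒰).inv.app X ≫ φ.app ((lam 𝒰).obj X) ≫ (e'.ι 𝒰).hom.app X := fun 𝒰 =>
    (LocConst.homDense_incl 𝒰).exists_natTrans (d.leg 𝒰).adj
      ((e.ι 𝒰).inv ≫ Functor.whiskerLeft (lam 𝒰) φ ≫ (e'.ι 𝒰).hom)
  choose t ht using H
  refine ⟨⟨t, fun {𝒰 𝒱} h X => ?_⟩, ht⟩
  -- Compatibility with the structural 2-cells is checked on covering projections. The source is
  -- isomorphic to a leg through `d.iso h`, hence is a left adjoint.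
  have key : (d.iso h).hom ≫ t 𝒱 = Functor.whiskerLeft (transition h) (t 𝒰) ≫ (d'.iso h).hom := by
    refine (LocConst.homDense_incl 𝒱).natTrans_ext
      ((d.leg 𝒱).adj.ofNatIsoLeft (d.iso h).symm) fun X => ?_
    have e1 := ht 𝒱 X
    have e2 : (t 𝒰).app ((transition h).obj ((incl 𝒱).obj X)) = _ := ht 𝒰 ((covPullback h).obj X)
    have e3 := e.comm h X
    have e4 := e'.comm h X
    have e5 := φ.naturality (lamIso h X).hom
    change (d.iso h).hom.app _ ≫ (t 𝒱).app _ =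
      (t 𝒰).app ((transition h).obj ((incl 𝒱).obj X)) ≫ (d'.iso h).hom.app _
    rw [e1, e2]
    refine (cancel_epi ((e.ι 𝒰).hom.app ((covPullback h).obj X))).1 ?_
    refine (Category.assoc _ _ _).symm.trans ((congrArg (fun r => r ≫ _) e3).trans ?_)
    refine (Category.assoc _ _ _).trans ((congrArg (fun r => _ ≫ r)
      ((e.ι 𝒱).hom_inv_id_app_assoc X _)).trans ?_)
    refine (Category.assoc _ _ _).symm.trans ((congrArg (fun r => r ≫ _) e5).trans ?_)
    refine (Category.assoc _ _ _).trans ((congrArg (fun r => _ ≫ r) e4.symm).trans ?_)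
    refine ((congrArg (fun r => _ ≫ r) (Category.assoc _ _ _)).trans
      (((e.ι 𝒰).hom_inv_id_app_assoc _ _).trans (Category.assoc _ _ _))).symm
  exact congrArg (fun r => r.app X) key

theorem exists_iso (e : Extension d G) (e' : Extension d' G') (φ : G ≅ G') : Nonempty (d ≅ d') := by
  obtain ⟨τ, hτ⟩ := e.exists_hom e' φ.hom
  obtain ⟨τ', hτ'⟩ := e'.exists_hom e φ.inv
  have key : ∀ {d d' : PseudoCone E T} {G G' : CG E ⥤ T} (e : Extension d G)
      (e' : Extension d' G') (φ : G ≅ G') (τ : d ⟶ d') (τ' : d' ⟶ d),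
      (∀ (𝒰 : Cover E) (X : CovProj 𝒰),
        NatTrans.app (PseudoCone.Hom.τ τ 𝒰) ((incl 𝒰).obj X) =
          (e.ι 𝒰).inv.app X ≫ φ.hom.app ((lam 𝒰).obj X) ≫ (e'.ι 𝒰).hom.app X) →
      (∀ (𝒰 : Cover E) (X : CovProj 𝒰),
        NatTrans.app (PseudoCone.Hom.τ τ' 𝒰) ((incl 𝒰).obj X) =
          (e'.ι 𝒰).inv.app X ≫ φ.inv.app ((lam 𝒰).obj X) ≫ (e.ι 𝒰).hom.app X) →
      τ ≫ τ' = 𝟙 d := by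
    intro d d' G G' e e' φ τ τ' hτ hτ'
    refine hom_ext_incl fun 𝒰 X => ?_
    change NatTrans.app (PseudoCone.Hom.τ τ 𝒰) ((incl 𝒰).obj X) ≫
      NatTrans.app (PseudoCone.Hom.τ τ' 𝒰) ((incl 𝒰).obj X) = 𝟙 _
    rw [hτ, hτ']
    refine (Category.assoc _ _ _).trans ((congrArg (fun r => _ ≫ r)
      ((Category.assoc _ _ _).trans (congrArg (fun r => _ ≫ r)
        ((e'.ι 𝒰).hom_inv_id_app_assoc X _)))).trans ?_)
    refine (congrArg (fun r => _ ≫ r) (φ.hom_inv_id_app_assoc _ _)).trans ?_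
    exact (e.ι 𝒰).inv_hom_id_app X
  exact ⟨⟨τ, τ', key e e' φ τ τ' hτ hτ', key e' e φ.symm τ' τ hτ' hτ⟩⟩

theorem exists_natTrans (τ : d ⟶ d') : ∃ φ : G ⟶ G', ∀ (𝒰 : Cover E) (X : CovProj 𝒰),
    φ.app ((lam 𝒰).obj X) ≫ (e'.ι 𝒰).hom.app X =
      (e.ι 𝒰).hom.app X ≫ NatTrans.app (PseudoCone.Hom.τ τ 𝒰) ((incl 𝒰).obj X) := by
  let t : ∀ 𝒰 : Cover E, lam 𝒰 ⋙ G ⟶ lam 𝒰 ⋙ G' := fun 𝒰 =>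
    (e.ι 𝒰).hom ≫ Functor.whiskerLeft (incl 𝒰)
      (show (d.leg 𝒰).inv ⟶ (d'.leg 𝒰).inv from PseudoCone.Hom.τ τ 𝒰) ≫ (e'.ι 𝒰).inv
  have ht : ∀ (𝒰 : Cover E) (X : CovProj 𝒰), (t 𝒰).app X ≫ (e'.ι 𝒰).hom.app X =
      (e.ι 𝒰).hom.app X ≫ NatTrans.app (PseudoCone.Hom.τ τ 𝒰) ((incl 𝒰).obj X) := by
    intro 𝒰 X
    refine (Category.assoc _ _ _).trans (congrArg (fun r => _ ≫ r) ?_)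
    refine (Category.assoc _ _ _).trans ((congrArg (fun r => _ ≫ r)
      ((e'.ι 𝒰).inv_hom_id_app X)).trans (Category.comp_id _))
  have hl : ∀ {𝒰 𝒱 : Cover E} (h : 𝒰 ⟶ 𝒱) (X : CovProj 𝒱),
      G.map (lamIso h X).hom ≫ (t 𝒱).app X =
        (t 𝒰).app ((covPullback h).obj X) ≫ G'.map (lamIso h X).hom := by
    intro 𝒰 𝒱 h X
    have e1 := PseudoCone.Hom.comm τ h ((incl 𝒱).obj X)
    refine (cancel_mono ((e'.ι 𝒱).hom.app X)).1 ?_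
    refine (Category.assoc _ _ _).trans ((congrArg (fun r => _ ≫ r) (ht 𝒱 X)).trans ?_)
    refine (Category.assoc _ _ _).symm.trans ((congrArg (fun r => r ≫ _) (e.comm h X).symm).trans ?_)
    refine (Category.assoc _ _ _).trans ((congrArg (fun r => _ ≫ r) e1).trans ?_)
    refine (Category.assoc _ _ _).symm.trans ((congrArg (fun r => r ≫ _)
      (ht 𝒰 ((covPullback h).obj X)).symm).trans ?_)
    exact (Category.assoc _ _ _).trans ((congrArg (fun r => _ ≫ r) (e'.comm h X)).trans
      (Category.assoc _ _ _).symm)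
  -- Each object carries its own cover, which supplies the component. Naturality follows from
  -- `CG.fac`, from `hl` for the two refinements and from naturality over the common cover.
  refine ⟨⟨fun A => (t A.cover).app A.toCovProj, fun A B f => ?_⟩, ht⟩
  obtain ⟨𝒲, h, l, a, ha⟩ := f.2
  have e1 := CG.fac f ha
  have e2 := hl h A.toCovProj
  have e3 := hl l B.toCovProj
  have e4 := (t 𝒲).naturality (X := (covPullback h).obj A.toCovProj)
    (Y := (covPullback l).obj B.toCovProj) (ObjectProperty.homMk a)
  refine (cancel_epi (G.map (lamIso h A.toCovProj).hom)).1 ?_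
  refine (Category.assoc _ _ _).symm.trans ((congrArg (fun r => r ≫ _)
    ((G.map_comp _ _).symm.trans ((congrArg G.map e1).trans (G.map_comp _ _)))).trans ?_)
  refine (Category.assoc _ _ _).trans ((congrArg (fun r => _ ≫ r) e3).trans ?_)
  refine (Category.assoc _ _ _).symm.trans ((congrArg (fun r => r ≫ _) e4).trans ?_)
  refine (Category.assoc _ _ _).trans ((congrArg (fun r => _ ≫ r)
    ((G'.map_comp _ _).symm.trans ((congrArg G'.map e1.symm).trans (G'.map_comp _ _)))).trans ?_)
  exact (Category.assoc _ _ _).symm.trans ((congrArg (fun r => r ≫ _) e2.symm).trans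
    (Category.assoc _ _ _))

/-- Pseudo-cones extending a functor, composed with a geometric morphism. -/
def precomp (p : GeomMorphism T' T) : Extension ((d.precomp T').obj p) (G ⋙ p.inv) where
  ι 𝒰 := Functor.isoWhiskerRight (e.ι 𝒰) p.inv
  comm h X := (p.inv.map_comp _ _).symm.trans ((congrArg p.inv.map (e.comm h X)).trans
    (p.inv.map_comp _ _))

end Extension

variable (d) in
/-- A pseudo-cone extends the functor which it defines. -/
def extensionFunctor : Extension d d.functor where
  ι := d.lamFunctorIso
  comm h X := (Category.id_comp _).trans
    ((functor_map_lamIso h X).symm.trans (Category.comp_id _).symm)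

/-- A functor whose restrictions extend to geometric morphisms extends to a pseudo-cone. -/
theorem exists_extension (G : CG E ⥤ T) (p : ∀ 𝒰 : Cover E, GeomMorphism T (GCat 𝒰))
    (α : ∀ 𝒰 : Cover E, lam 𝒰 ⋙ G ≅ incl 𝒰 ⋙ (p 𝒰).inv) :
    ∃ d : PseudoCone E T, Nonempty (Extension d G) := by
  -- On covering projections the structural 2-cell is forced to be the image of `lamIso`. It extends
  -- to G_𝒱 by density, since the transition functor is itself an inverse image; the two coherence
  -- laws are then identities already valid in cG(E).
  let a : ∀ {𝒰 𝒱 : Cover E} (h : 𝒰 ⟶ 𝒱),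
      incl 𝒱 ⋙ transition h ⋙ (p 𝒰).inv ≅ incl 𝒱 ⋙ (p 𝒱).inv := fun {𝒰 𝒱} h =>
    (Functor.isoWhiskerLeft (covPullback h) (α 𝒰)).symm ≪≫
      Functor.isoWhiskerRight (CG.lamNatIso h) G ≪≫ α 𝒱
  have adj : ∀ (𝒰 𝒱 : Cover E) (h : 𝒰 ⟶ 𝒱), ∃ R, Nonempty ((transition h ⋙ (p 𝒰).inv) ⊣ R) := by
    intro 𝒰 𝒱 h
    obtain ⟨q, hq⟩ := LocConst.exists_geomMorphism_transition h
    exact ⟨_, ⟨(hq ▸ q.adj : transition h ⊣ q.dir).comp (p 𝒰).adj⟩⟩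
  choose R adj using adj
  have H : ∀ (𝒰 𝒱 : Cover E) (h : 𝒰 ⟶ 𝒱), ∃ β : transition h ⋙ (p 𝒰).inv ≅ (p 𝒱).inv,
      ∀ X, (α 𝒰).hom.app ((covPullback h).obj X) ≫ β.hom.app ((incl 𝒱).obj X) =
        G.map (lamIso h X).hom ≫ (α 𝒱).hom.app X := by
    intro 𝒰 𝒱 h
    obtain ⟨β, hβ⟩ := (LocConst.homDense_incl 𝒱).exists_natIso (adj 𝒰 𝒱 h).some (p 𝒱).adj (a h)
    exact ⟨β, fun X => (congrArg (fun r => _ ≫ r) (hβ X)).trans ((α 𝒰).hom_inv_id_app_assoc _ _)⟩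
  choose β hβ using H
  refine ⟨⟨p, fun h => β _ _ h, fun 𝒰 X => ?_, fun {𝒰 𝒱 𝒲} h k X => ?_⟩, ⟨⟨α, fun h => hβ _ _ h⟩⟩⟩
  · let b : transition (𝟙 𝒰) ⋙ (p 𝒰).inv ⟶ (p 𝒰).inv :=
      { app := fun X => (p 𝒰).inv.map (transitionId X).hom
        naturality := fun X Y f => ((p 𝒰).inv.map_comp _ _).symm.trans
          ((congrArg (p 𝒰).inv.map (ObjectProperty.hom_ext _ (LocConst.hom_ext_f
            ((Category.comp_id f.hom.f).trans (Category.id_comp _).symm)))).trans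
              ((p 𝒰).inv.map_comp _ _)) }
    have key : (β _ _ (𝟙 𝒰)).hom = b :=
      (LocConst.homDense_incl 𝒰).natTrans_ext (adj _ _ (𝟙 𝒰)).some fun X => by
        refine (cancel_epi ((α 𝒰).hom.app ((covPullback (𝟙 𝒰)).obj X))).1 ((hβ _ _ _ X).trans ?_)
        have e1 : (lamIso (𝟙 𝒰) X).hom = (lam 𝒰).map (X := (covPullback (𝟙 𝒰)).obj X) (Y := X)
          (ObjectProperty.homMk (LocConst.pullbackIdIso X.obj).hom) := CG.hom_ext rfl
        rw [e1]
        exact (α 𝒰).hom.naturality (X := (covPullback (𝟙 𝒰)).obj X) (Y := X)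
          (ObjectProperty.homMk (LocConst.pullbackIdIso X.obj).hom)
    exact congrArg (fun r => r.app X) key
  · let b : transition (h ≫ k) ⋙ (p 𝒰).inv ⟶ transition k ⋙ transition h ⋙ (p 𝒰).inv :=
      { app := fun X => (p 𝒰).inv.map (transitionComp h k X).hom
        naturality := fun X Y f => ((p 𝒰).inv.map_comp _ _).symm.trans
          ((congrArg (p 𝒰).inv.map (ObjectProperty.hom_ext _ (LocConst.hom_ext_f
            ((Category.comp_id f.hom.f).trans (Category.id_comp _).symm)))).trans
              ((p 𝒰).inv.map_comp _ _)) }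
    have key : (β _ _ (h ≫ k)).hom = b ≫ Functor.whiskerLeft (transition k) (β _ _ h).hom ≫ (β _ _ k).hom :=
      (LocConst.homDense_incl 𝒲).natTrans_ext (adj _ _ (h ≫ k)).some fun X => by
        refine (cancel_epi ((α 𝒰).hom.app ((covPullback (h ≫ k)).obj X))).1 ((hβ _ _ _ X).trans ?_)
        let m : (covPullback (h ≫ k)).obj X ⟶ (covPullback h).obj ((covPullback k).obj X) :=
          ObjectProperty.homMk (LocConst.pullbackCompIso h k X.obj).hom
        have e1 : (lamIso (h ≫ k) X).hom = (lam 𝒰).map m ≫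
            (lamIso h ((covPullback k).obj X)).hom ≫ (lamIso k X).hom :=
          CG.hom_ext ((Category.id_comp _).trans (Category.id_comp _)).symm
        have e2 := (α 𝒰).hom.naturality m
        have e3 := hβ _ _ h ((covPullback k).obj X)
        have e4 := hβ _ _ k X
        rw [e1, G.map_comp, G.map_comp]
        refine (Category.assoc _ _ _).trans ((congrArg (fun r => G.map ((lam 𝒰).map m) ≫ r)
          ((Category.assoc _ _ _).trans ((congrArg (fun r => _ ≫ r) e4.symm).trans
            ((Category.assoc _ _ _).symm.trans ((congrArg (fun r => r ≫ _) e3.symm).trans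
              (Category.assoc _ _ _)))))).trans ?_)
        exact (Category.assoc _ _ _).symm.trans ((congrArg (fun r => r ≫ _) e2).trans
          (Category.assoc _ _ _))
    exact congrArg (fun r => r.app X) key

end PseudoCone

end Extends

/-! ### The canonical pseudo-cone and its universal property -/

section Canonical

variable {E : Type (u + 1)} [Category.{u} E] [IsGrothendieckTopos.{u} E]

namespace CG

/-- The image of a stalkwise surjective sieve generates a covering sieve of cG(E), and sheafified
Yoneda is epimorphic on covers. -/
lemma epiOnCovers_lam (𝒰 : Cover E) :
    EpiOnCovers (LocConst.stalkTop 𝒰) (lam 𝒰 ⋙ ayoneda (topology E)) := by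
  intro X S hS Z p q h
  have h1 : S.functorPushforward (lam 𝒰) ∈ topology E ((lam 𝒰).obj X) :=
    lam_mem_topology hS fun Y f hf => Sieve.image_mem_functorPushforward _ _ hf
  refine epiOnCovers_ayoneda (topology E) h1 p q ?_
  rintro ⟨⟨Y, k⟩, Z, f, g, hf, e⟩
  replace e : k = g ≫ (lam 𝒰).map f := e
  have := h ⟨⟨Z, f⟩, hf⟩
  change (ayoneda (topology E)).map k ≫ p = (ayoneda (topology E)).map k ≫ q
  rw [e, Functor.map_comp, Category.assoc, Category.assoc]
  exact congrArg (fun r => _ ≫ r) this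

end CG

variable (E) in
theorem exists_extension_ayoneda :
    ∃ c : PseudoCone E (GTopos E), Nonempty (c.Extension (ayoneda (topology E))) := by
  have H : ∀ 𝒰 : Cover E, ∃ p : GeomMorphism (GTopos E) (GCat 𝒰),
      Nonempty (lam 𝒰 ⋙ ayoneda (topology E) ≅ incl 𝒰 ⋙ p.inv) := fun 𝒰 => by
    have := isGrothendieckTopos_GTopos E
    have : PreservesFiniteLimits (ayoneda (topology E)) := inferInstance
    have : PreservesFiniteLimits (lam 𝒰 ⋙ ayoneda (topology E)) := comp_preservesFiniteLimits _ _
    exact LocConst.exists_geomMorphism_GCat _ (CG.epiOnCovers_lam 𝒰)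
  choose p α using H
  exact PseudoCone.exists_extension _ p fun 𝒰 => (α 𝒰).some

namespace PseudoCone

variable {c : PseudoCone E (GTopos E)} (e : c.Extension (ayoneda (topology E)))

include e

/-- The required η is the unit of sheafification followed by the extension isomorphism, and the unit
belongs to `W`. -/
theorem Extension.isCanonical : c.IsCanonical := by
  refine ⟨fun 𝒰 => Functor.whiskerLeft (lam 𝒰 ⋙ yoneda)
      (toSheafification (topology E) (Type u)) ≫
    Functor.whiskerRight (e.ι 𝒰).hom (sheafToPresheaf (topology E) (Type u)), ?_, ?_⟩
  · intro 𝒰 X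
    exact MorphismProperty.comp_mem _ _ _ ((topology E).W_toSheafify _)
      (MorphismProperty.of_isIso _ ((sheafToPresheaf _ _).map ((e.ι 𝒰).hom.app X)))
  · intro 𝒰 𝒱 h X
    have e1 := congrArg (sheafToPresheaf (topology E) (Type u)).map (e.comm h X)
    have e2 := toSheafify_naturality (topology E) (yoneda.map (lamIso h X).hom)
    refine (Category.assoc _ _ _).trans ((congrArg (fun r => _ ≫ r) e1).trans ?_)
    exact (Category.assoc _ _ _).symm.trans ((congrArg (fun r => r ≫ _) e2.symm).trans
      (Category.assoc _ _ _))

/-- 2-cells between inverse images on G(E) are determined by, and extend from, representables, where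
the extension isomorphisms translate them into morphisms of pseudo-cones. A pseudo-cone d comes from
a geometric morphism because `d.functor` satisfies the hypotheses of `exists_geomMorphism`. -/
theorem Extension.isLimit : PseudoCone.IsLimit.{w, v} c := by
  intro T _ _
  have := isGrothendieckTopos_GTopos E
  have faithful : (c.precomp T).Faithful := ⟨fun {p q f g} h =>
    (homDense_ayoneda (topology E)).natTrans_ext (P := p.inv) (Q := q.inv) p.adj fun A => by
      have e1 : p.inv.map ((e.ι A.cover).hom.app A.toCovProj) ≫ NatTrans.app f _ =
        NatTrans.app f _ ≫ q.inv.map ((e.ι A.cover).hom.app A.toCovProj) := NatTrans.naturality f _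
      have e2 : p.inv.map ((e.ι A.cover).hom.app A.toCovProj) ≫ NatTrans.app g _ =
        NatTrans.app g _ ≫ q.inv.map ((e.ι A.cover).hom.app A.toCovProj) := NatTrans.naturality g _
      have e3 : NatTrans.app f ((c.leg A.cover).inv.obj ((incl A.cover).obj A.toCovProj)) =
          NatTrans.app g ((c.leg A.cover).inv.obj ((incl A.cover).obj A.toCovProj)) :=
        congrArg (fun r => NatTrans.app (PseudoCone.Hom.τ r A.cover) ((incl A.cover).obj A.toCovProj)) h
      exact (cancel_mono (q.inv.map ((e.ι A.cover).hom.app A.toCovProj))).1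
        (e1.symm.trans ((congrArg (fun r => _ ≫ r) e3).trans e2))⟩
  have full : (c.precomp T).Full := ⟨fun {p q} τ => by
    obtain ⟨φ, hφ⟩ := (e.precomp p).exists_natTrans (e.precomp q) τ
    obtain ⟨β, hβ⟩ := (homDense_ayoneda (topology E)).exists_natTrans p.adj φ
    refine ⟨β, hom_ext_incl fun 𝒰 X => ?_⟩
    have e1 := β.naturality ((e.ι 𝒰).hom.app X)
    refine (cancel_epi (p.inv.map ((e.ι 𝒰).hom.app X))).1 ?_
    exact e1.trans ((congrArg (fun r => r ≫ _) (hβ ((lam 𝒰).obj X))).trans (hφ 𝒰 X))⟩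
  have surj : (c.precomp T).EssSurj := ⟨fun d => by
    obtain ⟨p, ⟨α⟩⟩ := exists_geomMorphism d.functor d.epiOnCovers_functor
    exact ⟨p, Extension.exists_iso (e.precomp p) d.extensionFunctor α.symm⟩⟩
  exact ⟨faithful, full, surj⟩

end PseudoCone

end Canonical

end FundTopos

end

theorem mainTheorem6 {E : Type (u + 1)} [Category.{u} E]
    [IsGrothendieckTopos.{u} E] :
    (∀ 𝒰 : Cover E, IsGrothendieckTopos.{u} (GCat 𝒰)) ∧
    IsGrothendieckTopos.{u} (GTopos E) ∧
    (∀ {𝒰 𝒱 : Cover E} (h : 𝒰 ⟶ 𝒱), ∃ p : GeomMorphism (GCat 𝒰) (GCat 𝒱),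
      p.inv = transition h) ∧
    ∃ c : PseudoCone E (GTopos E), c.IsCanonical ∧ PseudoCone.IsLimit.{w, v} c := by
  obtain ⟨c, ⟨e⟩⟩ := exists_extension_ayoneda E
  exact ⟨fun 𝒰 => inferInstance, isGrothendieckTopos_GTopos E,
    fun h => LocConst.exists_geomMorphism_transition h, c, e.isCanonical, e.isLimit⟩
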